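/- Let $M$ be a smooth manifold without boundary (Hausdorff, $\sigma$-compact, finite-dimensional), let $\pi$, $\alpha_1$, $\alpha$ be smooth real vector bundles of finite rank over $M$, and let $J^\infty(\pi)$ be the space of infinite jets $j^\infty_x s$ of sections of $\pi$, with projection $\pi_\infty\colon J^\infty(\pi)\to M$ and the inverse limit topology. Smooth functions and sections on open subsets of $J^\infty(\pi)$ are those which locally are smooth functions of the jet coordinates up to some finite order (one order for the whole function). Let $F$ be a smooth section of $\pi_\infty^*(\alpha_1)$ over $J^\infty(\pi)$, and let $\mathcal E^\infty\subset J^\infty(\pi)$ be the infinite prolongation of the equation $F=0$, that is, the set of points where all total derivatives $D_\sigma F$ vanish. Regularity condition: there are an open set $\mathcal U\supset\mathcal E^\infty$ in $J^\infty(\pi)$, a star-shaped open neighbourhood $\mathcal V$ of zero in $\mathbb R^\infty$ and an isomorphism (a homeomorphism that is smooth in both directions) $\nu\colon\mathcal U\to\mathcal E^\infty\times\mathcal V$ such that $\nu(\theta)=(\theta,0)$ for $\theta\in\mathcal E^\infty$, and such that the second component $v=(v_1,v_2,\dots)$ of $\nu$ consists of functions $v_s=D_{\sigma_s}(F_{i_s})$,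 that is, iterated total derivatives along vector fields on $M$ of components of $F$ (pairings of $F$ with sections of $\alpha_1^*$). Fix such data. Let $\mathcal F$ be the algebra of smooth functions on $\mathcal U$, and let $P_1$, $Q$, $\kappa$ be the modules of smooth sections over $\mathcal U$ of $\pi_\infty^*(\alpha_1)$, $\pi_\infty^*(\alpha)$, $\pi_\infty^*(\pi)$. A $\mathcal C$-differential operator is one which in local coordinates has the form $\sum_\sigma a_\sigma D_\sigma$ with smooth coefficients and bounded order; $\mathcal C\mathrm{Diff}(\cdot,\cdot)$ is the module of such operators. Put $\mathcal I=\{\Delta(F)\mid\Delta\in\mathcal C\mathrm{Diff}(P_1,\mathcal F)\}\subset\mathcal F$ and $Q'=\{\pi_\infty^*(s)|_{\mathcal U}\mid s\in\Gamma(\alpha)\}\subset Q$. For $q\in Q$ let $\ell_q=\sum_{j,\sigma}\frac{\partial q}{\partial u^j_\sigma}D_\sigma$ be its linearization, an operator from $\kappa$ to $Q$, and let $K\subset Q$ be the kernel of $q\mapsto\ell_q|_{\mathcal E^\infty}$, i.e. the set of $q\in Q$ such that $\ell_q(\varphi)$ vanishes on $\mathcal E^\infty$ for all $\varphi\in\kappa$.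 Then: (1) If all fibres of $\pi_\infty|_{\mathcal E^\infty}\colon\mathcal E^\infty\to M$ are non-empty and connected, then $K=\mathcal I^2Q\oplus Q'$ (equality, and the sum is direct). (2) Without the assumption on the fibres the same holds locally along $\mathcal E^\infty$: an element $q\in Q$ lies in $K$ if and only if for every $\theta_0\in\mathcal E^\infty$ there are $a\in\mathcal I^2Q$ and $s\in\Gamma(\alpha)$ with $q=a+\pi_\infty^*(s)$ in a neighbourhood of $\theta_0$; and if $a\in\mathcal I^2Q$ coincides with $\pi_\infty^*(s)$, $s\in\Gamma(\alpha)$, in a neighbourhood of $\theta_0\in\mathcal E^\infty$, then $s=0$ in a neighbourhood of $\pi_\infty(\theta_0)$. (3) $\mathcal I^2Q$ is the set of all elements of the form $\Delta(F,F)$ with $\Delta\in\mathcal C\mathrm{Diff}(P_1,\mathcal C\mathrm{Diff}(P_1,Q))$, that is, of bidifferential operators $\Delta(p,p')$ of the local form $\sum a_{\sigma\tau}D_\sigma p\,D_\tau p'$ with smooth coefficients and bounded order. -/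

import Mathlib

open Bundle Filter
open scoped Manifold ContDiff Topology

noncomputable section

namespace JetGeometry

section Jets

variable (E : Type*) [NormedAddCommGroup E] [NormedSpace ℝ E]
  {M : Type*} [TopologicalSpace M] [ChartedSpace E M]
  (F : Type*) [NormedAddCommGroup F] [NormedSpace ℝ F]
  (V : M → Type*) [TopologicalSpace (TotalSpace F V)] [∀ x, TopologicalSpace (V x)]
  [∀ x, AddCommGroup (V x)] [∀ x, Module ℝ (V x)] [FiberBundle F V] [VectorBundle ℝ F V]

/-- The space `Γ(V)` of global smooth sections of the vector bundle `V` over `M`. -/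
abbrev Sections : Type _ := ContMDiffSection 𝓘(ℝ, E) F ∞ V

/-- The part of `M` covered by the preferred chart and the preferred trivialization at `x₀`. -/
def coordDomain (x₀ : M) : Set M :=
  (chartAt E x₀).source ∩ (trivializationAt F V x₀).baseSet

/-- The expression `E → F` of a (possibly not everywhere smooth) section of `V` in the preferred
chart and trivialization at `x₀`; only its values on the image of `coordDomain` matter. -/
def localRep (x₀ : M) (s : (x : M) → V x) : E → F := fun y =>
  (trivializationAt F V x₀ ⟨(chartAt E x₀).symm y, s ((chartAt E x₀).symm y)⟩).2

/-- Two sections have the same infinite jet at `x` if all their partial derivatives in local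
coordinates agree at `x`. -/
def SameJet (x : M) (s t : (x : M) → V x) : Prop :=
  ∀ k : ℕ, iteratedFDeriv ℝ k (localRep E F V x s) (chartAt E x x) =
    iteratedFDeriv ℝ k (localRep E F V x t) (chartAt E x x)

/-- The equivalence relation "same infinite jet at `x`" on smooth sections. -/
def jetSetoid (x : M) : Setoid (Sections E F V) where
  r s t := SameJet E F V x s t
  iseqv := ⟨fun _ _ => rfl, fun h k => (h k).symm, fun h h' k => (h k).trans (h' k)⟩

/-- The infinite jet space `J^∞(V)`: pairs of a point `x` and an infinite jet at `x`. -/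
structure InfJet where
  /-- the projection to the base manifold -/
  base : M
  /-- the class of sections with the given jet at `base` -/
  cls : Quotient (jetSetoid E F V base)

/-- The infinite jet at `x` of a smooth section `s`; thus `jet s` is the prolongation of `s`. -/
def jet (s : Sections E F V) (x : M) : InfJet E F V := ⟨x, Quotient.mk (jetSetoid E F V x) s⟩

variable {E F V}

/-- Some smooth section whose infinite jet at `θ.base` is `θ`. -/
def InfJet.sec (θ : InfJet E F V) : Sections E F V := Quotient.out θ.cls

variable (E F) in
/-- The coordinate space for jets of order `k`: a base point and, for each `i ≤ k`, all partial
derivatives of order `i`, collected in one multilinear map. -/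
abbrev JetCoord (k : ℕ) : Type _ := E × ((i : Fin (k + 1)) → E [×(i : ℕ)]→L[ℝ] F)

/-- The coordinates `(x_i, u^j_σ)`, `|σ| ≤ k`, of a jet in the preferred chart and trivialization
at `x₀` (meaningful for jets over `coordDomain E F V x₀`). -/
def coords (k : ℕ) (x₀ : M) (θ : InfJet E F V) : JetCoord E F k :=
  (chartAt E x₀ θ.base,
    fun i => iteratedFDeriv ℝ i (localRep E F V x₀ θ.sec) (chartAt E x₀ θ.base))

/-- The (inverse limit) topology of `J^∞(V)`, generated by coordinate neighbourhoods. -/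
instance : TopologicalSpace (InfJet E F V) :=
  TopologicalSpace.generateFrom {S | ∃ (x₀ : M) (k : ℕ) (W : Set (JetCoord E F k)), IsOpen W ∧
    S = {θ | θ.base ∈ coordDomain E F V x₀ ∧ coords k x₀ θ ∈ W}}

end Jets

section HorizontalModules

variable {E : Type*} [NormedAddCommGroup E] [NormedSpace ℝ E]
  {M : Type*} [TopologicalSpace M] [ChartedSpace E M]
  {F : Type*} [NormedAddCommGroup F] [NormedSpace ℝ F]
  {V : M → Type*} [TopologicalSpace (TotalSpace F V)] [∀ x, TopologicalSpace (V x)]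
  [∀ x, AddCommGroup (V x)] [∀ x, Module ℝ (V x)] [FiberBundle F V] [VectorBundle ℝ F V]
  (FP : Type*) [NormedAddCommGroup FP] [NormedSpace ℝ FP]
  (P : M → Type*) [TopologicalSpace (TotalSpace FP P)] [∀ x, TopologicalSpace (P x)]
  [∀ x, AddCommGroup (P x)] [∀ x, Module ℝ (P x)] [FiberBundle FP P] [VectorBundle ℝ FP P]
  (FQ : Type*) [NormedAddCommGroup FQ] [NormedSpace ℝ FQ]
  (Q : M → Type*) [TopologicalSpace (TotalSpace FQ Q)] [∀ x, TopologicalSpace (Q x)]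
  [∀ x, AddCommGroup (Q x)] [∀ x, Module ℝ (Q x)] [FiberBundle FQ Q] [VectorBundle ℝ FQ Q]
  (U : Set (InfJet E F V))

/-- Smooth sections over `U ⊆ J^∞(V)` of the pullback of `P`: locally they are smooth functions of
the jet coordinates up to some finite order `k`. -/
def IsSmoothSection (p : (θ : U) → P θ.1.base) : Prop :=
  ∃ k : ℕ, ∀ θ₀ : U, ∃ G : JetCoord E F k → FP, ContDiff ℝ ∞ G ∧
    ∀ᶠ θ in 𝓝 θ₀,
      (trivializationAt FP P θ₀.1.base ⟨θ.1.base, p θ⟩).2 = G (coords k θ₀.1.base θ.1)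

/-- The horizontal module of smooth sections over `U` of the pullback of `P`. -/
def HorizontalModule : Set ((θ : U) → P θ.1.base) := {p | IsSmoothSection FP P U p}

/-- The set of smooth functions on `U`: the horizontal module of the trivial line bundle. -/
abbrev Functions : Set (U → ℝ) := HorizontalModule ℝ (Bundle.Trivial M ℝ) U

/-- Restriction to `U` of a section over the whole of `J^∞(V)`. -/
def restrict (Φ : HorizontalModule FP P (Set.univ : Set (InfJet E F V))) :
    HorizontalModule FP P U :=
  ⟨fun θ => Φ.1 ⟨θ.1, trivial⟩, by
    obtain ⟨k, hk⟩ := Φ.2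
    refine ⟨k, fun θ₀ => ?_⟩
    obtain ⟨G, hG, h⟩ := hk ⟨θ₀.1, trivial⟩
    refine ⟨G, hG, ?_⟩
    have hc : Continuous (fun θ : U => (⟨θ.1, trivial⟩ : (Set.univ : Set (InfJet E F V)))) :=
      Continuous.subtype_mk continuous_subtype_val _
    exact hc.continuousAt.eventually h⟩

variable {FP P FQ Q U}

open Classical in
/-- Extension of a section over `U` by zero. -/
def extend (p : (θ : U) → P θ.1.base) (θ : InfJet E F V) : P θ.base :=
  if h : θ ∈ U then p ⟨θ, h⟩ else 0

/-- The section `x ↦ p (j^∞_x s)` of `P`; it is used only near points with `j^∞_x s ∈ U`. -/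
def along (p : (θ : U) → P θ.1.base) (s : Sections E F V) (x : M) : P x :=
  extend p (jet E F V s x)

variable (FP P) in
/-- All total derivatives `D_σ p`, `|σ| = i`, at `θ = j^∞_x s`, in the coordinates at `x₀`: the
derivatives of order `i` at `x` of the section `x' ↦ p (j^∞_{x'} s)`. -/
def totalDerivs (i : ℕ) (x₀ : M) (p : (θ : U) → P θ.1.base) (θ : U) : E [×i]→L[ℝ] FP :=
  iteratedFDeriv ℝ i (localRep E FP P x₀ (along p θ.1.sec)) (chartAt E x₀ θ.1.base)

variable (FP P FQ Q) in
/-- `Δ ∈ CDiff(P, Q)`: in local coordinates, `Δ` is `∑ a_σ D_σ` with `|σ| ≤ r` and smooth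
coefficients `a_σ`. -/
def IsCDiff (Δ : HorizontalModule FP P U → HorizontalModule FQ Q U) : Prop :=
  ∃ r k : ℕ, ∀ θ₀ : U,
    ∃ a : (i : Fin (r + 1)) → JetCoord E F k → ((E [×(i : ℕ)]→L[ℝ] FP) →L[ℝ] FQ),
      (∀ i, ContDiff ℝ ∞ (a i)) ∧
      ∀ᶠ θ in 𝓝 θ₀, ∀ p : HorizontalModule FP P U,
        (trivializationAt FQ Q θ₀.1.base ⟨θ.1.base, (Δ p).1 θ⟩).2 =
          ∑ i, a i (coords k θ₀.1.base θ.1) (totalDerivs FP P i θ₀.1.base p.1 θ)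

set_option maxSynthPendingDepth 3 in
variable (FP P FQ Q) in
/-- `Δ ∈ CDiff(P, CDiff(P, Q))`: in local coordinates, `Δ(p, p')` is `∑ a_{στ} D_σ p D_τ p'` with
`|σ|, |τ| ≤ r` and smooth coefficients `a_{στ}`. -/
def IsBiCDiff
    (Δ : HorizontalModule FP P U → HorizontalModule FP P U → HorizontalModule FQ Q U) : Prop :=
  ∃ r k : ℕ, ∀ θ₀ : U,
    ∃ a : (i j : Fin (r + 1)) → JetCoord E F k →
        ((E [×(i : ℕ)]→L[ℝ] FP) →L[ℝ] (E [×(j : ℕ)]→L[ℝ] FP) →L[ℝ] FQ),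
      (∀ i j, ContDiff ℝ ∞ (a i j)) ∧
      ∀ᶠ θ in 𝓝 θ₀, ∀ p p' : HorizontalModule FP P U,
        (trivializationAt FQ Q θ₀.1.base ⟨θ.1.base, (Δ p p').1 θ⟩).2 =
          ∑ i, ∑ j, a i j (coords k θ₀.1.base θ.1)
            (totalDerivs FP P i θ₀.1.base p.1 θ) (totalDerivs FP P j θ₀.1.base p'.1 θ)

open Classical in
/-- For a smooth section `φ` over `U` of the pullback of `V` and `θ = j^∞_x s ∈ U`: a global section
of `V` with the same infinite jet at `x` as `x' ↦ φ (j^∞_{x'} s)`, that is, with partial derivatives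
`(D_σ φ)(θ)` at `x`. -/
def prolong (φ : (θ : U) → V θ.1.base) (θ : U) : Sections E F V :=
  if h : ∃ t : Sections E F V, SameJet E F V θ.1.base t (along φ θ.1.sec) then h.choose else 0

variable (FQ Q) in
/-- The linearization `ℓ_q(φ) = ∑ ∂q/∂u^j_σ D_σ φ^j`, that is, the derivative of `q` along the
vertical vector at `θ` with components `(D_σ φ)(θ)`. -/
def linearization (q : (θ : U) → Q θ.1.base) (φ : (θ : U) → V θ.1.base) (θ : U) : Q θ.1.base :=
  (trivializationAt FQ Q θ.1.base).symm θ.1.base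
    (deriv (fun t : ℝ => (trivializationAt FQ Q θ.1.base
      ⟨θ.1.base, extend q (jet E F V (θ.1.sec + t • prolong φ θ) θ.1.base)⟩).2) 0)

/-- The infinite prolongation of the equation `Φ = 0`: all points at which every total derivative
`D_σ Φ` vanishes. -/
def prolongation (Φ : HorizontalModule FP P (Set.univ : Set (InfJet E F V))) :
    Set (InfJet E F V) :=
  {θ | ∀ k : ℕ, totalDerivs FP P k θ.base Φ.1 ⟨θ, trivial⟩ = 0}

variable (FQ Q) in
/-- `q ↦ ℓ_q|_Y`, where `ℓ_q|_Y` sends `φ` to the restriction of `ℓ_q(φ)` to `Y ⊆ U`. -/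
def restrictedLinearization {Y : Set (InfJet E F V)} (hY : Y ⊆ U) (q : (θ : U) → Q θ.1.base) :
    HorizontalModule F V U → (θ : Y) → Q θ.1.base :=
  fun φ θ => linearization FQ Q q φ.1 ⟨θ.1, hY θ.2⟩

variable (FQ Q) in
/-- The kernel of `q ↦ ℓ_q|_Y` on the horizontal module of `Q` over `U`. -/
def linearizationKernel {Y : Set (InfJet E F V)} (hY : Y ⊆ U) : Set ((θ : U) → Q θ.1.base) :=
  {q | q ∈ HorizontalModule FQ Q U ∧ restrictedLinearization FQ Q hY q = 0}

variable (U) in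
/-- The ideal `I = {Δ(Φ) | Δ ∈ CDiff(P, Functions U)}` of the equation. -/
def equationIdeal (Φ : HorizontalModule FP P (Set.univ : Set (InfJet E F V))) : Set (U → ℝ) :=
  {f | ∃ Δ : HorizontalModule FP P U → Functions U,
    IsCDiff FP P ℝ (Bundle.Trivial M ℝ) Δ ∧ f = (Δ (restrict FP P U Φ)).1}

variable (U FQ Q) in
/-- `I²Q`: all finite sums of products `f g q` with `f, g ∈ I` and `q` in the horizontal module
of `Q`. -/
def idealSqModule (Φ : HorizontalModule FP P (Set.univ : Set (InfJet E F V))) :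
    Submodule ℝ ((θ : U) → Q θ.1.base) :=
  Submodule.span ℝ {w | ∃ f ∈ equationIdeal U Φ, ∃ g ∈ equationIdeal U Φ,
    ∃ q ∈ HorizontalModule FQ Q U, w = fun θ => (f θ * g θ) • q θ}

variable (U FQ Q) in
/-- The pullback of sections of `Q` from `M` to `U`. -/
def pullback : Sections E FQ Q →ₗ[ℝ] ((θ : U) → Q θ.1.base) where
  toFun s θ := s θ.1.base
  map_add' _ _ := rfl
  map_smul' _ _ := rfl

end HorizontalModules

section Regularity

variable {E : Type*} [NormedAddCommGroup E] [NormedSpace ℝ E]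
  {M : Type*} [TopologicalSpace M] [ChartedSpace E M]
  {F : Type*} [NormedAddCommGroup F] [NormedSpace ℝ F]
  {V : M → Type*} [TopologicalSpace (TotalSpace F V)] [∀ x, TopologicalSpace (V x)]
  [∀ x, AddCommGroup (V x)] [∀ x, Module ℝ (V x)] [FiberBundle F V] [VectorBundle ℝ F V]

/-- Smooth functions on `Y × W` for `Y ⊆ J^∞(V)` and `W ⊆ ℝ^∞`: locally they are smooth functions of
finitely many coordinates. -/
def IsSmoothProd {Y : Set (InfJet E F V)} {W : Set (ℕ → ℝ)} (g : Y × W → ℝ) : Prop :=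
  ∃ k N : ℕ, ∀ z₀ : Y × W, ∃ G : JetCoord E F k × (Fin N → ℝ) → ℝ, ContDiff ℝ ∞ G ∧
    ∀ᶠ z in 𝓝 z₀, g z = G (coords k z₀.1.1.base z.1.1, fun i => z.2.1 i)

/-- The total derivative `D_X f` along a vector field `X` on `M`, characterized by
`(D_X f) ∘ j^∞(s) = X (f ∘ j^∞(s))`. -/
def totalDeriv [IsManifold 𝓘(ℝ, E) ∞ M]
    (X : Sections E E (TangentSpace 𝓘(ℝ, E) : M → Type _)) (f : InfJet E F V → ℝ)
    (θ : InfJet E F V) : ℝ :=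
  mfderiv 𝓘(ℝ, E) 𝓘(ℝ, ℝ) (fun x => f (jet E F V θ.sec x)) θ.base (X θ.base)

variable (FP : Type*) [NormedAddCommGroup FP] [NormedSpace ℝ FP]
  (P : M → Type*) [TopologicalSpace (TotalSpace FP P)] [∀ x, TopologicalSpace (P x)]
  [∀ x, AddCommGroup (P x)] [∀ x, Module ℝ (P x)] [FiberBundle FP P] [VectorBundle ℝ FP P]

variable (E) in
/-- A smooth section of the dual bundle of `P`: a family of linear functionals that is smooth on
smooth sections. Applied to a section of (the pullback of) `P` it gives a component. -/
structure DualSection where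
  /-- the functional on each fibre -/
  toFun : (x : M) → P x →ₗ[ℝ] ℝ
  /-- smoothness -/
  smooth : ∀ s : Sections E FP P, ContMDiff 𝓘(ℝ, E) 𝓘(ℝ, ℝ) ∞ (fun x => toFun x (s x))

variable {FP P}

/-- The regularity condition for the equation `Φ = 0`: an open `U ⊇ 𝓔^∞` and an isomorphism
`ν : U → 𝓔^∞ × W` onto the product with a star-shaped open neighbourhood `W` of zero in `ℝ^∞`, equal
to `(θ, 0)` on `𝓔^∞`, whose second component consists of total derivatives of components of `Φ`. -/
structure Regularity [IsManifold 𝓘(ℝ, E) ∞ M]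
    (Φ : HorizontalModule FP P (Set.univ : Set (InfJet E F V))) where
  U : Set (InfJet E F V)
  isOpen_U : IsOpen U
  prolongation_subset : prolongation Φ ⊆ U
  W : Set (ℕ → ℝ)
  isOpen_W : IsOpen W
  zero_mem_W : (0 : ℕ → ℝ) ∈ W
  starConvex_W : StarConvex ℝ (0 : ℕ → ℝ) W
  ν : U ≃ₜ prolongation Φ × W
  /-- `ν` and its inverse are smooth: they pull smooth functions back to smooth functions. -/
  smooth_symm : ∀ f ∈ Functions U, IsSmoothProd (f ∘ ν.symm)
  smooth : ∀ g : prolongation Φ × W → ℝ, IsSmoothProd g → g ∘ ν ∈ Functions U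
  ν_fst : ∀ θ : prolongation Φ, (ν ⟨θ.1, prolongation_subset θ.2⟩).1 = θ
  ν_snd : ∀ θ : prolongation Φ, ((ν ⟨θ.1, prolongation_subset θ.2⟩).2 : ℕ → ℝ) = 0
  /-- `v_s = D_{σ_s}(F_{i_s})`, with total derivatives along vector fields on `M` and components with
  respect to sections of the dual bundle. -/
  v_eq : ∀ s : ℕ, ∃ (σ : List (Sections E E (TangentSpace 𝓘(ℝ, E) : M → Type _)))
    (ξ : DualSection E FP P), ∀ θ : U, ((ν θ).2 : ℕ → ℝ) s =
      σ.foldr totalDeriv (fun θ' => ξ.toFun θ'.base (Φ.1 ⟨θ', trivial⟩)) θ.1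

end Regularity

end JetGeometry

end

/-!
Call a section of a bundle over the jet space *flat* at a point if its derivatives in all vertical
directions vanish there (`FlatAt`). The linearization of a section `q` at a point collects exactly
these derivatives, because every vertical direction comes from a section of `π`; so the kernel `K`
consists of the sections that are flat along the equation (`mem_linearizationKernel_iff`). The
theorem follows from a description of `I²Q` and a description of flat sections, both of which rest
on the splitting `ν` of a neighbourhood of the equation into the equation and an open star-shaped
subset of `ℝ^∞`, and on the retraction onto the equation that it defines.

The components of the second factor of `ν` are total derivatives of the equation `F`. All total
derivatives of `F` vanish on the equation, hence these components have zero derivative there along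
the prolongation of any section. Consequently the retraction preserves the Cartan directions, i.e.
the first derivatives of prolongations, at points of the equation
(`Regularity.exists_hasFDerivAt_retraction`). In particular the projection of the equation to the
base is open (`Regularity.eventually_exists_base_eq`).

*The submodule `I²Q`* consists of the sections that vanish and are flat along the equation
(`Regularity.mem_idealSqModule_iff`). A product of two elements of `I` and a section has these
properties by the product rule. Conversely, at a point of the equation, vertical and Cartan
directions span all directions. A section `q` that vanishes and is flat along the equation has zero
derivative in the former by flatness, and in the latter because they may be replaced by their images
under the retraction, which lie in the equation, where `q` is zero. So the derivative of `q` in the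
direction of the second factor of the splitting is zero (`Regularity.hasDerivAt_line`), and the
Hadamard lemma (`exists_hadamard`), applied twice in this factor, writes `q` as
`∑ v_j v_l a_{jl}`, where `v_j ∈ I`. Coordinates of the fibre exist only locally over the base, so
this is done for the pieces of a locally finite decomposition (`exists_weights`). The pieces of the
coefficients have a common finite order because both halves of the isomorphism preserve functions
of *one* finite order: a locally finite family of unbounded order would have a sum without finite
order (`exists_uniform_order`).

*A flat section* agrees on the equation locally with the pullback of a section over the base
(`Regularity.exists_section_eq_of_flatAt`). Composed with the retraction, it is a function of
finitely many jet coordinates whose derivative vanishes on the kernel of the derivative of the map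
that sends a jet to the base point of its retraction. This map is a submersion, since the
retraction preserves Cartan directions, and thus the function factors through it
(`exists_factor_through_submersion`). If the fibres of the equation are connected, the local
sections fit together (`Regularity.exists_global_section_eq`).

Subtracting the section over the base from an element of `K` gives a section which vanishes and is
flat along the equation, globally or after multiplication by a cutoff function; this proves the
decompositions. A section over the base whose pullback coincides near a point of the equation with
an element of `I²Q` vanishes on the image of a neighbourhood of the point in the equation, and this
image is a neighbourhood in the base.

Finally, `Δ(F, F)` is a bilinear expression in total derivatives of `F`, all of which vanish on the
equation, so it vanishes there together with its vertical derivatives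
(`IsBiCDiff.eq_zero_and_flatAt`) and lies in `I²Q`; that all elements of `I²Q` are of this form is
immediate from the definitions (`exists_isBiCDiff_of_mem_idealSqModule`).
-/

set_option linter.unusedSectionVars false

namespace JetGeometry

/-! ### Smooth germs and their Taylor coefficients -/

section Calculus

variable {E F G H P : Type*} [NormedAddCommGroup E] [NormedSpace ℝ E]
  [NormedAddCommGroup F] [NormedSpace ℝ F] [NormedAddCommGroup G] [NormedSpace ℝ G]
  [NormedAddCommGroup H] [NormedSpace ℝ H] [NormedAddCommGroup P] [NormedSpace ℝ P]

/-- `g` is smooth in a neighbourhood of `y`. This is stronger than `ContDiffAt ℝ ∞ g y`, where the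
neighbourhood may shrink with the order of differentiability. -/
def SmoothNear (g : E → F) (y : E) : Prop := ∀ᶠ z in 𝓝 y, ContDiffAt ℝ ∞ g z

theorem SmoothNear.contDiffAt {g : E → F} {y : E} (h : SmoothNear g y) : ContDiffAt ℝ ∞ g y :=
  h.self_of_nhds

theorem SmoothNear.eventually {g : E → F} {y : E} (h : SmoothNear g y) :
    ∀ᶠ z in 𝓝 y, SmoothNear g z := h.eventually_nhds

theorem SmoothNear.congr {g g' : E → F} {y : E} (h : SmoothNear g y) (hg : g' =ᶠ[𝓝 y] g) :
    SmoothNear g' y := by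
  filter_upwards [h, hg.eventually_nhds] with z hz hz'
  exact hz.congr_of_eventuallyEq hz'

theorem _root_.ContDiff.smoothNear {g : E → F} (h : ContDiff ℝ ∞ g) (y : E) : SmoothNear g y :=
  Eventually.of_forall fun _ => h.contDiffAt

theorem SmoothNear.comp {g : F → G} {f : E → F} {y : E} (hg : SmoothNear g (f y))
    (hf : SmoothNear f y) : SmoothNear (fun z => g (f z)) y := by
  filter_upwards [hf, hf.contDiffAt.continuousAt.eventually hg] with z h1 h2
  exact h2.comp z h1

theorem SmoothNear.prodMk {g : E → G} {f : E → F} {y : E} (hg : SmoothNear g y)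
    (hf : SmoothNear f y) : SmoothNear (fun z => (g z, f z)) y := by
  filter_upwards [hg, hf] with z h1 h2
  exact h1.prodMk h2

theorem SmoothNear.iteratedFDeriv {g : E → F} {y : E} (hg : SmoothNear g y) (i : ℕ) :
    SmoothNear (iteratedFDeriv ℝ i g) y := by
  filter_upwards [hg] with z hz
  exact hz.iteratedFDeriv_right (by exact_mod_cast le_top)

/-- A smooth germ extends to a smooth function on the whole space. -/
theorem SmoothNear.exists_contDiff [FiniteDimensional ℝ E] {g : E → F} {y : E}
    (h : SmoothNear g y) : ∃ g' : E → F, ContDiff ℝ ∞ g' ∧ g' =ᶠ[𝓝 y] g := by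
  obtain ⟨ε, hε, hball⟩ := Metric.eventually_nhds_iff_ball.1 h
  let b : ContDiffBump y := ⟨ε / 3, ε / 2, by positivity, by linarith⟩
  refine ⟨fun z => b z • g z, contDiff_iff_contDiffAt.2 fun z => ?_, ?_⟩
  · by_cases hz : z ∈ Metric.ball y ε
    · exact b.contDiff.contDiffAt.smul (hball z hz)
    · have hz' : z ∈ (Metric.closedBall y (ε / 2))ᶜ := by
        simp only [Metric.mem_ball, not_lt, Set.mem_compl_iff, Metric.mem_closedBall,
          not_le] at hz ⊢
        linarith
      refine (contDiffAt_const (c := (0 : F))).congr_of_eventuallyEq ?_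
      filter_upwards [Metric.isClosed_closedBall.isOpen_compl.mem_nhds hz'] with w hw
      simp only [Set.mem_compl_iff, Metric.mem_closedBall, not_le] at hw
      rw [b.zero_of_le_dist hw.le, zero_smul]
  · filter_upwards [b.eventuallyEq_one] with z hz
    simp [hz]

/-- Partial derivatives in the second variable are the restrictions of the full derivatives to the
second factor, and thus smooth in both variables. -/
theorem contDiff_iteratedFDeriv_param {f : P → E → F}
    (h : ContDiff ℝ ∞ (fun q : P × E => f q.1 q.2)) (i : ℕ) :
    ContDiff ℝ ∞ (fun q : P × E => iteratedFDeriv ℝ i (f q.1) q.2) := by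
  have key : ∀ q : P × E, iteratedFDeriv ℝ i (f q.1) q.2 =
      ContinuousMultilinearMap.compContinuousLinearMapL (𝕜 := ℝ) (F := F)
        (fun _ : Fin i => ContinuousLinearMap.inr ℝ P E)
        (iteratedFDeriv ℝ i (fun q : P × E => f q.1 q.2) q) := by
    rintro ⟨p, z⟩
    have h1 : ContDiff ℝ ∞ (fun w : P × E => f (w + (p, 0)).1 (w + (p, 0)).2) :=
      h.comp (contDiff_id.add contDiff_const)
    have h2 := (ContinuousLinearMap.inr ℝ P E).iteratedFDeriv_comp_right h1 z (i := i)
      (by exact_mod_cast le_top)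
    have h3 := iteratedFDeriv_comp_add_right (𝕜 := ℝ) (f := fun q : P × E => f q.1 q.2) i (p, 0)
      ((ContinuousLinearMap.inr ℝ P E) z)
    rw [h3] at h2
    have h4 : (ContinuousLinearMap.inr ℝ P E) z + (p, 0) = (p, z) := by simp
    rw [h4] at h2
    rw [ContinuousMultilinearMap.compContinuousLinearMapL_apply, ← h2]
    congr 1
    funext w
    simp
  simp only [key]
  exact (ContinuousLinearMap.contDiff _).comp
    (contDiff_iff_contDiffAt.2 fun q =>
      h.contDiffAt.iteratedFDeriv_right (by exact_mod_cast le_top))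

/-- By the formula of Faà di Bruno, the `n`-th derivative of a composition depends only on the
derivatives of the inner function up to order `n`. -/
theorem iteratedFDeriv_comp_congr_right {h : F → G} {g₁ g₂ : E → F} {y : E} {n : ℕ}
    (hg : ∀ m ≤ n, iteratedFDeriv ℝ m g₁ y = iteratedFDeriv ℝ m g₂ y)
    (hh : ContDiffAt ℝ ∞ h (g₁ y)) (h₁ : ContDiffAt ℝ ∞ g₁ y) (h₂ : ContDiffAt ℝ ∞ g₂ y) :
    iteratedFDeriv ℝ n (fun z => h (g₁ z)) y = iteratedFDeriv ℝ n (fun z => h (g₂ z)) y := by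
  have h0 : g₁ y = g₂ y := by
    have := congrArg (fun u => u 0) (hg 0 (Nat.zero_le _))
    simpa using this
  have e₁ := iteratedFDeriv_comp hh h₁ (i := n) (by exact_mod_cast le_top)
  have e₂ := iteratedFDeriv_comp (h0 ▸ hh) h₂ (i := n) (by exact_mod_cast le_top)
  refine e₁.trans (Eq.trans ?_ e₂.symm)
  simp only [FormalMultilinearSeries.taylorComp,
    FormalMultilinearSeries.compAlongOrderedFinpartition, ftaylorSeries]
  refine Finset.sum_congr rfl fun c _ => ?_
  rw [h0]
  congr 1
  funext m
  exact hg _ (c.partSize_le m)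

/-- By the formula of Faà di Bruno, the `n`-th derivative of a composition depends only on the
derivatives of the outer function up to order `n`. -/
theorem iteratedFDeriv_comp_congr_left {g₁ g₂ : F → G} {h : E → F} {y : E} {n : ℕ}
    (hg : ∀ m ≤ n, iteratedFDeriv ℝ m g₁ (h y) = iteratedFDeriv ℝ m g₂ (h y))
    (hh : ContDiffAt ℝ ∞ h y) (h₁ : ContDiffAt ℝ ∞ g₁ (h y)) (h₂ : ContDiffAt ℝ ∞ g₂ (h y)) :
    iteratedFDeriv ℝ n (fun z => g₁ (h z)) y = iteratedFDeriv ℝ n (fun z => g₂ (h z)) y := by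
  have e₁ := iteratedFDeriv_comp h₁ hh (i := n) (by exact_mod_cast le_top)
  have e₂ := iteratedFDeriv_comp h₂ hh (i := n) (by exact_mod_cast le_top)
  refine e₁.trans (Eq.trans ?_ e₂.symm)
  simp only [FormalMultilinearSeries.taylorComp,
    FormalMultilinearSeries.compAlongOrderedFinpartition, ftaylorSeries]
  refine Finset.sum_congr rfl fun c _ => ?_
  rw [hg _ c.length_le]

theorem iteratedFDeriv_isometry_congr (c : F ≃ₗᵢ[ℝ] G) {h₁ h₂ : E → F} {y : E} {j : ℕ}
    (h : iteratedFDeriv ℝ j h₁ y = iteratedFDeriv ℝ j h₂ y) :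
    iteratedFDeriv ℝ j (c ∘ h₁) y = iteratedFDeriv ℝ j (c ∘ h₂) y := by
  have key : ∀ g : E → F, iteratedFDeriv ℝ j (c ∘ g) y =
      (c : F →L[ℝ] G).compContinuousMultilinearMap (iteratedFDeriv ℝ j g y) :=
    fun g => c.toContinuousLinearEquiv.iteratedFDeriv_comp_left
  rw [key, key, h]

theorem iteratedFDeriv_fderiv_congr {g₁ g₂ : E → F} {y : E} {j : ℕ}
    (h : iteratedFDeriv ℝ (j + 1) g₁ y = iteratedFDeriv ℝ (j + 1) g₂ y) :
    iteratedFDeriv ℝ j (fderiv ℝ g₁) y = iteratedFDeriv ℝ j (fderiv ℝ g₂) y := by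
  simpa only [iteratedFDeriv_succ_eq_comp_right, Function.comp_apply,
    EmbeddingLike.apply_eq_iff_eq] using h

set_option maxSynthPendingDepth 3 in
theorem iteratedFDeriv_iteratedFDeriv_congr {g₁ g₂ : E → F} {y : E} (i j : ℕ)
    (hg : iteratedFDeriv ℝ (i + j) g₁ y = iteratedFDeriv ℝ (i + j) g₂ y) :
    iteratedFDeriv ℝ j (iteratedFDeriv ℝ i g₁) y =
      iteratedFDeriv ℝ j (iteratedFDeriv ℝ i g₂) y := by
  induction i generalizing j with
  | zero =>
    rw [zero_add] at hg
    simpa only [iteratedFDeriv_zero_eq_comp] using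
      iteratedFDeriv_isometry_congr (continuousMultilinearCurryFin0 ℝ E F).symm hg
  | succ i ih =>
    have h1 := iteratedFDeriv_fderiv_congr
      (ih (j + 1) (by rwa [show i + (j + 1) = i + 1 + j by omega]))
    rw [iteratedFDeriv_succ_eq_comp_left, iteratedFDeriv_succ_eq_comp_left]
    exact iteratedFDeriv_isometry_congr
      (continuousMultilinearCurryLeftEquiv ℝ (fun _ : Fin (i + 1) => E) F).symm h1

theorem iteratedFDeriv_prod_congr {f₁ f₂ : E → F} {g₁ g₂ : E → G} {y : E} {n : ℕ}
    (hf : iteratedFDeriv ℝ n f₁ y = iteratedFDeriv ℝ n f₂ y)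
    (hg : iteratedFDeriv ℝ n g₁ y = iteratedFDeriv ℝ n g₂ y)
    (hf₁ : ContDiffAt ℝ ∞ f₁ y) (hf₂ : ContDiffAt ℝ ∞ f₂ y)
    (hg₁ : ContDiffAt ℝ ∞ g₁ y) (hg₂ : ContDiffAt ℝ ∞ g₂ y) :
    iteratedFDeriv ℝ n (fun z => (f₁ z, g₁ z)) y =
      iteratedFDeriv ℝ n (fun z => (f₂ z, g₂ z)) y := by
  have hn : (n : ℕ∞ω) ≤ ∞ := by exact_mod_cast le_top
  refine ContinuousMultilinearMap.ext fun v => Prod.ext ?_ ?_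
  · have a := (ContinuousLinearMap.fst ℝ F G).iteratedFDeriv_comp_left (hf₁.prodMk hg₁) hn
    have b := (ContinuousLinearMap.fst ℝ F G).iteratedFDeriv_comp_left (hf₂.prodMk hg₂) hn
    have c := congrArg (fun u => u v) (a.symm.trans (Eq.trans hf b))
    simpa using c
  · have a := (ContinuousLinearMap.snd ℝ F G).iteratedFDeriv_comp_left (hf₁.prodMk hg₁) hn
    have b := (ContinuousLinearMap.snd ℝ F G).iteratedFDeriv_comp_left (hf₂.prodMk hg₂) hn
    have c := congrArg (fun u => u v) (a.symm.trans (Eq.trans hg b))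
    simpa using c

theorem iteratedFDeriv_pi_congr {ι : Type*} [Fintype ι] {K : ι → Type*}
    [∀ a, NormedAddCommGroup (K a)] [∀ a, NormedSpace ℝ (K a)] {f₁ f₂ : E → (a : ι) → K a}
    {y : E} {n : ℕ}
    (hf : ∀ a, iteratedFDeriv ℝ n (fun z => f₁ z a) y = iteratedFDeriv ℝ n (fun z => f₂ z a) y)
    (hf₁ : ContDiffAt ℝ ∞ f₁ y) (hf₂ : ContDiffAt ℝ ∞ f₂ y) :
    iteratedFDeriv ℝ n f₁ y = iteratedFDeriv ℝ n f₂ y := by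
  have hn : (n : ℕ∞ω) ≤ ∞ := by exact_mod_cast le_top
  ext1 v
  funext a
  have h1 := (ContinuousLinearMap.proj (R := ℝ) (φ := K) a).iteratedFDeriv_comp_left hf₁ hn
  have h2 := (ContinuousLinearMap.proj (R := ℝ) (φ := K) a).iteratedFDeriv_comp_left hf₂ hn
  have c := congrArg (fun u => u v) (h1.symm.trans (Eq.trans (hf a) h2))
  simpa using c

end Calculus

section JetFibre

variable {E F G H P : Type*} [NormedAddCommGroup E] [NormedSpace ℝ E]
  [NormedAddCommGroup F] [NormedSpace ℝ F] [NormedAddCommGroup G] [NormedSpace ℝ G]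
  [NormedAddCommGroup H] [NormedSpace ℝ H] [NormedAddCommGroup P] [NormedSpace ℝ P]

variable (E F) in
/-- The fibre coordinates of jets of order `k`. The entries need not be symmetric; the tuples that
come from functions form the subspace `jetSpace`. -/
abbrev JetFibre (k : ℕ) : Type _ := (i : Fin (k + 1)) → E [×(i : ℕ)]→L[ℝ] F

/-- The Taylor coefficients of order at most `k` of `g` at `y`. -/
noncomputable def jetAt (k : ℕ) (g : E → F) (y : E) : JetFibre E F k :=
  fun i => iteratedFDeriv ℝ i g y

theorem finiteDimensional_continuousMultilinearMap (n : ℕ) [FiniteDimensional ℝ E]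
    [FiniteDimensional ℝ F] : FiniteDimensional ℝ (E [×n]→L[ℝ] F) :=
  Module.Finite.of_injective (ContinuousMultilinearMap.toMultilinearMapLinear (R' := ℝ) (A := ℝ)
    (M₁ := fun _ : Fin n => E) (M₂ := F)) ContinuousMultilinearMap.toMultilinearMap_injective

instance (k : ℕ) [FiniteDimensional ℝ E] [FiniteDimensional ℝ F] :
    FiniteDimensional ℝ (JetFibre E F k) :=
  haveI := fun i : Fin (k + 1) => finiteDimensional_continuousMultilinearMap (E := E) (F := F) i
  Module.Finite.pi

theorem SmoothNear.jetAt {g : E → F} {y : E} (hg : SmoothNear g y) (k : ℕ) :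
    SmoothNear (jetAt k g) y := by
  filter_upwards [hg] with z hz
  exact contDiffAt_pi.2 fun i => hz.iteratedFDeriv_right (by exact_mod_cast le_top)

theorem jetAt_congr {g g' : E → F} {y : E} (h : g =ᶠ[𝓝 y] g') (k : ℕ) :
    jetAt k g y = jetAt k g' y :=
  funext fun i => (h.iteratedFDeriv ℝ i).self_of_nhds

theorem jetAt_add {g g' : E → F} {y : E} (hg : ContDiffAt ℝ ∞ g y) (hg' : ContDiffAt ℝ ∞ g' y)
    (k : ℕ) : jetAt k (fun z => g z + g' z) y = jetAt k g y + jetAt k g' y :=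
  funext fun i => iteratedFDeriv_add_apply (hg.of_le (by exact_mod_cast le_top))
    (hg'.of_le (by exact_mod_cast le_top))

theorem jetAt_smul {g : E → F} {y : E} (hg : ContDiffAt ℝ ∞ g y) (c : ℝ) (k : ℕ) :
    jetAt k (fun z => c • g z) y = c • jetAt k g y :=
  funext fun i => iteratedFDeriv_const_smul_apply (hg.of_le (by exact_mod_cast le_top))

theorem jetAt_comp_sub (g : E → F) (y : E) (k : ℕ) :
    jetAt k (fun z => g (z - y)) y = jetAt k g 0 :=
  funext fun i => by
    change iteratedFDeriv ℝ i (fun z => g (z - y)) y = _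
    rw [iteratedFDeriv_comp_sub, sub_self]; rfl

theorem jetAt_comp_add (g : E → F) (y : E) (k : ℕ) :
    jetAt k (fun z => g (z + y)) 0 = jetAt k g y :=
  funext fun i => by
    change iteratedFDeriv ℝ i (fun z => g (z + y)) 0 = _
    rw [iteratedFDeriv_comp_add_right, zero_add]; rfl

variable (E F) in
/-- The space of smooth functions. -/
def smoothFunctions : Submodule ℝ (E → F) where
  carrier := {g | ContDiff ℝ ∞ g}
  add_mem' := fun {_ _} (h : ContDiff ℝ ∞ _) (h' : ContDiff ℝ ∞ _) => ContDiff.add h h'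
  zero_mem' := (contDiff_const : ContDiff ℝ ∞ fun _ : E => (0 : F))
  smul_mem' := fun c _ (h : ContDiff ℝ ∞ _) => ContDiff.const_smul c h

theorem contDiff_of_smoothFunctions (g : smoothFunctions E F) : ContDiff ℝ ∞ g.1 := g.2

variable (E F) in
/-- The jet at the origin, as a linear map on smooth functions. -/
noncomputable def jetZero (k : ℕ) : smoothFunctions E F →ₗ[ℝ] JetFibre E F k where
  toFun g := jetAt k g.1 0
  map_add' g g' := jetAt_add (contDiff_of_smoothFunctions g).contDiffAt
    (contDiff_of_smoothFunctions g').contDiffAt k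
  map_smul' c g := jetAt_smul (contDiff_of_smoothFunctions g).contDiffAt c k

variable (E F) in
/-- The subspace of those fibre coordinates that are Taylor coefficients of smooth functions. -/
noncomputable def jetSpace (k : ℕ) : Submodule ℝ (JetFibre E F k) := LinearMap.range (jetZero E F k)

theorem jetAt_mem_jetSpace [FiniteDimensional ℝ E] {g : E → F} {y : E} (hg : SmoothNear g y)
    (k : ℕ) : jetAt k g y ∈ jetSpace E F k := by
  obtain ⟨g', hg', h⟩ := hg.exists_contDiff
  refine ⟨⟨fun z => g' (z + y), hg'.comp (contDiff_id.add contDiff_const)⟩, ?_⟩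
  change jetAt k (fun z => g' (z + y)) 0 = _
  rw [jetAt_comp_add, jetAt_congr h]

theorem exists_contDiff_jetAt_eq {k : ℕ} {u : JetFibre E F k} (hu : u ∈ jetSpace E F k) (y : E) :
    ∃ g : E → F, ContDiff ℝ ∞ g ∧ jetAt k g y = u := by
  obtain ⟨⟨g, hg⟩, rfl⟩ := hu
  exact ⟨fun z => g (z - y), ContDiff.comp (𝕜 := ℝ) hg (contDiff_id.sub contDiff_const),
    jetAt_comp_sub g y k⟩

variable (E F) in
/-- Jets of finite order are realized by functions that depend smoothly on the jet: a substitute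
for Taylor polynomials that needs no formula. -/
theorem exists_jet_realization [FiniteDimensional ℝ E] [FiniteDimensional ℝ F] (k : ℕ) :
    ∃ ρ : JetFibre E F k → E → F, ContDiff ℝ ∞ (fun q : JetFibre E F k × E => ρ q.1 q.2) ∧
      ∀ (g : E → F) (y : E), SmoothNear g y →
        jetAt k (fun x => ρ (jetAt k g y) (x - y)) y = jetAt k g y := by
  obtain ⟨σ, hσ⟩ := LinearMap.exists_rightInverse_of_surjective (jetZero E F k).rangeRestrict
    (LinearMap.range_rangeRestrict _)
  obtain ⟨p, hp⟩ := LinearMap.exists_leftInverse_of_injective (jetSpace E F k).subtype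
    (Submodule.ker_subtype _)
  -- A linear right inverse of the jet map, extended to the tuples that are not jets by a
  -- projection; it is smooth in the jet because it is linear on a finite-dimensional space.
  let R : JetFibre E F k →ₗ[ℝ] smoothFunctions E F := σ ∘ₗ p
  have hR : ∀ u ∈ jetSpace E F k, jetAt k (R u).1 0 = u := fun u hu => by
    have h1 : p u = ⟨u, hu⟩ := LinearMap.congr_fun hp ⟨u, hu⟩
    have h2 := LinearMap.congr_fun hσ (p u)
    have h3 := congrArg Subtype.val h2
    rw [h1] at h3
    change jetAt k (σ (p u)).1 0 = u
    rw [h1]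
    exact h3
  refine ⟨fun u => (R u).1, ?_, fun g y hg => ?_⟩
  · let b := Module.finBasis ℝ (JetFibre E F k)
    have : (fun q : JetFibre E F k × E => (R q.1).1 q.2) =
        fun q => ∑ i, (LinearMap.toContinuousLinearMap (b.coord i)) q.1 • (R (b i)).1 q.2 := by
      funext q
      conv_lhs => rw [← b.sum_repr q.1, map_sum]
      simp [Finset.sum_apply]
    rw [this]
    exact ContDiff.sum fun i _ => ((ContinuousLinearMap.contDiff _).comp contDiff_fst).smul
      ((contDiff_of_smoothFunctions (R (b i))).comp contDiff_snd)
  · exact (jetAt_comp_sub _ y k).trans (hR _ (jetAt_mem_jetSpace hg k))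

/-- Partial derivatives of an expression in a jet are smooth expressions in a jet of higher order:
the coordinate form of the fact that total derivatives and changes of coordinates are smooth on jet
spaces. -/
theorem exists_prolonged_expression [FiniteDimensional ℝ E] [FiniteDimensional ℝ F]
    (k i : ℕ) {g : E × JetCoord E F k → H} (hg : ContDiff ℝ ∞ g) {φ : E → E} (hφ : ContDiff ℝ ∞ φ) :
    ∃ g' : E × JetCoord E F (k + i) → E [×i]→L[ℝ] H, ContDiff ℝ ∞ g' ∧
      ∀ (s : E → F) (z : E), SmoothNear s (φ z) →
        iteratedFDeriv ℝ i (fun w => g (w, (φ w, jetAt k s (φ w)))) z =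
          g' (z, (φ z, jetAt (k + i) s (φ z))) := by
  obtain ⟨ρ, hρ, hρs⟩ := exists_jet_realization E F (k + i)
  let f : JetCoord E F (k + i) → E → H :=
    fun c w => g (w, (φ w, jetAt k (fun x => ρ c.2 (x - c.1)) (φ w)))
  have hjet : ContDiff ℝ ∞ (fun q : JetCoord E F (k + i) × E =>
      jetAt k (fun x => ρ q.1.2 (x - q.1.1)) q.2) := by
    refine contDiff_pi.2 fun a => ?_
    refine contDiff_iteratedFDeriv_param (f := fun (c : JetCoord E F (k + i)) x =>
      ρ c.2 (x - c.1)) ?_ a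
    exact hρ.comp ((contDiff_snd.comp contDiff_fst).prodMk
      (contDiff_snd.sub (contDiff_fst.comp contDiff_fst)))
  have hf : ContDiff ℝ ∞ (fun q : JetCoord E F (k + i) × E => f q.1 q.2) := by
    refine hg.comp (contDiff_snd.prodMk ((hφ.comp contDiff_snd).prodMk ?_))
    exact hjet.comp (contDiff_fst.prodMk (hφ.comp contDiff_snd))
  refine ⟨fun q => iteratedFDeriv ℝ i (f q.2) q.1, ?_, fun s z hs => ?_⟩
  · exact (contDiff_iteratedFDeriv_param hf i).comp (contDiff_snd.prodMk contDiff_fst)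
  · have hr : ContDiff ℝ ∞ (fun x => ρ (jetAt (k + i) s (φ z)) (x - φ z)) :=
      hρ.comp (contDiff_const.prodMk (contDiff_id.sub contDiff_const))
    have hs' := hρs s (φ z) hs
    -- The realization `r` has the same jet of order `k + i` at `φ z` as `s`; the derivative of
    -- order `i` of an expression in the jet of order `k` sees nothing else of `s`.
    set r := fun x => ρ (jetAt (k + i) s (φ z)) (x - φ z) with hrdef
    have c1 : ContDiffAt ℝ ∞ (fun w => jetAt k s (φ w)) z :=
      (hs.jetAt k).contDiffAt.comp z hφ.contDiffAt
    have c2 : ContDiffAt ℝ ∞ (fun w => jetAt k r (φ w)) z :=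
      ((hr.smoothNear (φ z)).jetAt k).contDiffAt.comp z hφ.contDiffAt
    change _ = iteratedFDeriv ℝ i (fun w => g (w, (φ w, jetAt k r (φ w)))) z
    refine iteratedFDeriv_comp_congr_right (h := g) (fun m hm => ?_) hg.contDiffAt
      (contDiffAt_id.prodMk (hφ.contDiffAt.prodMk c1))
      (contDiffAt_id.prodMk (hφ.contDiffAt.prodMk c2))
    refine iteratedFDeriv_prod_congr rfl (iteratedFDeriv_prod_congr rfl ?_ hφ.contDiffAt
      hφ.contDiffAt c1 c2) contDiffAt_id contDiffAt_id (hφ.contDiffAt.prodMk c1)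
      (hφ.contDiffAt.prodMk c2)
    refine iteratedFDeriv_pi_congr (fun a => ?_) c1 c2
    refine iteratedFDeriv_comp_congr_left (g₁ := iteratedFDeriv ℝ a s)
      (g₂ := iteratedFDeriv ℝ a r) (fun b hb => ?_) hφ.contDiffAt
      (hs.iteratedFDeriv a).contDiffAt ((hr.smoothNear (φ z)).iteratedFDeriv a).contDiffAt
    refine iteratedFDeriv_iteratedFDeriv_congr a b ?_
    exact (congrFun hs' ⟨a + b, by omega⟩).symm

end JetFibre

end JetGeometry

namespace JetGeometry

/-! ### Smooth parametric integrals and the Hadamard lemma -/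

section Hadamard

variable {C H P : Type*} [NormedAddCommGroup C] [NormedSpace ℝ C]
  [NormedAddCommGroup H] [NormedSpace ℝ H] [NormedAddCommGroup P] [NormedSpace ℝ P]

theorem contDiff_integral_param {g : P × ℝ → H} (hg : ContDiff ℝ ∞ g) :
    ContDiff ℝ ∞ (fun p => ∫ t in (0 : ℝ)..1, g (p, t)) := by
  -- The integral is a convolution with the indicator of the unit interval, evaluated at `0`.
  let χ : ContDiffBump (-(1 / 2) : ℝ) := ⟨1, 2, by norm_num, by norm_num⟩
  have key := MeasureTheory.contDiffOn_convolution_right_with_param_comp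
    (μ := MeasureTheory.volume) (n := ⊤)
    (ContinuousLinearMap.lsmul ℝ ℝ : ℝ →L[ℝ] H →L[ℝ] H) (s := (Set.univ : Set P))
    (v := fun _ => (0 : ℝ)) contDiffOn_const
    (f := Set.indicator (Set.Ioc (0 : ℝ) 1) (fun _ => (1 : ℝ)))
    (g := fun p s => χ s • g (p, -s)) (k := Metric.closedBall (-(1 / 2) : ℝ) 2) isOpen_univ
    (isCompact_closedBall _ _) ?_ ?_ ?_
  · rw [contDiffOn_univ] at key
    convert key using 1
    funext p
    rw [MeasureTheory.convolution_def, intervalIntegral.integral_of_le zero_le_one,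
      ← MeasureTheory.integral_indicator measurableSet_Ioc]
    congr 1
    funext t
    by_cases ht : t ∈ Set.Ioc (0 : ℝ) 1
    · have h1 : χ (0 - t) = 1 := χ.one_of_mem_closedBall (by
        simp only [Metric.mem_closedBall, Real.dist_eq, χ]
        rw [abs_le]
        constructor <;> linarith [ht.1, ht.2])
      simp only [Set.indicator_of_mem ht, h1]
      simp
    · simp only [Set.indicator_of_notMem ht]
      simp
  · intro p x _ hx
    simp only [Metric.mem_closedBall, not_le] at hx
    rw [χ.zero_of_le_dist hx.le, zero_smul]
  · exact ((MeasureTheory.integrable_indicator_iff measurableSet_Ioc).2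
      (MeasureTheory.integrableOn_const (by simp))).locallyIntegrable
  · refine ContDiff.contDiffOn ?_
    exact (χ.contDiff.comp contDiff_snd).smul
      (hg.comp (contDiff_fst.prodMk (contDiff_snd.neg)))

variable {Y : Type*} [TopologicalSpace Y]

/-- Near `z₀` the function `h` on `Y × ℝ^∞` is a smooth function of the coordinates `c` on `Y` and
of the first `N` coordinates on `ℝ^∞`. -/
def SmoothInCoords (N : ℕ) (c : Y → C) (h : Y × (ℕ → ℝ) → H) (z₀ : Y × (ℕ → ℝ)) : Prop :=
  ∃ g : C × (Fin N → ℝ) → H, ContDiff ℝ ∞ g ∧ ∀ᶠ z in 𝓝 z₀, h z = g (c z.1, fun i => z.2 i)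

/-- Integration along the segments from the zero section preserves smoothness and does not raise
the number of coordinates involved. -/
theorem SmoothInCoords.integral {N : ℕ} {c : Y → C} {h : Y × (ℕ → ℝ) → H} {y₀ : Y} {w₀ : ℕ → ℝ}
    (hh : ∀ t ∈ Set.Icc (0 : ℝ) 1, SmoothInCoords N c h (y₀, t • w₀)) :
    SmoothInCoords N c (fun z => ∫ t in (0 : ℝ)..1, h (z.1, t • z.2)) (y₀, w₀) := by
  classical
  -- Near each point of the segment `h` has a smooth expression; the expressions for different parts
  -- of the segment are glued by a partition of unity on the unit interval.
  choose! g hg hgh using hh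
  have h1 : ∀ t ∈ Set.Icc (0 : ℝ) 1, ∃ A ∈ 𝓝 (y₀, w₀), ∃ U : Set ℝ, IsOpen U ∧ t ∈ U ∧
      ∀ z ∈ A, ∀ τ ∈ U, h (z.1, τ • z.2) = g t (c z.1, fun i => τ * z.2 i) := by
    intro t ht
    have hc : Continuous (fun q : (Y × (ℕ → ℝ)) × ℝ => (q.1.1, q.2 • q.1.2)) := by fun_prop
    have h2 : ∀ᶠ q in 𝓝 (y₀, w₀) ×ˢ 𝓝 t, h (q.1.1, q.2 • q.1.2) =
        g t (c q.1.1, fun i => q.2 * q.1.2 i) := by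
      rw [← nhds_prod_eq]
      exact (hc.continuousAt (x := ((y₀, w₀), t))).eventually (hgh t ht)
    obtain ⟨pa, ha, pb, hb, hab⟩ := eventually_prod_iff.1 h2
    obtain ⟨U, hU, hUo, htU⟩ := eventually_nhds_iff.1 hb
    exact ⟨_, ha, U, hUo, htU, fun z hz τ hτ => hab hz (hU τ hτ)⟩
  choose A hA U hUo htU hAU using h1
  obtain ⟨ρ, hρ⟩ := SmoothPartitionOfUnity.exists_isSubordinate 𝓘(ℝ, ℝ)
    (isClosed_Icc (a := (0 : ℝ)) (b := 1)) (fun t : Set.Icc (0 : ℝ) 1 => U t.1 t.2)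
    (fun t => hUo t.1 t.2) (fun t ht => Set.mem_iUnion.2 ⟨⟨t, ht⟩, htU t ht⟩)
  have hfin := ρ.locallyFinite.finite_nonempty_inter_compact (isCompact_Icc (a := (0 : ℝ)) (b := 1))
  let S := hfin.toFinset
  let G : (C × (Fin N → ℝ)) × ℝ → H := fun q =>
    ∑ i ∈ S, ρ i q.2 • g i.1 (q.1.1, fun j => q.2 * q.1.2 j)
  have hG : ContDiff ℝ ∞ G := by
    refine ContDiff.sum fun i _ => ?_
    refine ((ρ i).contMDiff.contDiff.comp contDiff_snd).smul ((hg i.1 i.2).comp ?_)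
    refine (contDiff_fst.comp contDiff_fst).prodMk (contDiff_pi.2 fun j => ?_)
    exact contDiff_snd.mul ((contDiff_apply ℝ ℝ j).comp (contDiff_snd.comp contDiff_fst))
  refine ⟨_, contDiff_integral_param hG, ?_⟩
  filter_upwards [(Filter.biInter_finset_mem S).2 fun i _ => hA i.1 i.2] with z hz
  refine intervalIntegral.integral_congr fun t ht => ?_
  rw [Set.uIcc_of_le zero_le_one] at ht
  have hsupp : (Function.support fun i => ρ i t) ⊆ S := fun i hi => by
    simp only [S, Set.Finite.coe_toFinset, Set.mem_ofPred_eq]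
    exact ⟨t, hi, ht⟩
  have hsum : ∑ i ∈ S, ρ i t = 1 := by
    rw [← finsum_eq_sum_of_support_subset _ hsupp]
    exact ρ.sum_eq_one ht
  change h (z.1, t • z.2) = ∑ i ∈ S, ρ i t • g i.1 (c z.1, fun j => t * z.2 j)
  refine (one_smul ℝ (h (z.1, t • z.2))).symm.trans ?_
  rw [← congrArg (· • h (z.1, t • z.2)) hsum, Finset.sum_smul]
  refine Finset.sum_congr rfl fun i hi => ?_
  by_cases h0 : ρ i t = 0
  · rw [h0, zero_smul, zero_smul]
  · rw [hAU i.1 i.2 z (Set.mem_iInter₂.1 hz i hi) t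
      (hρ i (subset_closure (Function.mem_support.2 h0)))]

/-- The partial derivative of `h` in the direction of the `i`-th coordinate of `ℝ^∞`. -/
noncomputable def coordDeriv (i : ℕ) (h : Y × (ℕ → ℝ) → H) (z : Y × (ℕ → ℝ)) : H :=
  deriv (fun ε : ℝ => h (z.1, z.2 + ε • Pi.single i 1)) 0

/-- The chain rule for a curve `γ` in `ℝ^∞`: it has to be differentiable only in each coordinate, as
`h` locally depends on finitely many of them. -/
theorem hasDerivAt_of_eventuallyEq_coords {N : ℕ} {c : Y → C} {h : Y × (ℕ → ℝ) → H}
    {z₀ : Y × (ℕ → ℝ)} {g : C × (Fin N → ℝ) → H} (hg : ContDiff ℝ ∞ g)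
    (hgh : ∀ᶠ z in 𝓝 z₀, h z = g (c z.1, fun i => z.2 i)) {γ : ℝ → ℕ → ℝ} {γ' : ℕ → ℝ} {t : ℝ}
    (hγ : ∀ i, HasDerivAt (fun τ => γ τ i) (γ' i) t) (hγt : γ t = z₀.2) :
    HasDerivAt (fun τ => h (z₀.1, γ τ))
      (fderiv ℝ g (c z₀.1, fun i => z₀.2 i) (0, fun i => γ' i)) t := by
  have h1 : HasDerivAt (fun τ => (c z₀.1, fun i : Fin N => γ τ i)) ((0 : C), fun i : Fin N => γ' i)
      t := (hasDerivAt_const t (c z₀.1)).prodMk (hasDerivAt_pi.2 fun i => hγ i)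
  have h2 := ((hg.differentiable (by simp)).differentiableAt
    (x := (c z₀.1, fun i : Fin N => γ t i))) |>.hasFDerivAt.comp_hasDerivAt t h1
  simp only [hγt] at h2
  refine h2.congr_of_eventuallyEq ?_
  have hcont : ContinuousAt (fun τ => (z₀.1, γ τ)) t :=
    continuousAt_const.prodMk (continuousAt_pi.2 fun i => (hγ i).continuousAt)
  have h3 : Tendsto (fun τ => (z₀.1, γ τ)) (𝓝 t) (𝓝 z₀) := by
    have := hcont.tendsto
    rwa [hγt] at this
  exact h3.eventually hgh

theorem SmoothInCoords.coordDeriv_eventuallyEq {N : ℕ} {c : Y → C} {h : Y × (ℕ → ℝ) → H}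
    {z₀ : Y × (ℕ → ℝ)} {g : C × (Fin N → ℝ) → H} (hg : ContDiff ℝ ∞ g)
    (hgh : ∀ᶠ z in 𝓝 z₀, h z = g (c z.1, fun i => z.2 i)) (i : ℕ) :
    ∀ᶠ z in 𝓝 z₀, coordDeriv i h z =
      fderiv ℝ g (c z.1, fun j => z.2 j) (0, fun j => (Pi.single i 1 : ℕ → ℝ) j) := by
  filter_upwards [hgh.eventually_nhds] with z hz
  refine (hasDerivAt_of_eventuallyEq_coords hg hz (γ := fun ε => z.2 + ε • Pi.single i 1)
    (fun j => ?_) (by simp)).deriv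
  simpa using ((hasDerivAt_id (0 : ℝ)).mul_const ((Pi.single i 1 : ℕ → ℝ) j)).const_add (z.2 j)

theorem SmoothInCoords.coordDeriv {N : ℕ} {c : Y → C} {h : Y × (ℕ → ℝ) → H}
    {z₀ : Y × (ℕ → ℝ)} (hh : SmoothInCoords N c h z₀) (i : ℕ) :
    SmoothInCoords N c (coordDeriv i h) z₀ := by
  obtain ⟨g, hg, hgh⟩ := hh
  refine ⟨fun p => fderiv ℝ g p (0, fun j => (Pi.single i 1 : ℕ → ℝ) j), ?_,
    coordDeriv_eventuallyEq hg hgh i⟩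
  exact (hg.fderiv_right (m := ∞) (by simp)).clm_apply contDiff_const

/-- **Hadamard's lemma** on `Y × W` with `W ⊆ ℝ^∞` star-shaped: a smooth function that vanishes for
`w = 0` is a combination of finitely many coordinates `w i` with smooth coefficients, and the
coefficients involve no more coordinates than the function. -/
theorem exists_hadamard [CompleteSpace H] {N : ℕ} {c : Y → Y → C} {W : Set (ℕ → ℝ)}
    (hW : StarConvex ℝ (0 : ℕ → ℝ) W) {h : Y × (ℕ → ℝ) → H}
    (hh : ∀ y, ∀ w ∈ W, SmoothInCoords N (c y) h (y, w)) (h0 : ∀ y, h (y, 0) = 0) :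
    ∃ b : Fin N → Y × (ℕ → ℝ) → H, (∀ i y, ∀ w ∈ W, SmoothInCoords N (c y) (b i) (y, w)) ∧
      ∀ y, ∀ w ∈ W, h (y, w) = ∑ i : Fin N, w i • b i (y, w) := by
  have hseg : ∀ w ∈ W, ∀ t ∈ Set.Icc (0 : ℝ) 1, t • w ∈ W := fun w hw t ht =>
    starConvex_zero_iff.1 hW hw ht.1 ht.2
  -- The coefficients are the integrals of the partial derivatives along the segments from the zero
  -- section; the expansion is the fundamental theorem of calculus on a segment.
  refine ⟨fun i z => ∫ t in (0 : ℝ)..1, coordDeriv i h (z.1, t • z.2), fun i y w hw =>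
    SmoothInCoords.integral fun t ht => (hh y _ (hseg w hw t ht)).coordDeriv i, fun y w hw => ?_⟩
  have hderiv : ∀ t ∈ Set.uIcc (0 : ℝ) 1, HasDerivAt (fun t : ℝ => h (y, t • w))
      (∑ i : Fin N, w i • coordDeriv i h (y, t • w)) t := by
    intro t ht
    rw [Set.uIcc_of_le zero_le_one] at ht
    obtain ⟨g, hg, hgh⟩ := hh y _ (hseg w hw t ht)
    have h1 := hasDerivAt_of_eventuallyEq_coords hg hgh (γ := fun t => t • w) (γ' := w) (t := t)
      (fun j => by simpa using (hasDerivAt_id t).mul_const (w j)) rfl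
    convert h1 using 1
    have h2 : ((0 : C), fun i : Fin N => w i) =
        ∑ i : Fin N, w i • ((0 : C), fun j : Fin N => (Pi.single (i : ℕ) 1 : ℕ → ℝ) j) := by
      refine Prod.ext ?_ ?_
      · simp [Prod.fst_sum]
      · funext j
        simp only [Prod.snd_sum, Finset.sum_apply, Prod.smul_mk, Pi.smul_apply, smul_eq_mul]
        rw [Finset.sum_eq_single j]
        · simp
        · intro i _ hij
          rw [Pi.single_eq_of_ne (fun h => hij (Fin.ext h.symm)), mul_zero]
        · simp
    rw [h2, map_sum]
    refine Finset.sum_congr rfl fun i _ => ?_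
    rw [map_smul, (SmoothInCoords.coordDeriv_eventuallyEq hg hgh i).self_of_nhds]
  have hcont : ∀ i : Fin N, ContinuousOn (fun t : ℝ => coordDeriv i h (y, t • w))
      (Set.uIcc 0 1) := by
    intro i t ht
    rw [Set.uIcc_of_le zero_le_one] at ht
    obtain ⟨g, hg, hgh⟩ := (hh y _ (hseg w hw t ht)).coordDeriv i
    refine ContinuousAt.continuousWithinAt ?_
    have hc : Continuous (fun t : ℝ => (y, t • w)) := by fun_prop
    have h1 := (hc.continuousAt (x := t)).eventually hgh
    refine ContinuousAt.congr ?_ (h1.mono fun _ h => h.symm)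
    have h2 : Continuous (fun t : ℝ => (c y y, fun j : Fin N => (t • w) j)) :=
      continuous_const.prodMk (continuous_pi fun j => continuous_id.mul continuous_const)
    exact (hg.continuous.comp h2).continuousAt
  have hint : ∀ i ∈ (Finset.univ : Finset (Fin N)), IntervalIntegrable
      (fun t : ℝ => w i • coordDeriv i h (y, t • w)) MeasureTheory.volume 0 1 := fun i _ =>
    ((hcont i).const_smul (w i)).intervalIntegrable
  have hFTC := intervalIntegral.integral_eq_sub_of_hasDerivAt hderiv
    (ContinuousOn.intervalIntegrable (continuousOn_finsetSum _ fun i _ =>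
      (hcont i).const_smul (w i)))
  rw [intervalIntegral.integral_finsetSum hint] at hFTC
  simp only [intervalIntegral.integral_smul, one_smul, zero_smul, h0, sub_zero] at hFTC
  exact hFTC.symm

end Hadamard

/-! ### Factorization through a submersion -/

section Submersion

variable {E S T : Type*} [NormedAddCommGroup E] [NormedSpace ℝ E] [CompleteSpace E]
  [NormedAddCommGroup S] [NormedSpace ℝ S] [CompleteSpace S]
  [NormedAddCommGroup T] [NormedSpace ℝ T]

/-- If the kernel of the derivative of the submersion `B` lies in that of the derivative of `f`,
then `f` is locally a function of `B`. -/
theorem exists_factor_through_submersion {f : E × S → T} {B : E × S → E} {y₀ : E}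
    (hf : SmoothNear f (y₀, 0)) (hB : SmoothNear B (y₀, 0)) (hB0 : B (y₀, 0) = y₀)
    (hid : ∀ X, fderiv ℝ B (y₀, 0) (X, 0) = X)
    (hker : ∀ᶠ ζ in 𝓝 ((y₀, 0) : E × S), ∀ η, fderiv ℝ B ζ η = 0 → fderiv ℝ f ζ η = 0) :
    ∃ s : E → T, SmoothNear s y₀ ∧ ∀ᶠ ζ in 𝓝 ((y₀, 0) : E × S), f ζ = s (B ζ) := by
  -- `Ψ` is a coordinate system near the point in which `B` is the projection to the first factor.
  let Ψ : E × S → E × S := fun ζ => (B ζ, ζ.2)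
  have hΨ : SmoothNear Ψ (y₀, 0) := hB.prodMk (contDiff_snd.smoothNear _)
  have hΨ' : ∀ ζ, ContDiffAt ℝ ∞ B ζ →
      HasFDerivAt Ψ ((fderiv ℝ B ζ).prod (ContinuousLinearMap.snd ℝ E S)) ζ := fun ζ h =>
    (h.differentiableAt (by simp)).hasFDerivAt.prodMk hasFDerivAt_snd
  let D := fderiv ℝ B (y₀, 0) ∘L ContinuousLinearMap.inr ℝ E S
  let e : (E × S) ≃L[ℝ] (E × S) := ContinuousLinearEquiv.equivOfInverse
    ((ContinuousLinearMap.fst ℝ E S + D ∘L ContinuousLinearMap.snd ℝ E S).prod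
      (ContinuousLinearMap.snd ℝ E S))
    ((ContinuousLinearMap.fst ℝ E S - D ∘L ContinuousLinearMap.snd ℝ E S).prod
      (ContinuousLinearMap.snd ℝ E S)) (fun p => by simp) (fun p => by simp)
  have he : (fderiv ℝ B (y₀, 0)).prod (ContinuousLinearMap.snd ℝ E S) =
      (e : E × S →L[ℝ] E × S) := by
    refine ContinuousLinearMap.ext fun p => Prod.ext ?_ rfl
    have h1 : p = (p.1, 0) + (0, p.2) := by simp
    change fderiv ℝ B (y₀, 0) p = p.1 + fderiv ℝ B (y₀, 0) (0, p.2)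
    conv_lhs => rw [h1, map_add, hid]
  have hstrict : HasStrictFDerivAt Ψ (e : E × S →L[ℝ] E × S) (y₀, 0) :=
    hΨ.contDiffAt.hasStrictFDerivAt' (he ▸ hΨ' _ hB.contDiffAt) (by simp)
  let φ := hstrict.toOpenPartialHomeomorph Ψ
  have hφ : (φ : E × S → E × S) = Ψ := hstrict.toOpenPartialHomeomorph_coe
  have hsrc : ((y₀, 0) : E × S) ∈ φ.source := hstrict.mem_toOpenPartialHomeomorph_source
  have hΨ0 : Ψ (y₀, 0) = (y₀, 0) := Prod.ext hB0 rfl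
  have htgt : ((y₀, 0) : E × S) ∈ φ.target := by
    have := hstrict.image_mem_toOpenPartialHomeomorph_target
    rwa [hΨ0] at this
  have hsymm0 : φ.symm (y₀, 0) = (y₀, 0) := by
    have := φ.left_inv hsrc
    rwa [hφ, hΨ0] at this
  have hinv : ∀ᶠ ζ in 𝓝 ((y₀, 0) : E × S), ContDiffAt ℝ ∞ B ζ ∧
      ∃ e' : (E × S) ≃L[ℝ] (E × S), HasFDerivAt Ψ (e' : E × S →L[ℝ] E × S) ζ := by
    have h1 : ContinuousAt (fun ζ => (fderiv ℝ B ζ).prod (ContinuousLinearMap.snd ℝ E S))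
        ((y₀, 0) : E × S) := by
      have h2 : ContinuousAt (fderiv ℝ B) ((y₀, 0) : E × S) :=
        hB.contDiffAt.continuousAt_fderiv (by simp)
      have h3 : ContinuousAt (fun ζ => (ContinuousLinearMap.inl ℝ E S) ∘L fderiv ℝ B ζ +
          (ContinuousLinearMap.inr ℝ E S) ∘L (ContinuousLinearMap.snd ℝ E S)) ((y₀, 0) : E × S) :=
        (continuousAt_const.clm_comp h2).add continuousAt_const
      refine h3.congr (Eventually.of_forall fun ζ => ?_)
      refine ContinuousLinearMap.ext fun p => Prod.ext ?_ ?_ <;> simp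
    have h4 : ∀ᶠ ζ in 𝓝 ((y₀, 0) : E × S),
        (fderiv ℝ B ζ).prod (ContinuousLinearMap.snd ℝ E S) ∈
          Set.range ((↑) : ((E × S) ≃L[ℝ] (E × S)) → (E × S →L[ℝ] E × S)) := by
      refine h1.eventually_mem ?_
      rw [he]
      exact e.nhds
    filter_upwards [h4, hB] with ζ h5 h6
    obtain ⟨e', he'⟩ := h5
    exact ⟨h6, e', he' ▸ hΨ' ζ h6⟩
  have hcs : ContinuousAt φ.symm (y₀, 0) := φ.continuousAt_symm htgt
  have hts : Tendsto φ.symm (𝓝 (y₀, 0)) (𝓝 (y₀, 0)) := by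
    have := hcs.tendsto
    rwa [hsymm0] at this
  have hsm : SmoothNear φ.symm (y₀, 0) := by
    filter_upwards [hts.eventually hinv, hts.eventually hΨ, φ.open_target.mem_nhds htgt]
      with z h1 h2 hz
    obtain ⟨-, e', he'⟩ := h1
    exact φ.contDiffAt_symm hz (f₀' := e') (by rwa [hφ]) (by rwa [hφ])
  have hh : SmoothNear (fun z => f (φ.symm z)) (y₀, 0) :=
    SmoothNear.comp (by rwa [hsymm0]) hsm
  have htgt' : ∀ᶠ z in 𝓝 ((y₀, 0) : E × S), z ∈ φ.target := φ.open_target.mem_nhds htgt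
  -- In the coordinates given by `Ψ`, the derivative of `f` along the second factor vanishes.
  have hzero : ∀ᶠ z in 𝓝 ((y₀, 0) : E × S), ContDiffAt ℝ ∞ (fun z => f (φ.symm z)) z ∧
      ∀ p : S, fderiv ℝ (fun z => f (φ.symm z)) z (0, p) = 0 := by
    filter_upwards [hh, hsm, hts.eventually hinv, hts.eventually hf, hts.eventually hker,
      htgt'.eventually_nhds]
      with z h1 h2 h3 h4 h5 h6
    refine ⟨h1, fun p => ?_⟩
    have d1 : HasFDerivAt φ.symm (fderiv ℝ φ.symm z) z :=
      (h2.differentiableAt (by simp)).hasFDerivAt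
    have d2 : HasFDerivAt f (fderiv ℝ f (φ.symm z)) (φ.symm z) :=
      (h4.differentiableAt (by simp)).hasFDerivAt
    have d3 : HasFDerivAt (fun z => Ψ (φ.symm z)) _ z := (hΨ' _ h3.1).comp z d1
    have d4 : HasFDerivAt (fun z => Ψ (φ.symm z)) (ContinuousLinearMap.id ℝ (E × S)) z := by
      refine (hasFDerivAt_id z).congr_of_eventuallyEq (h6.mono fun w hw => ?_)
      change Ψ (φ.symm w) = w
      rw [← hφ]
      exact φ.right_inv hw
    have h7 := congrArg (fun L : E × S →L[ℝ] E × S => (L (0, p)).1) (d3.unique d4)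
    have h8 : fderiv ℝ B (φ.symm z) (fderiv ℝ φ.symm z (0, p)) = 0 := by simpa using h7
    have h9 := (d2.comp z d1).fderiv
    change fderiv ℝ (fun z => f (φ.symm z)) z = _ at h9
    rw [h9]
    exact h5 _ h8
  obtain ⟨ε, hε, hball⟩ := Metric.eventually_nhds_iff_ball.1 hzero
  have hconst : ∀ z ∈ Metric.ball ((y₀, 0) : E × S) ε, f (φ.symm z) = f (φ.symm (z.1, 0)) := by
    rintro ⟨x, p⟩ hz
    rw [← ball_prod_same] at hz
    have hd : ∀ q ∈ Metric.ball (0 : S) ε,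
        HasFDerivAt (fun q => f (φ.symm (x, q))) (0 : S →L[ℝ] T) q := fun q hq => by
      obtain ⟨h1, h2⟩ := hball (x, q) (by rw [← ball_prod_same]; exact ⟨hz.1, hq⟩)
      have h3 : HasFDerivAt (fun q : S => f (φ.symm (x, q))) _ q :=
        HasFDerivAt.comp (g := fun z => f (φ.symm z)) q
          (h1.differentiableAt (by simp)).hasFDerivAt (hasFDerivAt_prodMk_right x q)
      refine h3.congr_fderiv (ContinuousLinearMap.ext fun p => ?_)
      simpa using h2 p
    exact (convex_ball (0 : S) ε).is_const_of_fderivWithin_eq_zero (𝕜 := ℝ)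
      (fun q hq => (hd q hq).differentiableAt.differentiableWithinAt)
      (fun q hq => by
        rw [fderivWithin_of_isOpen Metric.isOpen_ball hq, (hd q hq).fderiv])
      hz.2 (Metric.mem_ball_self hε)
  refine ⟨fun x => f (φ.symm (x, 0)), SmoothNear.comp (g := fun z => f (φ.symm z))
    (f := fun x => (x, (0 : S))) hh ((contDiff_id.prodMk contDiff_const).smoothNear _), ?_⟩
  have hcΨ : Tendsto Ψ (𝓝 (y₀, 0)) (𝓝 (y₀, 0)) := by
    have := hΨ.contDiffAt.continuousAt.tendsto
    rwa [hΨ0] at this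
  filter_upwards [hcΨ.eventually (Metric.ball_mem_nhds _ hε), φ.open_source.mem_nhds hsrc]
    with ζ h1 h2
  have h3 := hconst _ h1
  have h4 : φ.symm (Ψ ζ) = ζ := by
    rw [← hφ]
    exact φ.left_inv h2
  rw [h4] at h3
  exact h3

/-- By the inverse function theorem, a map whose derivative at a fixed point is the identity is open
there. -/
theorem eventually_exists_eq_of_fderiv_eq_id {β : E → E} {y₀ : E} (hβ : ContDiffAt ℝ ∞ β y₀)
    (hβ0 : β y₀ = y₀) (hid : ∀ X, fderiv ℝ β y₀ X = X) {N : Set E} (hN : N ∈ 𝓝 y₀) :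
    ∀ᶠ x in 𝓝 y₀, ∃ y ∈ N, β y = x := by
  have h1 : HasStrictFDerivAt β ((ContinuousLinearEquiv.refl ℝ E : E ≃L[ℝ] E) : E →L[ℝ] E) y₀ := by
    refine hβ.hasStrictFDerivAt' ?_ (by simp)
    exact (hβ.differentiableAt (by simp)).hasFDerivAt.congr_fderiv
      (ContinuousLinearMap.ext fun X => hid X)
  have h2 := h1.map_nhds_eq_of_equiv
  rw [hβ0] at h2
  rw [← h2]
  exact Filter.eventually_map.2 (Filter.mem_of_superset hN fun y hy => ⟨y, hy, rfl⟩)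

end Submersion

end JetGeometry

namespace JetGeometry

/-! ### Vector bundles in coordinates -/

section Charts

variable {E : Type*} [NormedAddCommGroup E] [NormedSpace ℝ E]
  {M : Type*} [TopologicalSpace M] [ChartedSpace E M]
  {H : Type*} [NormedAddCommGroup H] [NormedSpace ℝ H]

theorem eventually_chart_symm {x₀ x : M} (hx : x ∈ (chartAt E x₀).source) {p : M → Prop}
    (hp : ∀ᶠ x' in 𝓝 x, p x') : ∀ᶠ z in 𝓝 (chartAt E x₀ x),
      z ∈ (chartAt E x₀).target ∧ p ((chartAt E x₀).symm z) := by
  refine ((chartAt E x₀).open_target.eventually_mem ((chartAt E x₀).map_source hx)).and ?_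
  exact ((chartAt E x₀).tendsto_symm hx).eventually hp

theorem eventually_chart {x₀ x : M} (hx : x ∈ (chartAt E x₀).source) {p : E → Prop}
    (hp : ∀ᶠ z in 𝓝 (chartAt E x₀ x), p z) :
    ∀ᶠ x' in 𝓝 x, x' ∈ (chartAt E x₀).source ∧ p (chartAt E x₀ x') :=
  ((chartAt E x₀).open_source.eventually_mem hx).and
    (((chartAt E x₀).continuousAt hx).eventually hp)

variable [IsManifold 𝓘(ℝ, E) ∞ M]

theorem smoothNear_comp_chart_symm {x₀ x : M} (hx : x ∈ (chartAt E x₀).source) {f : M → H}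
    (hf : ∀ᶠ x' in 𝓝 x, ContMDiffAt 𝓘(ℝ, E) 𝓘(ℝ, H) ∞ f x') :
    SmoothNear (fun z => f ((chartAt E x₀).symm z)) (chartAt E x₀ x) := by
  filter_upwards [eventually_chart_symm hx hf] with z hz
  refine contMDiffAt_iff_contDiffAt.1 ?_
  exact hz.2.comp z ((contMDiffOn_chart_symm (I := 𝓘(ℝ, E)) (x := x₀) z hz.1).contMDiffAt
    ((chartAt E x₀).open_target.mem_nhds hz.1))

theorem exists_contDiff_chart [FiniteDimensional ℝ E] {x₀ x : M}
    (hx : x ∈ (chartAt E x₀).source) {f : M → H}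
    (hf : ∀ᶠ x' in 𝓝 x, ContMDiffAt 𝓘(ℝ, E) 𝓘(ℝ, H) ∞ f x') :
    ∃ g : E → H, ContDiff ℝ ∞ g ∧ ∀ᶠ x' in 𝓝 x, f x' = g (chartAt E x₀ x') := by
  obtain ⟨g, hg, hgf⟩ := (smoothNear_comp_chart_symm hx hf).exists_contDiff
  refine ⟨g, hg, ?_⟩
  filter_upwards [eventually_chart hx hgf] with x' hx'
  rw [hx'.2, (chartAt E x₀).left_inv hx'.1]

theorem eventually_contMDiffAt_chart {x₀ x : M} (hx : x ∈ (chartAt E x₀).source) :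
    ∀ᶠ x' in 𝓝 x, ContMDiffAt 𝓘(ℝ, E) 𝓘(ℝ, E) ∞ (chartAt E x₀) x' := by
  filter_upwards [(chartAt E x₀).open_source.mem_nhds hx] with x' hx'
  exact (contMDiffOn_chart (I := 𝓘(ℝ, E)) (x := x₀) x' hx').contMDiffAt
    ((chartAt E x₀).open_source.mem_nhds hx')

theorem contMDiffAt_comp_chart {x₀ x : M} (hx : x ∈ (chartAt E x₀).source) {g : E → H}
    (hg : ContDiffAt ℝ ∞ g (chartAt E x₀ x)) :
    ContMDiffAt 𝓘(ℝ, E) 𝓘(ℝ, H) ∞ (fun x' => g (chartAt E x₀ x')) x :=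
  hg.contMDiffAt.comp x (eventually_contMDiffAt_chart hx).self_of_nhds

end Charts

section Coordinates

variable {E : Type*} [NormedAddCommGroup E] [NormedSpace ℝ E]
  {M : Type*} [TopologicalSpace M] [ChartedSpace E M]
  (F : Type*) [NormedAddCommGroup F] [NormedSpace ℝ F]
  (V : M → Type*) [TopologicalSpace (TotalSpace F V)] [∀ x, TopologicalSpace (V x)]
  [∀ x, AddCommGroup (V x)] [∀ x, Module ℝ (V x)] [FiberBundle F V] [VectorBundle ℝ F V]

/-- The coordinates of a vector in the fibre over `x`, in the preferred trivialization at `x₀`. -/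
noncomputable abbrev fibreCoord (x₀ : M) {x : M} (v : V x) : F :=
  (trivializationAt F V x₀ ⟨x, v⟩).2

theorem fibreCoord_add {x₀ x : M} (hx : x ∈ (trivializationAt F V x₀).baseSet) (v w : V x) :
    fibreCoord F V x₀ (v + w) = fibreCoord F V x₀ v + fibreCoord F V x₀ w :=
  ((trivializationAt F V x₀).linear ℝ hx).map_add v w

theorem fibreCoord_smul {x₀ x : M} (hx : x ∈ (trivializationAt F V x₀).baseSet) (c : ℝ) (v : V x) :
    fibreCoord F V x₀ (c • v) = c • fibreCoord F V x₀ v :=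
  ((trivializationAt F V x₀).linear ℝ hx).map_smul c v

theorem fibreCoord_zero {x₀ x : M} (hx : x ∈ (trivializationAt F V x₀).baseSet) :
    fibreCoord F V x₀ (0 : V x) = 0 :=
  ((trivializationAt F V x₀).linear ℝ hx).map_zero

theorem fibreCoord_symm {x₀ x : M} (hx : x ∈ (trivializationAt F V x₀).baseSet) (a : F) :
    fibreCoord F V x₀ ((trivializationAt F V x₀).symm x a) = a := by
  rw [fibreCoord, (trivializationAt F V x₀).apply_mk_symm hx]

theorem symm_fibreCoord {x₀ x : M} (hx : x ∈ (trivializationAt F V x₀).baseSet) (v : V x) :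
    (trivializationAt F V x₀).symm x (fibreCoord F V x₀ v) = v :=
  (trivializationAt F V x₀).symm_apply_apply_mk hx v

theorem fibreCoord_injective {x₀ x : M} (hx : x ∈ (trivializationAt F V x₀).baseSet) {v w : V x}
    (h : fibreCoord F V x₀ v = fibreCoord F V x₀ w) : v = w := by
  rw [← symm_fibreCoord F V hx v, h, symm_fibreCoord F V hx]

theorem isOpen_coordDomain (x₀ : M) : IsOpen (coordDomain E F V x₀) :=
  (chartAt E x₀).open_source.inter (trivializationAt F V x₀).open_baseSet

theorem mem_coordDomain_self (x₀ : M) : x₀ ∈ coordDomain E F V x₀ :=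
  ⟨mem_chart_source E x₀, FiberBundle.mem_baseSet_trivializationAt' x₀⟩

variable {F V}

theorem localRep_chart {x₀ x : M} (hx : x ∈ (chartAt E x₀).source) (s : (x : M) → V x) :
    localRep E F V x₀ s (chartAt E x₀ x) = fibreCoord F V x₀ (s x) :=
  congrArg (fun x => fibreCoord F V x₀ (s x)) ((chartAt E x₀).left_inv hx)

theorem localRep_congr {x₀ x : M} (hx : x ∈ (chartAt E x₀).source) {s t : (x : M) → V x}
    (h : ∀ᶠ x' in 𝓝 x, s x' = t x') :
    localRep E F V x₀ s =ᶠ[𝓝 (chartAt E x₀ x)] localRep E F V x₀ t := by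
  filter_upwards [eventually_chart_symm hx h] with z hz
  simp only [localRep, hz.2]

variable [IsManifold 𝓘(ℝ, E) ∞ M] [ContMDiffVectorBundle ∞ F V 𝓘(ℝ, E)]

/-- A change of trivialization, in terms of a chart of the base. -/
theorem exists_fibreCoord_change [FiniteDimensional ℝ E] {x₀ x₁ x₂ x : M}
    (hx : x ∈ (chartAt E x₀).source) (h₁ : x ∈ (trivializationAt F V x₁).baseSet)
    (h₂ : x ∈ (trivializationAt F V x₂).baseSet) :
    ∃ A : E → F →L[ℝ] F, ContDiff ℝ ∞ A ∧ ∀ᶠ x' in 𝓝 x, ∀ v : V x',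
      fibreCoord F V x₂ v = A (chartAt E x₀ x') (fibreCoord F V x₁ v) := by
  let e₁ := trivializationAt F V x₁
  let e₂ := trivializationAt F V x₂
  have hU : ∀ᶠ x' in 𝓝 x, x' ∈ e₁.baseSet ∩ e₂.baseSet :=
    (e₁.open_baseSet.inter e₂.open_baseSet).eventually_mem ⟨h₁, h₂⟩
  obtain ⟨A, hA, hA'⟩ := exists_contDiff_chart (E := E) hx
    (f := fun b => (e₁.coordChangeL ℝ e₂ b : F →L[ℝ] F))
    (hU.mono fun x' hx' => contMDiffAt_coordChangeL hx'.1 hx'.2)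
  refine ⟨A, hA, ?_⟩
  filter_upwards [hA', hU] with x' h h' v
  rw [← h]
  change _ = e₁.coordChangeL ℝ e₂ x' (fibreCoord F V x₁ v)
  rw [e₁.coordChangeL_apply e₂ h', symm_fibreCoord F V h'.1]

theorem smoothNear_localRep_of_contMDiffAt {x₀ x : M} (hx : x ∈ coordDomain E F V x₀)
    {s : (x : M) → V x} (hs : ∀ᶠ x' in 𝓝 x, ContMDiffAt 𝓘(ℝ, E) (𝓘(ℝ, E).prod 𝓘(ℝ, F)) ∞
      (fun x => TotalSpace.mk' F x (s x)) x') :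
    SmoothNear (localRep E F V x₀ s) (chartAt E x₀ x) := by
  refine smoothNear_comp_chart_symm (f := fun x => fibreCoord F V x₀ (s x)) hx.1 ?_
  filter_upwards [(trivializationAt F V x₀).open_baseSet.mem_nhds hx.2, hs] with x' hx' h
  exact ((trivializationAt F V x₀).contMDiffAt_section_iff hx').1 h

theorem smoothNear_localRep (s : Sections E F V) {x₀ x : M} (hx : x ∈ coordDomain E F V x₀) :
    SmoothNear (localRep E F V x₀ s) (chartAt E x₀ x) :=
  smoothNear_localRep_of_contMDiffAt hx (Eventually.of_forall fun x' => s.contMDiff x')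

/-- A change of coordinates on jet spaces of order `k`. -/
theorem exists_jetAt_change [FiniteDimensional ℝ E] [FiniteDimensional ℝ F] (k : ℕ) {x₁ x₂ x : M}
    (h₁ : x ∈ coordDomain E F V x₁) (h₂ : x ∈ coordDomain E F V x₂) :
    ∃ T : JetCoord E F k → JetCoord E F k, ContDiff ℝ ∞ T ∧ ∀ᶠ x' in 𝓝 x,
      ∀ s : (x : M) → V x, SmoothNear (localRep E F V x₁ s) (chartAt E x₁ x') →
        (chartAt E x₂ x', jetAt k (localRep E F V x₂ s) (chartAt E x₂ x')) =
          T (chartAt E x₁ x', jetAt k (localRep E F V x₁ s) (chartAt E x₁ x')) := by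
  obtain ⟨φ, hφ, hφ'⟩ := exists_contDiff_chart (E := E) h₂.1 (eventually_contMDiffAt_chart h₁.1)
  obtain ⟨ψ, hψ, hψ'⟩ := exists_contDiff_chart (E := E) h₁.1 (eventually_contMDiffAt_chart h₂.1)
  obtain ⟨A, hA, hA'⟩ := exists_fibreCoord_change (E := E) h₂.1 h₁.2 h₂.2
  let c := continuousMultilinearCurryFin0 ℝ E F
  -- The coordinate expression of a section in the second system, in terms of its value in the
  -- first: an expression in jets of order zero, of which the derivatives are taken.
  let g : E × JetCoord E F 0 → F := fun q => A q.1 (c (q.2.2 0))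
  have hg : ContDiff ℝ ∞ g := by
    refine (hA.comp contDiff_fst).clm_apply (c.contDiff.comp ?_)
    exact (contDiff_pi.1 (contDiff_snd.comp contDiff_snd)) 0
  choose! g' hg' hg'' using fun i : ℕ => exists_prolonged_expression (F := F) 0 i hg hφ
  let τ : (i : Fin (k + 1)) → JetFibre E F k → JetFibre E F (0 + i) :=
    fun i u j => u ⟨j, by omega⟩
  have hτ : ∀ i, ContDiff ℝ ∞ (τ i) := fun i => contDiff_pi.2 fun j =>
    contDiff_pi.1 contDiff_id (⟨j, by omega⟩ : Fin (k + 1))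
  refine ⟨fun q => (ψ q.1, fun i => g' i (ψ q.1, (q.1, τ i q.2))), ?_, ?_⟩
  · refine (hψ.comp contDiff_fst).prodMk (contDiff_pi.2 fun i => (hg' i).comp ?_)
    exact (hψ.comp contDiff_fst).prodMk (contDiff_fst.prodMk ((hτ i).comp contDiff_snd))
  · have hall : ∀ᶠ x' in 𝓝 x, x' ∈ (chartAt E x₁).source ∧ x' ∈ (chartAt E x₂).source ∧
        chartAt E x₁ x' = φ (chartAt E x₂ x') ∧ chartAt E x₂ x' = ψ (chartAt E x₁ x') ∧
        ∀ v : V x', fibreCoord F V x₂ v = A (chartAt E x₂ x') (fibreCoord F V x₁ v) := by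
      filter_upwards [(chartAt E x₁).open_source.mem_nhds h₁.1,
        (chartAt E x₂).open_source.mem_nhds h₂.1, hφ', hψ', hA'] with x' a b c d e
      exact ⟨a, b, c, d, e⟩
    filter_upwards [hall.eventually_nhds] with x' hx' s hs
    obtain ⟨hs1, hs2, e1, e2, -⟩ := hx'.self_of_nhds
    refine Prod.ext e2 ?_
    funext i
    have hloc : localRep E F V x₂ s =ᶠ[𝓝 (chartAt E x₂ x')]
        fun w => g (w, (φ w, jetAt 0 (localRep E F V x₁ s) (φ w))) := by
      filter_upwards [eventually_chart_symm hs2 hx'] with w hw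
      obtain ⟨hw0, hw1, hw2, hw3, -, hw4⟩ := hw
      rw [(chartAt E x₂).right_inv hw0] at hw3 hw4
      change fibreCoord F V x₂ (s ((chartAt E x₂).symm w)) = A w (localRep E F V x₁ s (φ w))
      rw [hw4, ← hw3, localRep_chart hw1]
    have h3 := (hloc.iteratedFDeriv ℝ i).self_of_nhds
    refine h3.trans ?_
    rw [hg'' i _ _ (by rwa [← e1])]
    simp only [← e2, ← e1]
    rfl

/-- A smooth local expression is, near the point, the coordinate expression of a global smooth
section: multiply by a bump function. -/
theorem exists_section_localRep_eq [FiniteDimensional ℝ E] [T2Space M] {x₀ x : M}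
    (hx : x ∈ coordDomain E F V x₀) {g : E → F} (hg : SmoothNear g (chartAt E x₀ x)) :
    ∃ t : Sections E F V, ∀ᶠ x' in 𝓝 x, fibreCoord F V x₀ (t x') = g (chartAt E x₀ x') := by
  have hU : ∀ᶠ x' in 𝓝 x, x' ∈ coordDomain E F V x₀ ∧ ContDiffAt ℝ ∞ g (chartAt E x₀ x') :=
    ((isOpen_coordDomain F V x₀).eventually_mem hx).and
      ((eventually_chart hx.1 hg).mono fun _ h => h.2)
  obtain ⟨U, hU, hUo, hxU⟩ := eventually_nhds_iff.1 hU
  obtain ⟨f, -, hf⟩ := (SmoothBumpFunction.nhds_basis_tsupport (I := 𝓘(ℝ, E)) x).mem_iff.1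
    (hUo.mem_nhds hxU)
  let e := trivializationAt F V x₀
  let s : (x : M) → V x := fun x' => e.symm x' (g (chartAt E x₀ x'))
  have hs : ContMDiffOn 𝓘(ℝ, E) (𝓘(ℝ, E).prod 𝓘(ℝ, F)) ∞ (fun x => TotalSpace.mk' F x (s x)) U := by
    intro x' hx'
    refine ContMDiffAt.contMDiffWithinAt ?_
    refine (e.contMDiffAt_section_iff (hU x' hx').1.2).2 ?_
    refine (contMDiffAt_comp_chart (hU x' hx').1.1 (hU x' hx').2).congr_of_eventuallyEq ?_
    filter_upwards [hUo.mem_nhds hx'] with x'' h''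
    exact fibreCoord_symm F V (hU x'' h'').1.2 _
  refine ⟨⟨_, ContMDiffOn.smul_section_of_tsupport f.contMDiff.contMDiffOn hUo hf hs⟩, ?_⟩
  filter_upwards [f.eventuallyEq_one, hUo.mem_nhds hxU] with x' h1 h2
  change fibreCoord F V x₀ (f x' • s x') = _
  rw [h1]
  simp only [Pi.one_apply, one_smul]
  exact fibreCoord_symm F V (hU x' h2).1.2 _

/-- Every finite-order jet in coordinates is the jet of a global section. -/
theorem exists_section_jetAt_eq [FiniteDimensional ℝ E] [T2Space M] {x₀ x : M}
    (hx : x ∈ coordDomain E F V x₀) {k : ℕ} {u : JetFibre E F k} (hu : u ∈ jetSpace E F k) :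
    ∃ t : Sections E F V, jetAt k (localRep E F V x₀ t) (chartAt E x₀ x) = u := by
  obtain ⟨g, hg, hgu⟩ := exists_contDiff_jetAt_eq hu (chartAt E x₀ x)
  obtain ⟨t, ht⟩ := exists_section_localRep_eq hx (hg.smoothNear _)
  refine ⟨t, ?_⟩
  rw [← hgu]
  refine jetAt_congr ?_ k
  filter_upwards [eventually_chart_symm hx.1 ht] with z hz
  have := hz.2
  rwa [(chartAt E x₀).right_inv hz.1] at this

/-! ### Coordinates and topology of the jet space -/

theorem InfJet.jet_sec (θ : InfJet E F V) : jet E F V θ.sec θ.base = θ := by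
  cases θ with
  | mk x c =>
    change InfJet.mk x (Quotient.mk _ (Quotient.out c)) = _
    rw [Quotient.out_eq]

theorem sameJet_sec_jet (s : Sections E F V) (x : M) :
    SameJet E F V x (jet E F V s x).sec s :=
  Quotient.exact (s := jetSetoid E F V x) (Quotient.out_eq (Quotient.mk (jetSetoid E F V x) s))

/-- Equality of jets does not depend on the coordinates. -/
theorem SameJet.jetAt_eq [FiniteDimensional ℝ E] [FiniteDimensional ℝ F] {x : M}
    {s t : (x : M) → V x} (h : SameJet E F V x s t)
    (hs : SmoothNear (localRep E F V x s) (chartAt E x x))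
    (ht : SmoothNear (localRep E F V x t) (chartAt E x x)) {x₀ : M}
    (hx : x ∈ coordDomain E F V x₀) (k : ℕ) :
    jetAt k (localRep E F V x₀ s) (chartAt E x₀ x) =
      jetAt k (localRep E F V x₀ t) (chartAt E x₀ x) := by
  obtain ⟨T, -, hT⟩ := exists_jetAt_change k (mem_coordDomain_self (E := E) F V x) hx
  have h1 := hT.self_of_nhds s hs
  have h2 := hT.self_of_nhds t ht
  have h3 : jetAt k (localRep E F V x s) (chartAt E x x) =
      jetAt k (localRep E F V x t) (chartAt E x x) := funext fun i => h i
  rw [h3] at h1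
  exact congrArg Prod.snd (h1.trans h2.symm)

theorem coords_jet [FiniteDimensional ℝ E] [FiniteDimensional ℝ F] (k : ℕ) {x₀ x : M}
    (hx : x ∈ coordDomain E F V x₀) (s : Sections E F V) :
    coords k x₀ (jet E F V s x) =
      (chartAt E x₀ x, jetAt k (localRep E F V x₀ s) (chartAt E x₀ x)) :=
  Prod.ext rfl ((sameJet_sec_jet s x).jetAt_eq (smoothNear_localRep _ (mem_coordDomain_self F V x))
    (smoothNear_localRep _ (mem_coordDomain_self F V x)) hx k)

theorem jet_eq_jet {s t : Sections E F V} {x : M} (h : SameJet E F V x s t) :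
    jet E F V s x = jet E F V t x :=
  congrArg (InfJet.mk x) (Quotient.sound (s := jetSetoid E F V x) h)

/-- A change of coordinates on the jet space preserves the order of the coordinates. -/
theorem exists_coords_change [FiniteDimensional ℝ E] [FiniteDimensional ℝ F] (k : ℕ) {x₁ x₂ x : M}
    (h₁ : x ∈ coordDomain E F V x₁) (h₂ : x ∈ coordDomain E F V x₂) :
    ∃ T : JetCoord E F k → JetCoord E F k, ContDiff ℝ ∞ T ∧ ∀ᶠ x' in 𝓝 x,
      ∀ θ : InfJet E F V, θ.base = x' → coords k x₂ θ = T (coords k x₁ θ) := by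
  obtain ⟨T, hT, h⟩ := exists_jetAt_change k h₁ h₂
  refine ⟨T, hT, ?_⟩
  filter_upwards [h, (isOpen_coordDomain F V x₁).mem_nhds h₁] with x' h1 h2 θ hθ
  subst hθ
  exact h1 θ.sec (smoothNear_localRep _ h2)

variable (E F) in
/-- Forgetting the coordinates of order greater than `k`. -/
noncomputable def jetTrunc {k k' : ℕ} (h : k ≤ k') : JetFibre E F k' →L[ℝ] JetFibre E F k :=
  ContinuousLinearMap.pi fun i =>
    ContinuousLinearMap.proj (R := ℝ) (φ := fun j : Fin (k' + 1) => E [×(j : ℕ)]→L[ℝ] F)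
      (⟨i, by omega⟩ : Fin (k' + 1))

variable (E F) in
/-- Forgetting the coordinates of order greater than `k`, keeping the base point. -/
noncomputable def coordTrunc {k k' : ℕ} (h : k ≤ k') : JetCoord E F k' →L[ℝ] JetCoord E F k :=
  (ContinuousLinearMap.id ℝ E).prodMap (jetTrunc E F h)

theorem coordTrunc_coords {k k' : ℕ} (h : k ≤ k') (x₀ : M) (θ : InfJet E F V) :
    coordTrunc E F h (coords k' x₀ θ) = coords k x₀ θ := rfl

theorem continuousAt_coords (k : ℕ) {x₀ : M} {θ₀ : InfJet E F V}
    (h : θ₀.base ∈ coordDomain E F V x₀) : ContinuousAt (coords k x₀) θ₀ := by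
  intro W hW
  obtain ⟨W', hW', ho, hm⟩ := mem_nhds_iff.1 hW
  have hopen : IsOpen {θ : InfJet E F V | θ.base ∈ coordDomain E F V x₀ ∧ coords k x₀ θ ∈ W'} :=
    TopologicalSpace.isOpen_generateFrom_of_mem ⟨x₀, k, W', ho, rfl⟩
  exact (hopen.eventually_mem ⟨h, hm⟩).mono fun θ hθ => hW' hθ.2

theorem continuous_base : Continuous (InfJet.base : InfJet E F V → M) := by
  rw [continuous_iff_continuousAt]
  intro θ₀
  set x₀ := θ₀.base with hx₀
  have hopen : IsOpen {θ : InfJet E F V | θ.base ∈ coordDomain E F V x₀ ∧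
      coords 0 x₀ θ ∈ (Set.univ : Set (JetCoord E F 0))} :=
    TopologicalSpace.isOpen_generateFrom_of_mem ⟨x₀, 0, Set.univ, isOpen_univ, rfl⟩
  have hmem : ∀ᶠ θ : InfJet E F V in 𝓝 θ₀, θ.base ∈ coordDomain E F V x₀ :=
    (hopen.eventually_mem ⟨mem_coordDomain_self F V x₀, trivial⟩).mono fun θ h => h.1
  have h1 : ContinuousAt (fun θ : InfJet E F V => (chartAt E x₀).symm (coords 0 x₀ θ).1) θ₀ := by
    refine ContinuousAt.comp (g := (chartAt E x₀).symm) ?_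
      (continuousAt_fst.comp (continuousAt_coords 0 (mem_coordDomain_self F V x₀)))
    exact (chartAt E x₀).continuousAt_symm ((chartAt E x₀).map_source (mem_chart_source E x₀))
  refine h1.congr (hmem.mono fun θ hθ => ?_)
  exact (chartAt E x₀).left_inv hθ.1

theorem eventually_base {θ₀ : InfJet E F V} {p : M → Prop} (h : ∀ᶠ x in 𝓝 θ₀.base, p x) :
    ∀ᶠ θ in 𝓝 θ₀, p θ.base :=
  continuous_base.continuousAt.eventually h

/-- The topology of the jet space near a point, in one fixed chart. -/
theorem mem_nhds_infJet_iff [FiniteDimensional ℝ E] [FiniteDimensional ℝ F] {x₀ : M}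
    {θ₀ : InfJet E F V} (h : θ₀.base ∈ coordDomain E F V x₀) {S : Set (InfJet E F V)} :
    S ∈ 𝓝 θ₀ ↔ ∃ k : ℕ, ∃ W ∈ 𝓝 (coords k x₀ θ₀), ∀ θ : InfJet E F V,
      θ.base ∈ coordDomain E F V x₀ → coords k x₀ θ ∈ W → θ ∈ S := by
  constructor
  -- The sets on the right-hand side form a filter `B`; it contains the generators of the topology
  -- because changes of coordinates are continuous.
  · let B : Filter (InfJet E F V) :=
      { sets := {S | ∃ k : ℕ, ∃ W ∈ 𝓝 (coords k x₀ θ₀), ∀ θ : InfJet E F V,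
          θ.base ∈ coordDomain E F V x₀ → coords k x₀ θ ∈ W → θ ∈ S}
        univ_sets := ⟨0, Set.univ, Filter.univ_mem, fun _ _ _ => trivial⟩
        sets_of_superset := fun ⟨k, W, hW, hS⟩ hST => ⟨k, W, hW, fun θ a b => hST (hS θ a b)⟩
        inter_sets := by
          rintro S T ⟨k, W, hW, hS⟩ ⟨k', W', hW', hT⟩
          refine ⟨max k k', coordTrunc E F (le_max_left k k') ⁻¹' W ∩
            coordTrunc E F (le_max_right k k') ⁻¹' W', Filter.inter_mem ?_ ?_,
            fun θ a b => ⟨hS θ a b.1, hT θ a b.2⟩⟩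
          · exact (coordTrunc E F (le_max_left k k')).continuous.continuousAt hW
          · exact (coordTrunc E F (le_max_right k k')).continuous.continuousAt hW' }
    have hB : B ≤ 𝓝 θ₀ := by
      rw [TopologicalSpace.nhds_generateFrom]
      refine le_iInf₂ fun S hS => Filter.le_principal_iff.2 ?_
      obtain ⟨hS0, x₁, k, W, hW, rfl⟩ := hS
      obtain ⟨T, hT, hT'⟩ := exists_coords_change k h hS0.1
      have h2 : ∀ᶠ x in 𝓝 θ₀.base, x ∈ coordDomain E F V x₁ ∧
          ∀ θ : InfJet E F V, θ.base = x → coords k x₁ θ = T (coords k x₀ θ) :=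
        ((isOpen_coordDomain F V x₁).eventually_mem hS0.1).and hT'
      have h3 := eventually_chart_symm h.1 h2
      refine ⟨k, {c | c.1 ∈ (chartAt E x₀).target ∧ (chartAt E x₀).symm c.1 ∈ coordDomain E F V x₁ ∧
          ∀ θ : InfJet E F V, θ.base = (chartAt E x₀).symm c.1 →
            coords k x₁ θ = T (coords k x₀ θ)} ∩ T ⁻¹' W, Filter.inter_mem ?_ ?_, ?_⟩
      · exact (continuousAt_fst (p := coords k x₀ θ₀)).eventually h3
      · refine hT.continuous.continuousAt (hW.mem_nhds ?_)
        rw [← hT'.self_of_nhds θ₀ rfl]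
        exact hS0.2
      · rintro θ hθ ⟨⟨-, a, b⟩, c⟩
        have hb : (chartAt E x₀).symm (coords k x₀ θ).1 = θ.base := (chartAt E x₀).left_inv hθ.1
        rw [hb] at a b
        refine ⟨a, ?_⟩
        rw [b θ rfl]
        exact c
    exact fun hS => hB hS
  · rintro ⟨k, W, hW, hS⟩
    filter_upwards [(continuousAt_coords k h).eventually hW,
      eventually_base ((isOpen_coordDomain F V x₀).eventually_mem h)] with θ h1 h2
    exact hS θ h2 h1

theorem continuous_jet [FiniteDimensional ℝ E] [FiniteDimensional ℝ F] (s : Sections E F V) :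
    Continuous (jet E F V s) := by
  rw [continuous_iff_continuousAt]
  intro x S hS
  have hx := mem_coordDomain_self (E := E) F V x
  obtain ⟨k, W, hW, hWS⟩ := (mem_nhds_infJet_iff (θ₀ := jet E F V s x) hx).1 hS
  have hc : ContinuousAt (fun x' => (chartAt E x x',
      jetAt k (localRep E F V x s) (chartAt E x x'))) x := by
    have h1 := (chartAt E x).continuousAt (mem_chart_source E x)
    exact h1.prodMk (ContinuousAt.comp (g := jetAt k (localRep E F V x s))
      (((smoothNear_localRep s hx).jetAt k).contDiffAt.continuousAt) h1)
  rw [coords_jet k hx s] at hW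
  change ∀ᶠ x' in 𝓝 x, jet E F V s x' ∈ S
  filter_upwards [hc.eventually hW, (isOpen_coordDomain F V x).mem_nhds hx] with x' h1 h2
  exact hWS _ h2 (by rw [coords_jet k h2 s]; exact h1)

theorem localRep_add_smul {x₀ x : M} (hx : x ∈ coordDomain E F V x₀) (s t : (x : M) → V x) (c : ℝ) :
    localRep E F V x₀ (fun x => s x + c • t x) =ᶠ[𝓝 (chartAt E x₀ x)]
      fun z => localRep E F V x₀ s z + c • localRep E F V x₀ t z := by
  filter_upwards [eventually_chart_symm hx.1
    ((isOpen_coordDomain F V x₀).eventually_mem hx)] with z hz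
  change fibreCoord F V x₀ (s _ + c • t _) = _
  rw [fibreCoord_add F V hz.2.2, fibreCoord_smul F V hz.2.2]
  rfl

theorem jetAt_localRep_add_smul {x₀ x : M} (hx : x ∈ coordDomain E F V x₀) (s t : Sections E F V)
    (c : ℝ) (k : ℕ) :
    jetAt k (localRep E F V x₀ (s + c • t : Sections E F V)) (chartAt E x₀ x) =
      jetAt k (localRep E F V x₀ s) (chartAt E x₀ x) +
        c • jetAt k (localRep E F V x₀ t) (chartAt E x₀ x) := by
  have hs := (smoothNear_localRep s hx).contDiffAt
  have ht := (smoothNear_localRep t hx).contDiffAt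
  rw [← jetAt_smul ht, ← jetAt_add hs (ht.const_smul c)]
  exact jetAt_congr (localRep_add_smul hx s t c) k

end Coordinates

end JetGeometry

namespace JetGeometry

/-! ### Functions that factor smoothly through coordinates -/

section SmoothThrough

variable {X X' C C' H H' : Type*} [TopologicalSpace X] [TopologicalSpace X']
  [NormedAddCommGroup C] [NormedSpace ℝ C] [NormedAddCommGroup C'] [NormedSpace ℝ C']
  [NormedAddCommGroup H] [NormedSpace ℝ H] [NormedAddCommGroup H'] [NormedSpace ℝ H']

/-- Near `z₀`, the function `f` is a smooth function of the coordinates `Θ`. -/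
def SmoothThrough (Θ : X → C) (f : X → H) (z₀ : X) : Prop :=
  ∃ G : C → H, ContDiff ℝ ∞ G ∧ ∀ᶠ z in 𝓝 z₀, f z = G (Θ z)

theorem smoothThrough_of_contDiff (Θ : X → C) {G : C → H} (hG : ContDiff ℝ ∞ G) (z₀ : X) :
    SmoothThrough Θ (fun z => G (Θ z)) z₀ :=
  ⟨G, hG, Eventually.of_forall fun _ => rfl⟩

theorem smoothThrough_const (Θ : X → C) (c : H) (z₀ : X) : SmoothThrough Θ (fun _ => c) z₀ :=
  smoothThrough_of_contDiff Θ contDiff_const z₀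

namespace SmoothThrough

variable {Θ : X → C} {Θ' : X → C'} {f f' : X → H} {z₀ : X}

theorem congr (h : SmoothThrough Θ f z₀) (hf : ∀ᶠ z in 𝓝 z₀, f' z = f z) :
    SmoothThrough Θ f' z₀ := by
  obtain ⟨G, hG, h⟩ := h
  exact ⟨G, hG, by filter_upwards [h, hf] with z h1 h2; rw [h2, h1]⟩

theorem trans (h : SmoothThrough Θ Θ' z₀) (hf : SmoothThrough Θ' f z₀) :
    SmoothThrough Θ f z₀ := by
  obtain ⟨G, hG, h⟩ := h
  obtain ⟨G', hG', hf⟩ := hf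
  exact ⟨G' ∘ G, hG'.comp hG, by filter_upwards [h, hf] with z h1 h2; rw [h2, h1]; rfl⟩

theorem contDiff_comp {g : H → H'} (hg : ContDiff ℝ ∞ g) (hf : SmoothThrough Θ f z₀) :
    SmoothThrough Θ (fun z => g (f z)) z₀ :=
  hf.trans (smoothThrough_of_contDiff f hg z₀)

theorem prodMk {f' : X → H'} (hf : SmoothThrough Θ f z₀) (hf' : SmoothThrough Θ f' z₀) :
    SmoothThrough Θ (fun z => (f z, f' z)) z₀ := by
  obtain ⟨G, hG, h⟩ := hf
  obtain ⟨G', hG', h'⟩ := hf'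
  exact ⟨fun c => (G c, G' c), hG.prodMk hG',
    by filter_upwards [h, h'] with z h1 h2; rw [h2, h1]⟩

theorem pi {ι : Type*} [Fintype ι] {K : ι → Type*} [∀ i, NormedAddCommGroup (K i)]
    [∀ i, NormedSpace ℝ (K i)] {f : X → (i : ι) → K i}
    (hf : ∀ i, SmoothThrough Θ (fun z => f z i) z₀) : SmoothThrough Θ f z₀ := by
  choose G hG h using hf
  exact ⟨fun c i => G i c, contDiff_pi.2 hG,
    by filter_upwards [eventually_all.2 h] with z h1; exact funext h1⟩

theorem add (hf : SmoothThrough Θ f z₀) (hf' : SmoothThrough Θ f' z₀) :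
    SmoothThrough Θ (fun z => f z + f' z) z₀ :=
  (hf.prodMk hf').contDiff_comp (g := fun p : H × H => p.1 + p.2) contDiff_add

theorem smul {a : X → ℝ} (ha : SmoothThrough Θ a z₀) (hf : SmoothThrough Θ f z₀) :
    SmoothThrough Θ (fun z => a z • f z) z₀ :=
  (ha.prodMk hf).contDiff_comp (g := fun p : ℝ × H => p.1 • p.2) (contDiff_fst.smul contDiff_snd)

theorem clm_apply {a : X → H →L[ℝ] H'} (ha : SmoothThrough Θ a z₀) (hf : SmoothThrough Θ f z₀) :
    SmoothThrough Θ (fun z => a z (f z)) z₀ :=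
  (ha.prodMk hf).contDiff_comp (g := fun p : (H →L[ℝ] H') × H => p.1 p.2)
    (contDiff_fst.clm_apply contDiff_snd)

theorem sum {ι : Type*} {s : Finset ι} {f : ι → X → H}
    (hf : ∀ i ∈ s, SmoothThrough Θ (f i) z₀) :
    SmoothThrough Θ (fun z => ∑ i ∈ s, f i z) z₀ := by
  classical
  induction s using Finset.induction_on with
  | empty => simpa using smoothThrough_const Θ (0 : H) z₀
  | insert a s ha ih =>
    simp only [Finset.sum_insert ha]
    exact (hf a (Finset.mem_insert_self a s)).add
      (ih fun i hi => hf i (Finset.mem_insert_of_mem hi))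

theorem comp_continuousAt {φ : X' → X} {z : X'} (hφ : ContinuousAt φ z)
    (hf : SmoothThrough Θ f (φ z)) : SmoothThrough (fun z => Θ (φ z)) (fun z => f (φ z)) z := by
  obtain ⟨G, hG, h⟩ := hf
  exact ⟨G, hG, hφ.eventually h⟩

theorem of_components [FiniteDimensional ℝ H]
    (hf : ∀ i, SmoothThrough Θ (fun z => (Module.finBasis ℝ H).equivFunL (f z) i) z₀) :
    SmoothThrough Θ f z₀ :=
  ((pi hf).contDiff_comp (Module.finBasis ℝ H).equivFunL.symm.contDiff).congr
    (Eventually.of_forall fun z => ((Module.finBasis ℝ H).equivFunL.symm_apply_apply (f z)).symm)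

theorem component [FiniteDimensional ℝ H] (hf : SmoothThrough Θ f z₀)
    (i : Fin (Module.finrank ℝ H)) :
    SmoothThrough Θ (fun z => (Module.finBasis ℝ H).equivFunL (f z) i) z₀ :=
  hf.contDiff_comp (g := fun v => (Module.finBasis ℝ H).equivFunL v i)
    (contDiff_pi.1 (Module.finBasis ℝ H).equivFunL.contDiff i)

end SmoothThrough

end SmoothThrough

/-! ### Smooth sections over the jet space -/

section Jets

variable {E : Type*} [NormedAddCommGroup E] [NormedSpace ℝ E] [FiniteDimensional ℝ E]
  {M : Type*} [TopologicalSpace M] [ChartedSpace E M] [IsManifold 𝓘(ℝ, E) ∞ M]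
  {F : Type*} [NormedAddCommGroup F] [NormedSpace ℝ F] [FiniteDimensional ℝ F]
  {V : M → Type*} [TopologicalSpace (TotalSpace F V)] [∀ x, TopologicalSpace (V x)]
  [∀ x, AddCommGroup (V x)] [∀ x, Module ℝ (V x)] [FiberBundle F V] [VectorBundle ℝ F V]
  [ContMDiffVectorBundle ∞ F V 𝓘(ℝ, E)]
  {H : Type*} [NormedAddCommGroup H] [NormedSpace ℝ H]

theorem smoothThrough_coords {k k' : ℕ} (hk : k ≤ k') {x₁ x₂ : M} {θ₀ : InfJet E F V}
    (h₁ : θ₀.base ∈ coordDomain E F V x₁) (h₂ : θ₀.base ∈ coordDomain E F V x₂) :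
    SmoothThrough (coords k' x₁) (coords k x₂) θ₀ := by
  obtain ⟨T, hT, h⟩ := exists_coords_change k h₁ h₂
  refine ⟨fun c => T (coordTrunc E F hk c), hT.comp (coordTrunc E F hk).contDiff, ?_⟩
  filter_upwards [eventually_base h] with θ hθ
  exact hθ θ rfl

theorem smoothThrough_base (k : ℕ) {x₁ : M} {θ₀ : InfJet E F V}
    (h₁ : θ₀.base ∈ coordDomain E F V x₁) {f : M → H}
    (hf : ∀ᶠ x in 𝓝 θ₀.base, ContMDiffAt 𝓘(ℝ, E) 𝓘(ℝ, H) ∞ f x) :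
    SmoothThrough (coords k x₁) (fun θ => f θ.base) θ₀ := by
  obtain ⟨g, hg, h⟩ := exists_contDiff_chart h₁.1 hf
  exact ⟨fun c => g c.1, hg.comp contDiff_fst, eventually_base h⟩

variable {FP : Type*} [NormedAddCommGroup FP] [NormedSpace ℝ FP]
  {P : M → Type*} [TopologicalSpace (TotalSpace FP P)] [∀ x, TopologicalSpace (P x)]
  [∀ x, AddCommGroup (P x)] [∀ x, Module ℝ (P x)] [FiberBundle FP P] [VectorBundle ℝ FP P]
  [ContMDiffVectorBundle ∞ FP P 𝓘(ℝ, E)]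
  {U : Set (InfJet E F V)}

/-- A change of trivialization of a bundle over `M`, as a smooth function on the jet space. -/
theorem exists_fibreCoord_change_jet (k : ℕ) {x₁ x₂ x₃ : M} {θ₀ : InfJet E F V}
    (h₁ : θ₀.base ∈ coordDomain E F V x₁) (h₂ : θ₀.base ∈ (trivializationAt FP P x₂).baseSet)
    (h₃ : θ₀.base ∈ (trivializationAt FP P x₃).baseSet) :
    ∃ A : M → FP →L[ℝ] FP, SmoothThrough (coords k x₁) (fun θ => A θ.base) θ₀ ∧
      ∀ᶠ x in 𝓝 θ₀.base, ∀ v : P x, fibreCoord FP P x₃ v = A x (fibreCoord FP P x₂ v) := by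
  obtain ⟨A, hA, h⟩ := exists_fibreCoord_change (E := E) (F := FP) (V := P) h₁.1 h₂ h₃
  exact ⟨fun x => A (chartAt E x₁ x), ⟨fun c => A c.1, hA.comp contDiff_fst,
    Eventually.of_forall fun _ => rfl⟩, h⟩

variable (FP P) in
/-- Smoothness of a section near one point, in arbitrary coordinates. -/
theorem smoothThrough_fibreCoord_change {k k' : ℕ} (hk : k ≤ k') {x₁ x₂ x₃ x₄ : M} {θ₀ : U}
    (h₁ : θ₀.1.base ∈ coordDomain E F V x₁)
    (h₂ : θ₀.1.base ∈ (trivializationAt FP P x₂).baseSet)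
    (h₃ : θ₀.1.base ∈ coordDomain E F V x₃)
    (h₄ : θ₀.1.base ∈ (trivializationAt FP P x₄).baseSet) {p : (θ : U) → P θ.1.base}
    (hp : SmoothThrough (fun θ : U => coords k x₁ θ.1) (fun θ => fibreCoord FP P x₂ (p θ)) θ₀) :
    SmoothThrough (fun θ : U => coords k' x₃ θ.1) (fun θ => fibreCoord FP P x₄ (p θ)) θ₀ := by
  obtain ⟨A, hA, h⟩ := exists_fibreCoord_change_jet (FP := FP) (P := P) k' h₃ h₂ h₄
  have hc := continuous_subtype_val.continuousAt (x := θ₀)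
  have h5 := ((smoothThrough_coords hk h₃ h₁).comp_continuousAt hc).trans hp
  exact ((hA.comp_continuousAt hc).clm_apply h5).congr
    (hc.eventually ((eventually_base h).mono fun θ hθ => hθ)  |>.mono fun θ hθ => hθ (p θ))

variable (FP P U) in
/-- A section which near every point is a smooth function of the jet coordinates of order `k`. -/
def SmoothOfOrder (k : ℕ) (p : (θ : U) → P θ.1.base) : Prop :=
  ∀ θ₀ : U, SmoothThrough (fun θ : U => coords k θ₀.1.base θ.1)
    (fun θ => fibreCoord FP P θ₀.1.base (p θ)) θ₀

/-- The coordinates in the definition of smoothness may be replaced by any others near the point. -/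
theorem SmoothOfOrder.smoothThrough {k k' : ℕ} {p : (θ : U) → P θ.1.base}
    (hp : SmoothOfOrder FP P U k p) (hk : k ≤ k') {θ₀ : U} {x₁ x₂ : M}
    (h₁ : θ₀.1.base ∈ coordDomain E F V x₁)
    (h₂ : θ₀.1.base ∈ (trivializationAt FP P x₂).baseSet) :
    SmoothThrough (fun θ : U => coords k' x₁ θ.1) (fun θ => fibreCoord FP P x₂ (p θ)) θ₀ :=
  smoothThrough_fibreCoord_change FP P hk (mem_coordDomain_self F V _)
    (FiberBundle.mem_baseSet_trivializationAt' _) h₁ h₂ (hp θ₀)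

theorem SmoothOfOrder.mono {k k' : ℕ} (hk : k ≤ k') {p : (θ : U) → P θ.1.base}
    (h : SmoothOfOrder FP P U k p) : SmoothOfOrder FP P U k' p := fun _ =>
  h.smoothThrough hk (mem_coordDomain_self F V _) (FiberBundle.mem_baseSet_trivializationAt' _)

theorem eventually_mem_baseSet (θ₀ : U) :
    ∀ᶠ θ : U in 𝓝 θ₀, θ.1.base ∈ (trivializationAt FP P θ₀.1.base).baseSet :=
  continuous_subtype_val.continuousAt.eventually (eventually_base
    ((trivializationAt FP P θ₀.1.base).open_baseSet.eventually_mem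
      (FiberBundle.mem_baseSet_trivializationAt' _)))

theorem SmoothOfOrder.add {k : ℕ} {p p' : (θ : U) → P θ.1.base} (h : SmoothOfOrder FP P U k p)
    (h' : SmoothOfOrder FP P U k p') : SmoothOfOrder FP P U k (fun θ => p θ + p' θ) := fun θ₀ =>
  ((h θ₀).add (h' θ₀)).congr ((eventually_mem_baseSet θ₀).mono fun _ hθ =>
    fibreCoord_add FP P hθ _ _)

theorem SmoothOfOrder.smul {k : ℕ} {f : U → ℝ} {p : (θ : U) → P θ.1.base}
    (hf : ∀ θ₀ : U, SmoothThrough (fun θ : U => coords k θ₀.1.base θ.1) f θ₀)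
    (h : SmoothOfOrder FP P U k p) : SmoothOfOrder FP P U k (fun θ => f θ • p θ) := fun θ₀ =>
  ((hf θ₀).smul (h θ₀)).congr ((eventually_mem_baseSet θ₀).mono fun _ hθ =>
    fibreCoord_smul FP P hθ _ _)

theorem smoothOfOrder_pullback (s : Sections E FP P) :
    SmoothOfOrder FP P U 0 (fun θ => s θ.1.base) := fun θ₀ => by
  refine (smoothThrough_base 0 (mem_coordDomain_self F V _)
    (f := fun x => fibreCoord FP P θ₀.1.base (s x)) ?_).comp_continuousAt
    continuous_subtype_val.continuousAt
  filter_upwards [(trivializationAt FP P θ₀.1.base).open_baseSet.mem_nhds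
    (FiberBundle.mem_baseSet_trivializationAt' _)] with x hx
  exact ((trivializationAt FP P θ₀.1.base).contMDiffAt_section_iff hx).1 s.contMDiff.contMDiffAt

theorem add_mem_horizontalModule {p p' : (θ : U) → P θ.1.base} (h : p ∈ HorizontalModule FP P U)
    (h' : p' ∈ HorizontalModule FP P U) : p + p' ∈ HorizontalModule FP P U := by
  obtain ⟨k, hk⟩ := h
  obtain ⟨k', hk'⟩ := h'
  exact ⟨max k k', (SmoothOfOrder.mono (le_max_left k k') hk).add
    (SmoothOfOrder.mono (le_max_right k k') hk')⟩

theorem smul_mem_horizontalModule {f : U → ℝ} {p : (θ : U) → P θ.1.base} (hf : f ∈ Functions U)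
    (h : p ∈ HorizontalModule FP P U) : (fun θ => f θ • p θ) ∈ HorizontalModule FP P U := by
  obtain ⟨k, hk⟩ := hf
  obtain ⟨k', hk'⟩ := h
  refine ⟨max k k', SmoothOfOrder.smul (fun θ₀ => ?_) (SmoothOfOrder.mono (le_max_right k k') hk')⟩
  exact SmoothOfOrder.mono (FP := ℝ) (P := Bundle.Trivial M ℝ) (le_max_left k k') hk θ₀

theorem const_mem_functions (c : ℝ) : (fun _ => c) ∈ Functions U :=
  ⟨0, fun θ₀ => smoothThrough_const _ c θ₀⟩

theorem const_smul_mem_horizontalModule (c : ℝ) {p : (θ : U) → P θ.1.base}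
    (h : p ∈ HorizontalModule FP P U) : c • p ∈ HorizontalModule FP P U :=
  smul_mem_horizontalModule (const_mem_functions c) h

theorem pullback_mem_horizontalModule (s : Sections E FP P) :
    pullback FP P U s ∈ HorizontalModule FP P U := ⟨0, smoothOfOrder_pullback s⟩

theorem sub_mem_horizontalModule {p p' : (θ : U) → P θ.1.base} (h : p ∈ HorizontalModule FP P U)
    (h' : p' ∈ HorizontalModule FP P U) : p - p' ∈ HorizontalModule FP P U := by
  rw [sub_eq_add_neg, ← neg_one_smul ℝ p']
  exact add_mem_horizontalModule h (const_smul_mem_horizontalModule _ h')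

theorem zero_mem_horizontalModule : (0 : (θ : U) → P θ.1.base) ∈ HorizontalModule FP P U := by
  have := pullback_mem_horizontalModule (U := U) (0 : Sections E FP P)
  rwa [map_zero] at this

/-! ### Cutoff functions -/

/-- A function supported over the domain of one chart is smooth if it is so in that chart. -/
theorem smoothThrough_of_support {k : ℕ} {x₁ : M} {C : Set M} (hC : IsClosed C)
    (hCD : C ⊆ coordDomain E F V x₁) {f : U → H} (hf : ∀ θ : U, θ.1.base ∉ C → f θ = 0)
    (h : ∀ θ : U, θ.1.base ∈ C → SmoothThrough (fun θ : U => coords k x₁ θ.1) f θ) (θ₀ : U) :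
    SmoothThrough (fun θ : U => coords k θ₀.1.base θ.1) f θ₀ := by
  by_cases h0 : θ₀.1.base ∈ C
  · exact ((smoothThrough_coords le_rfl (mem_coordDomain_self F V _)
      (hCD h0)).comp_continuousAt continuous_subtype_val.continuousAt).trans (h θ₀ h0)
  · refine (smoothThrough_const _ (0 : H) θ₀).congr ?_
    exact continuous_subtype_val.continuousAt.eventually
      ((eventually_base (hC.isOpen_compl.eventually_mem h0))) |>.mono fun θ hθ => hf θ hθ

variable [T2Space M]

theorem exists_bump_base {x : M} {O : Set M} (hO : O ∈ 𝓝 x) :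
    ∃ f : M → ℝ, ContMDiff 𝓘(ℝ, E) 𝓘(ℝ, ℝ) ∞ f ∧ (∀ᶠ x' in 𝓝 x, f x' = 1) ∧ tsupport f ⊆ O := by
  obtain ⟨f, -, hf⟩ := (SmoothBumpFunction.nhds_basis_tsupport (I := 𝓘(ℝ, E)) x).mem_iff.1 hO
  exact ⟨f, f.contMDiff, f.eventuallyEq_one, hf⟩

/-- Smooth cutoff functions on the jet space: a basic neighbourhood involves finitely many jet
coordinates, and so does the cutoff function. -/
theorem exists_bump_jet {θ₀ : U} {O : Set U} (hO : O ∈ 𝓝 θ₀) :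
    ∃ χ : U → ℝ, χ ∈ Functions U ∧ (∀ᶠ θ in 𝓝 θ₀, χ θ = 1) ∧ ∀ θ ∉ O, ∀ᶠ θ' in 𝓝 θ, χ θ' = 0 := by
  obtain ⟨O', hO', hOO⟩ := mem_nhds_subtype U θ₀ O |>.1 hO
  set x₁ := θ₀.1.base with hx₁
  have hx := mem_coordDomain_self (E := E) F V x₁
  obtain ⟨k, W, hW, hWO⟩ := (mem_nhds_infJet_iff (θ₀ := θ₀.1) hx).1 hO'
  obtain ⟨f, hf, hf1, hfD⟩ := exists_bump_base (E := E)
    ((isOpen_coordDomain (E := E) F V x₁).mem_nhds hx)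
  obtain ⟨ε, hε, hball⟩ := Metric.mem_nhds_iff.1 hW
  let b : ContDiffBump (coords k x₁ θ₀.1) := ⟨ε / 3, ε / 2, by positivity, by linarith⟩
  have hval := continuous_subtype_val.continuousAt (x := θ₀)
  have hzero : ∀ θ : U, θ.1.base ∉ tsupport f → f θ.1.base * b (coords k x₁ θ.1) = 0 := by
    intro θ hθ
    rw [image_eq_zero_of_notMem_tsupport hθ, zero_mul]
  refine ⟨fun θ => f θ.1.base * b (coords k x₁ θ.1), ⟨k, fun θ => ?_⟩, ?_, ?_⟩
  · refine smoothThrough_of_support (isClosed_tsupport f) hfD hzero (fun θ hθ => ?_) θ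
    exact ((smoothThrough_base k (hfD hθ) (Eventually.of_forall fun x => hf x)).comp_continuousAt
      continuous_subtype_val.continuousAt).smul (smoothThrough_of_contDiff _ b.contDiff θ)
  · have h1 := hval.eventually ((continuousAt_coords k hx).eventually b.eventuallyEq_one)
    have h2 := hval.eventually (eventually_base hf1)
    filter_upwards [h1, h2] with θ h1 h2
    rw [h1, h2]
    simp
  · intro θ hθ
    by_cases h0 : θ.1.base ∈ tsupport f
    · have hnot : coords k x₁ θ.1 ∉ Metric.closedBall (coords k x₁ θ₀.1) (ε / 2) := by
        intro hc
        refine hθ (hOO (hWO θ.1 (hfD h0) (hball ?_)))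
        exact Metric.closedBall_subset_ball (by linarith) hc
      have h1 := continuous_subtype_val.continuousAt (x := θ) |>.eventually
        ((continuousAt_coords k (hfD h0)).eventually
          (Metric.isClosed_closedBall.isOpen_compl.eventually_mem hnot))
      filter_upwards [h1] with θ' h1
      rw [b.zero_of_le_dist, mul_zero]
      exact (not_le.1 fun h2 => h1 (Metric.mem_closedBall.2 h2)).le
    · have h1 := continuous_subtype_val.continuousAt (x := θ) |>.eventually
        (eventually_base ((isClosed_tsupport f).isOpen_compl.eventually_mem h0))
      exact h1.mono fun θ' => hzero θ'

end Jets

end JetGeometry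

namespace JetGeometry

/-! ### Sections along prolongations, and total derivatives -/

section Total

variable {E : Type*} [NormedAddCommGroup E] [NormedSpace ℝ E] [FiniteDimensional ℝ E]
  {M : Type*} [TopologicalSpace M] [ChartedSpace E M] [IsManifold 𝓘(ℝ, E) ∞ M]
  {F : Type*} [NormedAddCommGroup F] [NormedSpace ℝ F] [FiniteDimensional ℝ F]
  {V : M → Type*} [TopologicalSpace (TotalSpace F V)] [∀ x, TopologicalSpace (V x)]
  [∀ x, AddCommGroup (V x)] [∀ x, Module ℝ (V x)] [FiberBundle F V] [VectorBundle ℝ F V]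
  [ContMDiffVectorBundle ∞ F V 𝓘(ℝ, E)]
  {H : Type*} [NormedAddCommGroup H] [NormedSpace ℝ H]
  {FP : Type*} [NormedAddCommGroup FP] [NormedSpace ℝ FP]
  {P : M → Type*} [TopologicalSpace (TotalSpace FP P)] [∀ x, TopologicalSpace (P x)]
  [∀ x, AddCommGroup (P x)] [∀ x, Module ℝ (P x)] [FiberBundle FP P] [VectorBundle ℝ FP P]
  [ContMDiffVectorBundle ∞ FP P 𝓘(ℝ, E)]
  {U : Set (InfJet E F V)}

theorem extend_of_mem (p : (θ : U) → P θ.1.base) (θ : U) : extend p θ.1 = p θ :=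
  dif_pos θ.2

theorem extend_add (p p' : (θ : U) → P θ.1.base) (θ : InfJet E F V) :
    extend (p + p') θ = extend p θ + extend p' θ := by
  by_cases h : θ ∈ U <;> simp [extend, h]

theorem extend_smul (f : U → ℝ) (p : (θ : U) → P θ.1.base) (θ : InfJet E F V) :
    extend (fun θ => f θ • p θ) θ =
      (extend (P := Bundle.Trivial M ℝ) f θ : ℝ) • extend p θ := by
  by_cases h : θ ∈ U <;> simp [extend, h]

variable (FP) in
/-- The coordinates of the extension by zero of a section over `U`. -/
noncomputable def extendCoord (x₀ : M) (p : (θ : U) → P θ.1.base) (θ : InfJet E F V) : FP :=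
  fibreCoord FP P x₀ (extend p θ)

theorem extendCoord_of_mem (x₀ : M) (p : (θ : U) → P θ.1.base) (θ : U) :
    extendCoord FP x₀ p θ.1 = fibreCoord FP P x₀ (p θ) := by
  rw [extendCoord, extend_of_mem]

theorem extendCoord_add {x₀ : M} (p p' : (θ : U) → P θ.1.base) {θ : InfJet E F V}
    (h : θ.base ∈ (trivializationAt FP P x₀).baseSet) :
    extendCoord FP x₀ (p + p') θ = extendCoord FP x₀ p θ + extendCoord FP x₀ p' θ := by
  simp only [extendCoord]
  rw [extend_add, fibreCoord_add FP P h]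

theorem extendCoord_smul {x₀ : M} (f : U → ℝ) (p : (θ : U) → P θ.1.base) {θ : InfJet E F V}
    (h : θ.base ∈ (trivializationAt FP P x₀).baseSet) :
    extendCoord FP x₀ (fun θ => f θ • p θ) θ =
      extendCoord (P := Bundle.Trivial M ℝ) ℝ x₀ f θ • extendCoord FP x₀ p θ := by
  simp only [extendCoord]
  rw [extend_smul, fibreCoord_smul FP P h]
  rfl

theorem eventually_subtype (hU : IsOpen U) {θ₀ : U} {p : InfJet E F V → Prop}
    (h : ∀ᶠ θ : U in 𝓝 θ₀, p θ.1) : ∀ᶠ θ in 𝓝 θ₀.1, p θ := by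
  rw [← hU.isOpenEmbedding_subtypeVal.map_nhds_eq]
  exact h

theorem SmoothThrough.extendCoord (hU : IsOpen U) {k : ℕ} {x₁ x₂ : M} {θ₀ : U}
    {p : (θ : U) → P θ.1.base}
    (hp : SmoothThrough (fun θ : U => coords k x₁ θ.1) (fun θ => fibreCoord FP P x₂ (p θ)) θ₀) :
    SmoothThrough (coords k x₁) (extendCoord FP x₂ p) θ₀.1 := by
  obtain ⟨G, hG, h⟩ := hp
  refine ⟨G, hG, eventually_subtype hU ?_⟩
  filter_upwards [h] with θ hθ
  rw [extendCoord_of_mem, hθ]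

theorem tendsto_jet_chart_symm {x₁ x : M} (hx : x ∈ (chartAt E x₁).source)
    (s : Sections E F V) : Tendsto (fun w => jet E F V s ((chartAt E x₁).symm w))
      (𝓝 (chartAt E x₁ x)) (𝓝 (jet E F V s x)) :=
  ((continuous_jet s).tendsto x).comp ((chartAt E x₁).tendsto_symm hx)

theorem tendsto_jet_sec (θ : InfJet E F V) :
    Tendsto (jet E F V θ.sec) (𝓝 θ.base) (𝓝 θ) := by
  have h := (continuous_jet θ.sec).tendsto θ.base
  rwa [InfJet.jet_sec] at h

/-- A function on the jet space, evaluated along the prolongation of a section. -/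
theorem eventually_along_eq {x₁ x : M} (hx : x ∈ coordDomain E F V x₁) {f : InfJet E F V → H}
    {k : ℕ} {G : JetCoord E F k → H} (s : Sections E F V)
    (h : ∀ᶠ θ in 𝓝 (jet E F V s x), f θ = G (coords k x₁ θ)) :
    ∀ᶠ w in 𝓝 (chartAt E x₁ x), f (jet E F V s ((chartAt E x₁).symm w)) =
      G (w, jetAt k (localRep E F V x₁ s) w) := by
  have h1 := (tendsto_jet_chart_symm hx.1 s).eventually h
  filter_upwards [h1, eventually_chart_symm hx.1
    ((isOpen_coordDomain F V x₁).eventually_mem hx)] with w hw hw'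
  rw [hw, coords_jet k hw'.2 s, (chartAt E x₁).right_inv hw'.1]

/-- Total derivatives of a section of order `k` up to order `l` are smooth functions of the jet
coordinates of order `k + l`, the same for all sections `s` representing the jet. -/
theorem exists_totalDerivs_expression (hU : IsOpen U) {k : ℕ} {p : (θ : U) → P θ.1.base}
    (hp : SmoothOfOrder FP P U k p) (l : ℕ) {θ₀ : U} {x₁ : M}
    (h₁ : θ₀.1.base ∈ coordDomain E F V x₁)
    (h₂ : θ₀.1.base ∈ (trivializationAt FP P x₁).baseSet) :
    ∃ G : JetCoord E F (k + l) → JetFibre E FP l, ContDiff ℝ ∞ G ∧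
      ∀ᶠ θ in 𝓝 θ₀.1, ∀ s : Sections E F V, jet E F V s θ.base = θ →
        SmoothNear (localRep E FP P x₁ (along p s)) (chartAt E x₁ θ.base) ∧
        jetAt l (localRep E FP P x₁ (along p s)) (chartAt E x₁ θ.base) =
          G (coords (k + l) x₁ θ) := by
  obtain ⟨g, hg, h⟩ := (hp.smoothThrough le_rfl h₁ h₂).extendCoord hU
  choose g' hg' hg'' using fun i : ℕ => exists_prolonged_expression (F := F) k i
    (hg.comp contDiff_snd) (contDiff_id (𝕜 := ℝ) (E := E))
  let τ : (i : Fin (l + 1)) → JetCoord E F (k + l) →L[ℝ] JetCoord E F (k + i) :=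
    fun i => coordTrunc E F (by omega)
  refine ⟨fun c i => g' i (c.1, τ i c), contDiff_pi.2 fun i => (hg' i).comp
    (contDiff_fst.prodMk (τ i).contDiff), ?_⟩
  filter_upwards [h.eventually_nhds, eventually_base ((isOpen_coordDomain F V x₁).eventually_mem
    h₁)] with θ hθ hb s hs
  have hloc : localRep E FP P x₁ (along p s) =ᶠ[𝓝 (chartAt E x₁ θ.base)]
      fun w => g (w, jetAt k (localRep E F V x₁ s) w) :=
    eventually_along_eq (f := extendCoord FP x₁ p) hb s
      (by rw [hs]; exact hθ)
  have hsm := smoothNear_localRep s hb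
  refine ⟨?_, ?_⟩
  · refine SmoothNear.congr ?_ hloc
    exact SmoothNear.comp (hg.smoothNear _) ((contDiff_id.smoothNear _).prodMk (hsm.jetAt k))
  · rw [jetAt_congr hloc l]
    funext i
    refine (hg'' i _ _ hsm).trans ?_
    have h3 : coords (k + i) x₁ θ = (chartAt E x₁ θ.base,
        jetAt (k + i) (localRep E F V x₁ s) (chartAt E x₁ θ.base)) := by
      rw [← coords_jet (k + i) hb s, hs]
    change _ = g' i (chartAt E x₁ θ.base, coords (k + i) x₁ θ)
    rw [h3]
    rfl

variable (FP P) in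
/-- All total derivatives of order at most `l` of a section, in the coordinates at `x₁`. -/
noncomputable def totalJet (l : ℕ) (x₁ : M) (p : (θ : U) → P θ.1.base) (θ : U) : JetFibre E FP l :=
  fun i => totalDerivs FP P i x₁ p θ

theorem totalJet_eq (l : ℕ) (x₁ : M) (p : (θ : U) → P θ.1.base) (θ : U) :
    totalJet FP P l x₁ p θ =
      jetAt l (localRep E FP P x₁ (along p θ.1.sec)) (chartAt E x₁ θ.1.base) := rfl

theorem smoothNear_along (hU : IsOpen U) {p : (θ : U) → P θ.1.base}
    (hp : p ∈ HorizontalModule FP P U) {θ : U} {x₁ : M}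
    (h₁ : θ.1.base ∈ coordDomain E F V x₁)
    (h₂ : θ.1.base ∈ (trivializationAt FP P x₁).baseSet) {s : Sections E F V}
    (hs : jet E F V s θ.1.base = θ.1) :
    SmoothNear (localRep E FP P x₁ (along p s)) (chartAt E x₁ θ.1.base) := by
  obtain ⟨k, hk⟩ := hp
  obtain ⟨G, -, h⟩ := exists_totalDerivs_expression hU hk 0 h₁ h₂
  exact (h.self_of_nhds s hs).1

/-- Total derivatives at a point do not depend on the section representing it. -/
theorem jetAt_along_eq (hU : IsOpen U) {p : (θ : U) → P θ.1.base}
    (hp : p ∈ HorizontalModule FP P U) (l : ℕ) {θ : U} {x₁ : M}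
    (h₁ : θ.1.base ∈ coordDomain E F V x₁)
    (h₂ : θ.1.base ∈ (trivializationAt FP P x₁).baseSet) {s : Sections E F V}
    (hs : jet E F V s θ.1.base = θ.1) :
    jetAt l (localRep E FP P x₁ (along p s)) (chartAt E x₁ θ.1.base) = totalJet FP P l x₁ p θ := by
  obtain ⟨k, hk⟩ := hp
  obtain ⟨G, -, h⟩ := exists_totalDerivs_expression hU hk l h₁ h₂
  rw [(h.self_of_nhds s hs).2, totalJet_eq, (h.self_of_nhds _ θ.1.jet_sec).2]

theorem smoothThrough_totalJet (hU : IsOpen U) {k : ℕ} {p : (θ : U) → P θ.1.base}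
    (hp : SmoothOfOrder FP P U k p) (l : ℕ) {θ₀ : U} {x₁ : M}
    (h₁ : θ₀.1.base ∈ coordDomain E F V x₁)
    (h₂ : θ₀.1.base ∈ (trivializationAt FP P x₁).baseSet) :
    SmoothThrough (fun θ : U => coords (k + l) x₁ θ.1) (totalJet FP P l x₁ p) θ₀ := by
  obtain ⟨G, hG, h⟩ := exists_totalDerivs_expression hU hp l h₁ h₂
  refine ⟨G, hG, ?_⟩
  filter_upwards [continuous_subtype_val.continuousAt.eventually h] with θ hθ
  exact (hθ _ θ.1.jet_sec).2

/-- A section restricted to a smaller open set has the same total derivatives. -/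
theorem totalJet_restrict (hU : IsOpen U)
    (Φ : HorizontalModule FP P (Set.univ : Set (InfJet E F V))) (l : ℕ) (x₁ : M) (θ : U)
    (h₁ : θ.1.base ∈ (chartAt E x₁).source) :
    totalJet FP P l x₁ (restrict FP P U Φ).1 θ = totalJet FP P l x₁ Φ.1 ⟨θ.1, trivial⟩ := by
  rw [totalJet_eq, totalJet_eq]
  refine jetAt_congr (localRep_congr h₁ ?_) l
  filter_upwards [(tendsto_jet_sec θ.1).eventually (hU.eventually_mem θ.2)] with x hx
  exact (extend_of_mem _ ⟨_, hx⟩).trans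
    (extend_of_mem Φ.1 ⟨jet E F V θ.1.sec x, trivial⟩).symm

/-! ### Derivatives in vertical directions -/

theorem tendsto_jet_add_smul (θ : InfJet E F V) (t : Sections E F V) :
    Tendsto (fun τ : ℝ => jet E F V (θ.sec + τ • t) θ.base) (𝓝 0) (𝓝 θ) := by
  intro S hS
  set s := θ.sec
  set x := θ.base
  have hx := mem_coordDomain_self (E := E) F V x
  obtain ⟨k, W, hW, hWS⟩ := (mem_nhds_infJet_iff (θ₀ := θ) hx).1 hS
  have hc : Continuous (fun τ : ℝ => (chartAt E x x,
      jetAt k (localRep E F V x s) (chartAt E x x) +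
        τ • jetAt k (localRep E F V x t) (chartAt E x x))) := by fun_prop
  change ∀ᶠ τ : ℝ in 𝓝 0, jet E F V (s + τ • t) x ∈ S
  have h2 := hc.continuousAt (x := (0 : ℝ)) |>.eventually
    (p := fun c => c ∈ W) (by simp only [zero_smul, add_zero]; exact hW)
  filter_upwards [h2] with τ h
  exact hWS _ hx (by rw [coords_jet k hx, jetAt_localRep_add_smul hx]; exact h)

/-- The derivative of a smooth function on the jet space in the vertical direction given by a
section `t`, in terms of a coordinate expression. -/
theorem hasDerivAt_vertical {θ₀ : InfJet E F V} {x₁ : M} (hx : θ₀.base ∈ coordDomain E F V x₁)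
    {f : InfJet E F V → H} {k : ℕ} {G : JetCoord E F k → H} (hG : ContDiff ℝ ∞ G)
    (h : ∀ᶠ θ in 𝓝 θ₀, f θ = G (coords k x₁ θ)) (t : Sections E F V) :
    HasDerivAt (fun τ : ℝ => f (jet E F V (θ₀.sec + τ • t) θ₀.base))
      (fderiv ℝ G (coords k x₁ θ₀)
        (0, jetAt k (localRep E F V x₁ t) (chartAt E x₁ θ₀.base))) 0 := by
  let c : ℝ → JetCoord E F k := fun τ => (chartAt E x₁ θ₀.base,
    jetAt k (localRep E F V x₁ θ₀.sec) (chartAt E x₁ θ₀.base) +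
      τ • jetAt k (localRep E F V x₁ t) (chartAt E x₁ θ₀.base))
  have h0 : c 0 = coords k x₁ θ₀ := by
    simp only [c, zero_smul, add_zero]; rfl
  have hc : HasDerivAt c (0, jetAt k (localRep E F V x₁ t) (chartAt E x₁ θ₀.base)) 0 := by
    refine (hasDerivAt_const _ _).prodMk ?_
    simpa using ((hasDerivAt_id (0 : ℝ)).smul_const
      (jetAt k (localRep E F V x₁ t) (chartAt E x₁ θ₀.base))).const_add
      (jetAt k (localRep E F V x₁ θ₀.sec) (chartAt E x₁ θ₀.base))
  have hG' : HasFDerivAt G (fderiv ℝ G (c 0)) (c 0) :=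
    (hG.differentiable (by simp) _).hasFDerivAt
  rw [← h0]
  refine (hG'.comp_hasDerivAt (0 : ℝ) hc).congr_of_eventuallyEq ?_
  have h1 := (tendsto_jet_add_smul θ₀ t).eventually h
  filter_upwards [h1] with τ hτ
  rw [hτ, coords_jet k hx, jetAt_localRep_add_smul hx]
  rfl

variable (FP P) in
/-- The derivatives of `p` at `θ` in all vertical directions vanish. The vertical direction given by
a section `t` is the velocity of the curve of jets of `s + τ • t` at the base point of `θ`, where
`s` represents `θ`. -/
def FlatAt (p : (θ : U) → P θ.1.base) (θ : U) : Prop :=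
  ∀ t : Sections E F V, HasDerivAt (fun τ : ℝ => extendCoord FP θ.1.base p
    (jet E F V (θ.1.sec + τ • t) θ.1.base)) 0 0

/-- Flatness does not depend on the trivialization. -/
theorem FlatAt.hasDerivAt {p : (θ : U) → P θ.1.base} {θ : U} (h : FlatAt FP P p θ) {x₂ : M}
    (h₂ : θ.1.base ∈ (trivializationAt FP P x₂).baseSet) (t : Sections E F V) :
    HasDerivAt (fun τ : ℝ => extendCoord FP x₂ p
      (jet E F V (θ.1.sec + τ • t) θ.1.base)) 0 0 := by
  obtain ⟨A, -, hA⟩ := exists_fibreCoord_change (E := E) (F := FP) (V := P)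
    (mem_chart_source E θ.1.base) (FiberBundle.mem_baseSet_trivializationAt' θ.1.base) h₂
  have h3 := (A (chartAt E θ.1.base θ.1.base)).hasFDerivAt.comp_hasDerivAt (0 : ℝ) (h t)
  rw [map_zero] at h3
  refine h3.congr_of_eventuallyEq (Eventually.of_forall fun τ => ?_)
  exact hA.self_of_nhds _

/-- A coordinate expression of a flat section has zero derivative in the vertical directions given
by jets of functions. -/
theorem FlatAt.fderiv_eq_zero [T2Space M] {p : (θ : U) → P θ.1.base} {θ : U}
    (h : FlatAt FP P p θ) {x₁ x₂ : M} (h₁ : θ.1.base ∈ coordDomain E F V x₁)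
    (h₂ : θ.1.base ∈ (trivializationAt FP P x₂).baseSet) {k : ℕ} {G : JetCoord E F k → FP}
    (hG : ContDiff ℝ ∞ G)
    (hpG : ∀ᶠ θ' in 𝓝 θ.1, extendCoord FP x₂ p θ' = G (coords k x₁ θ'))
    {u : JetFibre E F k} (hu : u ∈ jetSpace E F k) :
    fderiv ℝ G (coords k x₁ θ.1) (0, u) = 0 := by
  obtain ⟨t, rfl⟩ := exists_section_jetAt_eq (V := V) h₁ hu
  exact (hasDerivAt_vertical h₁ hG hpG t).unique (h.hasDerivAt h₂ t)

theorem exists_hasDerivAt_vertical (hU : IsOpen U) {p : (θ : U) → P θ.1.base}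
    (hp : p ∈ HorizontalModule FP P U) (θ : U) (t : Sections E F V) :
    ∃ d, HasDerivAt (fun τ : ℝ => extendCoord FP θ.1.base p
      (jet E F V (θ.1.sec + τ • t) θ.1.base)) d 0 := by
  obtain ⟨k, hk⟩ := hp
  obtain ⟨G, hG, h⟩ := SmoothThrough.extendCoord hU (hk θ)
  exact ⟨_, hasDerivAt_vertical (mem_coordDomain_self F V _) hG h t⟩

theorem FlatAt.add {p p' : (θ : U) → P θ.1.base} {θ : U} (h : FlatAt FP P p θ)
    (h' : FlatAt FP P p' θ) : FlatAt FP P (p + p') θ := fun t => by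
  have := (h t).add (h' t)
  rw [add_zero] at this
  refine this.congr_of_eventuallyEq (Eventually.of_forall fun τ => ?_)
  exact extendCoord_add p p' (FiberBundle.mem_baseSet_trivializationAt' θ.1.base)

/-- A product is flat where its derivative vanishes by the product rule. -/
theorem flatAt_smul (hU : IsOpen U) {f : U → ℝ} (hf : f ∈ Functions U) {p : (θ : U) → P θ.1.base}
    (hp : p ∈ HorizontalModule FP P U) {θ : U} (hpθ : p θ = 0)
    (h : f θ = 0 ∨ FlatAt FP P p θ) : FlatAt FP P (fun θ => f θ • p θ) θ := fun t => by
  have hb := FiberBundle.mem_baseSet_trivializationAt' (F := FP) (E := P) θ.1.base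
  obtain ⟨d, hd⟩ := exists_hasDerivAt_vertical (P := Bundle.Trivial M ℝ) hU hf θ t
  obtain ⟨e, he, he'⟩ : ∃ e, HasDerivAt (fun τ : ℝ => extendCoord FP θ.1.base p
      (jet E F V (θ.1.sec + τ • t) θ.1.base)) e 0 ∧ f θ • e = 0 := by
    rcases h with h | h
    · obtain ⟨e, he⟩ := exists_hasDerivAt_vertical hU hp θ t
      exact ⟨e, he, by rw [h, zero_smul]⟩
    · exact ⟨0, h t, smul_zero _⟩
  have h0 : jet E F V (θ.1.sec + (0 : ℝ) • t) θ.1.base = θ.1 := by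
    rw [zero_smul, add_zero, InfJet.jet_sec]
  have h1 := hd.smul he
  have hp0 : extendCoord FP θ.1.base p (jet E F V (θ.1.sec + (0 : ℝ) • t) θ.1.base) = 0 := by
    rw [h0, extendCoord_of_mem, hpθ, fibreCoord_zero FP P hb]
  have hf0 : extendCoord (P := Bundle.Trivial M ℝ) ℝ θ.1.base f
      (jet E F V (θ.1.sec + (0 : ℝ) • t) θ.1.base) = f θ := by
    rw [h0, extendCoord_of_mem]
    rfl
  rw [hp0, hf0, he', smul_zero, add_zero] at h1
  exact h1.congr_of_eventuallyEq (Eventually.of_forall fun τ => extendCoord_smul f p hb)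

theorem FlatAt.congr {p p' : (θ : U) → P θ.1.base} {θ : U} (hU : IsOpen U) (h : FlatAt FP P p θ)
    (hp : ∀ᶠ θ' in 𝓝 θ, p' θ' = p θ') : FlatAt FP P p' θ := fun t => by
  have h1 : ∀ᶠ θ' in 𝓝 θ.1, extendCoord FP θ.1.base p' θ' = extendCoord FP θ.1.base p θ' :=
    eventually_subtype hU (hp.mono fun θ' h => by rw [extendCoord_of_mem, extendCoord_of_mem, h])
  have h2 := (tendsto_jet_add_smul θ.1 t).eventually h1
  exact (h t).congr_of_eventuallyEq h2

/-- A pullback from the base is constant along the fibres of the jet space. -/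
theorem flatAt_pullback (hU : IsOpen U) (s : Sections E FP P) (θ : U) :
    FlatAt FP P (pullback FP P U s) θ := fun t => by
  have h1 : ∀ᶠ θ' in 𝓝 θ.1, extendCoord FP θ.1.base (pullback FP P U s) θ' =
      fibreCoord FP P θ.1.base (s θ'.base) :=
    eventually_subtype hU (Eventually.of_forall fun θ' => extendCoord_of_mem _ _ θ')
  have h2 := (tendsto_jet_add_smul θ.1 t).eventually h1
  exact (hasDerivAt_const (0 : ℝ) (fibreCoord FP P θ.1.base (s θ.1.base))).congr_of_eventuallyEq h2

theorem linearization_eq (q : (θ : U) → P θ.1.base) (φ : (θ : U) → V θ.1.base) (θ : U) :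
    linearization FP P q φ θ = (trivializationAt FP P θ.1.base).symm θ.1.base
      (deriv (fun τ : ℝ => extendCoord FP θ.1.base q
        (jet E F V (θ.1.sec + τ • prolong φ θ) θ.1.base)) 0) := rfl

/-- The kernel of the restricted linearization consists of the sections that are flat along `Y`. -/
theorem mem_linearizationKernel_iff (hU : IsOpen U) {Y : Set (InfJet E F V)} (hY : Y ⊆ U)
    {q : (θ : U) → P θ.1.base} (hq : q ∈ HorizontalModule FP P U) :
    q ∈ linearizationKernel FP P hY ↔ ∀ θ : Y, FlatAt FP P q ⟨θ.1, hY θ.2⟩ := by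
  have hb : ∀ x : M, x ∈ (trivializationAt FP P x).baseSet := fun x =>
    FiberBundle.mem_baseSet_trivializationAt' x
  constructor
  · rintro ⟨-, h⟩ θ t
    let θ' : U := ⟨θ.1, hY θ.2⟩
    -- The pullback of `t` is a generating section whose prolongation at `θ` has the jet of `t`.
    let φ : HorizontalModule F V U := ⟨pullback F V U t, pullback_mem_horizontalModule t⟩
    have h1 : linearization FP P q φ.1 θ' = 0 := congrFun (congrFun h φ) θ
    have hsame : SameJet E F V θ.1.base t (along φ.1 θ.1.sec) := by
      intro k
      refine ((localRep_congr (mem_chart_source E _) ?_).iteratedFDeriv ℝ k).self_of_nhds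
      filter_upwards [(tendsto_jet_sec θ.1).eventually (hU.eventually_mem θ'.2)] with x hx
      exact (extend_of_mem φ.1 ⟨_, hx⟩).symm
    have hex : ∃ t : Sections E F V, SameJet E F V θ'.1.base t (along φ.1 θ'.1.sec) := ⟨t, hsame⟩
    have hpr : SameJet E F V θ.1.base (prolong φ.1 θ') t := by
      rw [prolong, dif_pos hex]
      exact fun k => (hex.choose_spec k).trans (hsame k).symm
    have hjet : ∀ τ : ℝ, jet E F V (θ.1.sec + τ • prolong φ.1 θ') θ.1.base =
        jet E F V (θ.1.sec + τ • t) θ.1.base := by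
      intro τ
      refine jet_eq_jet fun k => ?_
      have hx := mem_coordDomain_self (E := E) F V θ.1.base
      have h4 : jetAt k (localRep E F V θ.1.base (prolong φ.1 θ')) (chartAt E θ.1.base θ.1.base) =
          jetAt k (localRep E F V θ.1.base t) (chartAt E θ.1.base θ.1.base) :=
        funext fun i => hpr i
      have h5 := jetAt_localRep_add_smul hx θ.1.sec (prolong φ.1 θ') τ k
      rw [h4, ← jetAt_localRep_add_smul hx θ.1.sec t τ k] at h5
      exact congrFun h5 (Fin.last k)
    obtain ⟨d, hd⟩ := exists_hasDerivAt_vertical hU hq θ' t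
    have h6 : d = 0 := by
      have h8 := hd.congr_of_eventuallyEq (Eventually.of_forall fun τ =>
        congrArg (extendCoord FP θ.1.base q) (hjet τ))
      rw [linearization_eq, h8.deriv] at h1
      have h7 := congrArg (fibreCoord FP P θ.1.base) h1
      rwa [fibreCoord_symm FP P (hb _), fibreCoord_zero FP P (hb _)] at h7
    rw [h6] at hd
    exact hd
  · refine fun h => ⟨hq, ?_⟩
    funext φ θ
    change linearization FP P q φ.1 ⟨θ.1, hY θ.2⟩ = 0
    rw [linearization_eq, (h θ (prolong φ.1 ⟨θ.1, hY θ.2⟩)).deriv]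
    refine fibreCoord_injective FP P (hb θ.1.base) ?_
    rw [fibreCoord_symm FP P (hb _), fibreCoord_zero FP P (hb _)]

end Total

end JetGeometry

namespace JetGeometry

/-! ### Scalar total derivatives as linear differential operators -/

section JetAlgebra

variable {E : Type*} [NormedAddCommGroup E] [NormedSpace ℝ E]
  {F : Type*} [NormedAddCommGroup F] [NormedSpace ℝ F]

variable (E F) in
/-- The value of a jet. -/
noncomputable def jetVal (l : ℕ) : JetFibre E F l →L[ℝ] F :=
  ((continuousMultilinearCurryFin0 ℝ E F).toContinuousLinearEquiv :
    (E [×0]→L[ℝ] F) →L[ℝ] F).comp (ContinuousLinearMap.proj (R := ℝ)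
      (φ := fun j : Fin (l + 1) => E [×(j : ℕ)]→L[ℝ] F) 0)

theorem jetVal_jetAt (l : ℕ) (g : E → F) (y : E) : jetVal E F l (jetAt l g y) = g y := rfl

variable (F) in
/-- The derivative of a jet in the direction `X`. -/
noncomputable def jetShift (l : ℕ) (X : E) : JetFibre E F (l + 1) →L[ℝ] JetFibre E F l :=
  ContinuousLinearMap.pi fun i => ((ContinuousLinearMap.apply ℝ (E [×(i : ℕ)]→L[ℝ] F) X).comp
    ((continuousMultilinearCurryLeftEquiv ℝ (fun _ : Fin ((i : ℕ) + 1) => E)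
      F).toContinuousLinearEquiv : (E [×((i : ℕ) + 1)]→L[ℝ] F) →L[ℝ] _)).comp
    (ContinuousLinearMap.proj (R := ℝ) (φ := fun j : Fin (l + 1 + 1) => E [×(j : ℕ)]→L[ℝ] F) i.succ)

theorem contDiff_jetShift_apply (l : ℕ) (u : JetFibre E F (l + 1)) :
    ContDiff ℝ ∞ (fun X : E => jetShift F l X u) :=
  contDiff_pi.2 fun i => (continuousMultilinearCurryLeftEquiv ℝ (fun _ : Fin ((i : ℕ) + 1) => E)
    F (u i.succ)).contDiff

/-- Differentiating a jet in the direction `X` shifts it by one order. -/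
theorem hasFDerivAt_jetAt {g : E → F} {y : E} (hg : SmoothNear g y) (l : ℕ) :
    HasFDerivAt (jetAt l g) (fderiv ℝ (jetAt l g) y) y ∧
      ∀ X, fderiv ℝ (jetAt l g) y X = jetShift F l X (jetAt (l + 1) g y) := by
  have h1 := (hg.jetAt l).contDiffAt.differentiableAt (by simp)
  refine ⟨h1.hasFDerivAt, fun X => ?_⟩
  funext i
  have h2 : fderiv ℝ (jetAt l g) y X i = fderiv ℝ (iteratedFDeriv ℝ i g) y X := by
    have h3 := (hasFDerivAt_pi'.1 h1.hasFDerivAt i).fderiv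
    exact (congrArg (fun L => L X) h3).symm
  rw [h2]
  change _ = (continuousMultilinearCurryLeftEquiv ℝ (fun _ : Fin ((i : ℕ) + 1) => E) F
    (iteratedFDeriv ℝ (i + 1) g y)) X
  rw [iteratedFDeriv_succ_eq_comp_left, Function.comp_apply, LinearIsometryEquiv.apply_symm_apply]

end JetAlgebra

section Operators

variable {E : Type*} [NormedAddCommGroup E] [NormedSpace ℝ E] [FiniteDimensional ℝ E]
  {M : Type*} [TopologicalSpace M] [ChartedSpace E M] [IsManifold 𝓘(ℝ, E) ∞ M]
  {F : Type*} [NormedAddCommGroup F] [NormedSpace ℝ F] [FiniteDimensional ℝ F]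
  {V : M → Type*} [TopologicalSpace (TotalSpace F V)] [∀ x, TopologicalSpace (V x)]
  [∀ x, AddCommGroup (V x)] [∀ x, Module ℝ (V x)] [FiberBundle F V] [VectorBundle ℝ F V]
  [ContMDiffVectorBundle ∞ F V 𝓘(ℝ, E)]
  {H : Type*} [NormedAddCommGroup H] [NormedSpace ℝ H]
  {FP : Type*} [NormedAddCommGroup FP] [NormedSpace ℝ FP] [FiniteDimensional ℝ FP]
  {P : M → Type*} [TopologicalSpace (TotalSpace FP P)] [∀ x, TopologicalSpace (P x)]
  [∀ x, AddCommGroup (P x)] [∀ x, Module ℝ (P x)] [FiberBundle FP P] [VectorBundle ℝ FP P]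
  [ContMDiffVectorBundle ∞ FP P 𝓘(ℝ, E)]
  {U : Set (InfJet E F V)}

/-- The derivative of a function on `M` along a tangent vector, in a chart: the preferred
trivialization of the tangent bundle is the derivative of the chart. -/
theorem mfderiv_comp_chart {x₀ x : M} (hx : x ∈ (chartAt E x₀).source) {f : M → H} {h : E → H}
    (hh : DifferentiableAt ℝ h (chartAt E x₀ x)) (hf : ∀ᶠ x' in 𝓝 x, f x' = h (chartAt E x₀ x'))
    (v : TangentSpace 𝓘(ℝ, E) x) :
    mfderiv 𝓘(ℝ, E) 𝓘(ℝ, H) f x v =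
      fderiv ℝ h (chartAt E x₀ x)
        (fibreCoord E (TangentSpace 𝓘(ℝ, E) : M → Type _) x₀ v) := by
  have h1 : MDifferentiableAt 𝓘(ℝ, E) 𝓘(ℝ, E) (chartAt E x₀) x :=
    (eventually_contMDiffAt_chart hx).self_of_nhds.mdifferentiableAt (by simp)
  have h2 : HasMFDerivAt 𝓘(ℝ, E) 𝓘(ℝ, H) f x
      ((fderiv ℝ h (chartAt E x₀ x)).comp (mfderiv 𝓘(ℝ, E) 𝓘(ℝ, E) (chartAt E x₀) x)) :=
    (hh.hasFDerivAt.hasMFDerivAt.comp x h1.hasMFDerivAt).congr_of_eventuallyEq hf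
  have h3 := TangentBundle.continuousLinearMapAt_trivializationAt (I := 𝓘(ℝ, E)) hx
  have h4 : (trivializationAt E (TangentSpace 𝓘(ℝ, E)) x₀).continuousLinearMapAt ℝ x v =
      fibreCoord E (TangentSpace 𝓘(ℝ, E) : M → Type _) x₀ v := by
    rw [Trivialization.continuousLinearMapAt_apply, Trivialization.linearMapAt_apply, if_pos]
    simpa using hx
  rw [h2.mfderiv, ← h4, h3]
  rfl

/-- A section of the dual bundle has smooth coefficients in coordinates, namely its values on a
local frame that extends to global sections. -/
theorem exists_dual_chart [T2Space M] (ξ : DualSection E FP P) (x₀ : M) :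
    ∃ A : E → FP →L[ℝ] ℝ, ContDiff ℝ ∞ A ∧ ∀ᶠ x in 𝓝 x₀, ∀ v : P x,
      ξ.toFun x v = A (chartAt E x₀ x) (fibreCoord FP P x₀ v) := by
  let b := Module.finBasis ℝ FP
  choose t ht using fun i => exists_section_localRep_eq (V := P)
    (mem_coordDomain_self (E := E) FP P x₀) (g := fun _ => b i) (contDiff_const.smoothNear _)
  choose g hg hgt using fun i => exists_contDiff_chart (E := E) (mem_chart_source E x₀)
    (Eventually.of_forall fun x => (ξ.smooth (t i)) x)
  refine ⟨fun y => ∑ i, g i y • LinearMap.toContinuousLinearMap (b.coord i),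
    ContDiff.sum fun i _ => (hg i).smul contDiff_const, ?_⟩
  filter_upwards [eventually_all.2 ht, eventually_all.2 hgt,
    (isOpen_coordDomain (E := E) FP P x₀).mem_nhds (mem_coordDomain_self FP P x₀)] with x h1 h2 h3 v
  have h4 : v = ∑ i, b.repr (fibreCoord FP P x₀ v) i • t i x := by
    refine fibreCoord_injective FP P h3.2 ?_
    let e : P x →ₗ[ℝ] FP := (trivializationAt FP P x₀).linearMapAt ℝ x
    have he : ∀ w : P x, e w = fibreCoord FP P x₀ w := fun w => by
      simp only [e]
      rw [Trivialization.linearMapAt_apply, if_pos h3.2]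
    conv_lhs => rw [← b.sum_repr (fibreCoord FP P x₀ v)]
    rw [← he (∑ i, _), map_sum]
    refine Finset.sum_congr rfl fun i _ => ?_
    rw [map_smul, he, h1]
  conv_lhs => rw [h4]
  rw [map_sum, sum_apply]
  refine Finset.sum_congr rfl fun i _ => ?_
  rw [map_smul, h2]
  simp [mul_comm]

variable (FP) in
/-- A scalar operator on sections over the jet space which in local coordinates is a linear
combination of total derivatives of order at most `l`, with coefficients from the base. -/
def IsTotalOperator (l : ℕ) (D : ((θ : InfJet E F V) → P θ.base) → InfJet E F V → ℝ) : Prop :=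
  ∀ x₀ : M, ∃ A : E → JetFibre E FP l →L[ℝ] ℝ, ContDiff ℝ ∞ A ∧ ∀ᶠ x in 𝓝 x₀,
    ∀ U : Set (InfJet E F V), IsOpen U → ∀ p ∈ HorizontalModule FP P U, ∀ θ : U, θ.1.base = x →
      D (extend p) θ.1 = A (chartAt E x₀ x) (totalJet FP P l x₀ p θ)

theorem isTotalOperator_dual [T2Space M] (ξ : DualSection E FP P) :
    IsTotalOperator (E := E) (F := F) (V := V) FP 0 (fun p θ => ξ.toFun θ.base (p θ)) :=
    fun x₀ => by
  obtain ⟨A, hA, h⟩ := exists_dual_chart ξ x₀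
  refine ⟨fun y => (A y).comp (jetVal E FP 0), hA.clm_comp contDiff_const, ?_⟩
  filter_upwards [h, (chartAt E x₀).open_source.mem_nhds (mem_chart_source E x₀)]
    with x hx hxs U hU p hp θ hθ
  subst hθ
  rw [hx, totalJet_eq, ContinuousLinearMap.comp_apply, jetVal_jetAt, localRep_chart hxs]
  congr 1
  change extendCoord FP x₀ p θ.1 = extendCoord FP x₀ p (jet E F V θ.1.sec θ.1.base)
  rw [InfJet.jet_sec]

/-- Along the prolongation of a section, a total operator is a linear differential operator. -/
theorem IsTotalOperator.eventually_along {l : ℕ}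
    {D : ((θ : InfJet E F V) → P θ.base) → InfJet E F V → ℝ} {x₀ : M}
    {A : E → JetFibre E FP l →L[ℝ] ℝ} {x : M} (hx : x ∈ coordDomain E F V x₀)
    (hx' : x ∈ (trivializationAt FP P x₀).baseSet)
    (h : ∀ᶠ x in 𝓝 x, ∀ U : Set (InfJet E F V), IsOpen U → ∀ p ∈ HorizontalModule FP P U,
      ∀ θ : U, θ.1.base = x → D (extend p) θ.1 = A (chartAt E x₀ x) (totalJet FP P l x₀ p θ))
    (hU : IsOpen U) {p : (θ : U) → P θ.1.base} (hp : p ∈ HorizontalModule FP P U)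
    {s : Sections E F V} (hs : jet E F V s x ∈ U) :
    ∀ᶠ x' in 𝓝 x, D (extend p) (jet E F V s x') = A (chartAt E x₀ x')
      (jetAt l (localRep E FP P x₀ (along p s)) (chartAt E x₀ x')) := by
  filter_upwards [h, (continuous_jet s).continuousAt.eventually (hU.eventually_mem hs),
    (isOpen_coordDomain F V x₀).mem_nhds hx,
    (trivializationAt FP P x₀).open_baseSet.mem_nhds hx'] with x' h1 h2 h3 h4
  rw [h1 U hU p hp ⟨_, h2⟩ rfl]
  congr 1
  exact (jetAt_along_eq hU hp l (θ := ⟨_, h2⟩) h3 h4 rfl).symm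

/-- The total derivative of a total operator is a total operator of the next order, by the product
rule applied along the prolongation of a section. -/
theorem IsTotalOperator.totalDeriv [T2Space M] {l : ℕ}
    {D : ((θ : InfJet E F V) → P θ.base) → InfJet E F V → ℝ}
    (hD : IsTotalOperator FP l D) (X : Sections E E (TangentSpace 𝓘(ℝ, E) : M → Type _)) :
    IsTotalOperator FP (l + 1) (fun p => totalDeriv X (D p)) := fun x₀ => by
  obtain ⟨A, hA, h⟩ := hD x₀
  obtain ⟨g, hg, hgX⟩ := (smoothNear_localRep X
    (mem_coordDomain_self E (TangentSpace 𝓘(ℝ, E) : M → Type _) x₀)).exists_contDiff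
  refine ⟨fun y => (fderiv ℝ A y (g y)).comp (jetTrunc E FP (Nat.le_succ l)) +
    (A y).comp (jetShift FP l (g y)), ?_, ?_⟩
  · refine contDiff_clm_apply_iff.2 fun u => ?_
    refine ContDiff.add ?_ (hA.clm_apply ((contDiff_jetShift_apply l u).comp hg))
    exact ((hA.fderiv_right (m := ∞) (by simp)).clm_apply hg).clm_apply contDiff_const
  · filter_upwards [h.eventually_nhds, eventually_chart (mem_chart_source E x₀) hgX,
      (isOpen_coordDomain F V x₀).mem_nhds (mem_coordDomain_self (E := E) F V x₀),
      (trivializationAt FP P x₀).open_baseSet.mem_nhds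
        (FiberBundle.mem_baseSet_trivializationAt' x₀)] with x h1 h2 h3 h4 U hU p hp θ hθ
    subst hθ
    have hloc := IsTotalOperator.eventually_along h3 h4 h1 hU hp (s := θ.1.sec)
      (by rw [InfJet.jet_sec]; exact θ.2)
    have hsm := smoothNear_along hU hp h3 h4 θ.1.jet_sec
    set f := localRep E FP P x₀ (along p θ.1.sec) with hf
    have hA' := (hA.differentiable (by simp) (chartAt E x₀ θ.1.base)).hasFDerivAt
    obtain ⟨hj, hj'⟩ := hasFDerivAt_jetAt hsm l
    have hd := hA'.clm_apply hj
    change mfderiv 𝓘(ℝ, E) 𝓘(ℝ, ℝ) (fun x' => D (extend p) (jet E F V θ.1.sec x')) θ.1.base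
      (X θ.1.base) = _
    refine (mfderiv_comp_chart h3.1 (h := fun w => A w (jetAt l f w)) hd.differentiableAt hloc
      _).trans ?_
    rw [hd.fderiv]
    have hX : fibreCoord E (TangentSpace 𝓘(ℝ, E) : M → Type _) x₀ (X θ.1.base) =
        g (chartAt E x₀ θ.1.base) := by
      rw [h2.2, localRep_chart h3.1]
    rw [hX]
    simp only [add_apply, ContinuousLinearMap.comp_apply,
      ContinuousLinearMap.flip_apply, totalJet_eq, ← hf, hj']
    rw [add_comm]
    rfl

theorem exists_isTotalOperator_foldr [T2Space M] (ξ : DualSection E FP P)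
    (σ : List (Sections E E (TangentSpace 𝓘(ℝ, E) : M → Type _))) :
    ∃ l, IsTotalOperator (F := F) (V := V) FP l
      (fun p => σ.foldr totalDeriv (fun θ => ξ.toFun θ.base (p θ))) := by
  induction σ with
  | nil => exact ⟨0, isTotalOperator_dual ξ⟩
  | cons X σ ih =>
    obtain ⟨l, hl⟩ := ih
    exact ⟨l + 1, hl.totalDeriv X⟩

theorem IsTotalOperator.smoothThrough {l : ℕ}
    {D : ((θ : InfJet E F V) → P θ.base) → InfJet E F V → ℝ} (hD : IsTotalOperator FP l D)
    (hU : IsOpen U) {k : ℕ} {p : (θ : U) → P θ.1.base} (hp : SmoothOfOrder FP P U k p) (θ₀ : U) :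
    SmoothThrough (fun θ : U => coords (k + l) θ₀.1.base θ.1) (fun θ => D (extend p) θ.1) θ₀ := by
  obtain ⟨A, hA, h⟩ := hD θ₀.1.base
  have h1 := smoothThrough_totalJet hU hp l (θ₀ := θ₀) (mem_coordDomain_self F V _)
    (FiberBundle.mem_baseSet_trivializationAt' _)
  have h2 : SmoothThrough (fun θ : U => coords (k + l) θ₀.1.base θ.1)
      (fun θ => A (chartAt E θ₀.1.base θ.1.base)) θ₀ :=
    smoothThrough_of_contDiff _ (hA.comp contDiff_fst) θ₀
  refine (h2.clm_apply h1).congr ?_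
  filter_upwards [continuous_subtype_val.continuousAt.eventually (eventually_base h)] with θ hθ
  exact hθ U hU p ⟨k, hp⟩ θ rfl

/-- The values of total operators on the equation belong to its ideal. -/
theorem IsTotalOperator.mem_equationIdeal {l : ℕ}
    {D : ((θ : InfJet E F V) → P θ.base) → InfJet E F V → ℝ} (hD : IsTotalOperator FP l D)
    (hU : IsOpen U) (Φ : HorizontalModule FP P (Set.univ : Set (InfJet E F V))) :
    (fun θ : U => D (extend Φ.1) θ.1) ∈ equationIdeal U Φ := by
  classical
  let Δ : HorizontalModule FP P U → Functions U := fun p => ⟨fun θ => D (extend p.1) θ.1, by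
    obtain ⟨k, hk⟩ := p.2
    exact ⟨k + l, fun θ₀ => hD.smoothThrough hU hk θ₀⟩⟩
  refine ⟨Δ, ⟨l, 0, fun θ₀ => ?_⟩, ?_⟩
  · obtain ⟨A, hA, h⟩ := hD θ₀.1.base
    refine ⟨fun i c => (A c.1).comp (ContinuousLinearMap.single ℝ
      (fun j : Fin (l + 1) => E [×(j : ℕ)]→L[ℝ] FP) i), fun i =>
        (hA.comp contDiff_fst).clm_comp contDiff_const, ?_⟩
    filter_upwards [continuous_subtype_val.continuousAt.eventually (eventually_base h)] with θ hθ p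
    refine (hθ U hU p.1 p.2 θ rfl).trans ?_
    exact (ContinuousLinearMap.sum_comp_single _ _ (A _) (totalJet FP P l θ₀.1.base p.1 θ)).symm
  · funext θ
    obtain ⟨A, hA, h⟩ := hD θ.1.base
    have h1 := h.self_of_nhds U hU (restrict FP P U Φ).1 (restrict FP P U Φ).2 θ rfl
    have h2 := h.self_of_nhds Set.univ isOpen_univ Φ.1 Φ.2 ⟨θ.1, trivial⟩ rfl
    change D (extend Φ.1) θ.1 = D (extend (restrict FP P U Φ).1) θ.1
    rw [h1, totalJet_restrict hU Φ l _ θ (mem_chart_source E _)]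
    exact h2

/-- At points of the prolonged equation, the values of total operators on the equation have zero
derivative along prolongations of sections. -/
theorem IsTotalOperator.hasFDerivAt_zero {l : ℕ}
    {D : ((θ : InfJet E F V) → P θ.base) → InfJet E F V → ℝ} (hD : IsTotalOperator FP l D)
    (Φ : HorizontalModule FP P (Set.univ : Set (InfJet E F V))) {θ : InfJet E F V}
    (hθ : θ ∈ prolongation Φ) :
    HasFDerivAt (fun w => D (extend Φ.1) (jet E F V θ.sec ((chartAt E θ.base).symm w)))
      (0 : E →L[ℝ] ℝ) (chartAt E θ.base θ.base) := by
  obtain ⟨A, hA, h⟩ := hD θ.base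
  have h3 := mem_coordDomain_self (E := E) F V θ.base
  have h4 := FiberBundle.mem_baseSet_trivializationAt' (F := FP) (E := P) θ.base
  have hloc := IsTotalOperator.eventually_along h3 h4 h isOpen_univ Φ.2 (s := θ.sec) trivial
  have hsm := smoothNear_along isOpen_univ Φ.2 (θ := ⟨θ, trivial⟩) h3 h4 θ.jet_sec
  set f := localRep E FP P θ.base (along Φ.1 θ.sec) with hf
  have hzero : ∀ k, jetAt k f (chartAt E θ.base θ.base) = 0 := fun k => funext fun i => hθ i
  have hA' := (hA.differentiable (by simp) (chartAt E θ.base θ.base)).hasFDerivAt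
  obtain ⟨hj, hj'⟩ := hasFDerivAt_jetAt hsm l
  have hd := hA'.clm_apply hj
  have hd0 : HasFDerivAt (fun w => A w (jetAt l f w)) (0 : E →L[ℝ] ℝ)
      (chartAt E θ.base θ.base) := by
    refine hd.congr_fderiv (ContinuousLinearMap.ext fun X => ?_)
    simp only [add_apply, ContinuousLinearMap.comp_apply,
      ContinuousLinearMap.flip_apply, hj', hzero]
    simp
  refine hd0.congr_of_eventuallyEq ?_
  filter_upwards [eventually_chart_symm h3.1 hloc] with w hw
  rw [hw.2, (chartAt E θ.base).right_inv hw.1]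

/-- Elements of the ideal vanish on the prolonged equation, where all total derivatives of the
defining section do. -/
theorem eq_zero_of_mem_equationIdeal (hU : IsOpen U)
    {Φ : HorizontalModule FP P (Set.univ : Set (InfJet E F V))} {f : U → ℝ}
    (hf : f ∈ equationIdeal U Φ) {θ : U} (hθ : θ.1 ∈ prolongation Φ) : f θ = 0 := by
  obtain ⟨Δ, ⟨r, k, h⟩, rfl⟩ := hf
  obtain ⟨a, -, ha⟩ := h θ
  refine (ha.self_of_nhds (restrict FP P U Φ)).trans (Finset.sum_eq_zero fun i _ => ?_)
  have h1 := congrFun (totalJet_restrict hU Φ r θ.1.base θ (mem_chart_source E _)) i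
  have h2 : totalDerivs FP P i θ.1.base (restrict FP P U Φ).1 θ = 0 := h1.trans (hθ i)
  rw [h2, map_zero]

theorem equationIdeal_subset_functions
    {Φ : HorizontalModule FP P (Set.univ : Set (InfJet E F V))} {f : U → ℝ}
    (hf : f ∈ equationIdeal U Φ) : f ∈ Functions U := by
  obtain ⟨Δ, -, rfl⟩ := hf
  exact (Δ _).2

end Operators

end JetGeometry

namespace JetGeometry

/-! ### Uniform orders -/

/-- Suppose that every function which is everywhere of type `A` is everywhere of type `B n` for
some `n`. Then a locally finite family of functions of type `A` is of type `B n` for one `n`: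
otherwise a sum of functions from the family with disjoint supports is not of any type `B n`. -/
theorem exists_uniform_order {X M : Type*} [TopologicalSpace X] [TopologicalSpace M] {b : X → M}
    (hb : Continuous b) {A : X → (X → ℝ) → Prop} {B : ℕ → X → (X → ℝ) → Prop}
    (hA0 : ∀ x, A x fun _ => 0) (hAc : ∀ x f g, (∀ᶠ z in 𝓝 x, g z = f z) → A x f → A x g)
    (hB0 : ∀ n x, B n x fun _ => 0)
    (hBc : ∀ n x f g, (∀ᶠ z in 𝓝 x, g z = f z) → B n x f → B n x g)
    (hBm : ∀ m n x f, m ≤ n → B m x f → B n x f)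
    (hAB : ∀ f, (∀ x, A x f) → ∃ n, ∀ x, B n x f)
    {ι : Type*} {f : ι → X → ℝ} {C : ι → Set M} (hC : LocallyFinite C)
    (hCc : ∀ i, IsClosed (C i)) (hCk : ∀ i, IsCompact (C i))
    (hf0 : ∀ i x, b x ∉ C i → f i x = 0) (hf : ∀ i x, A x (f i)) :
    ∃ n, ∀ i x, B n x (f i) := by
  classical
  by_contra! H
  choose N hN using fun i => hAB (f i) (hf i)
  -- A sequence of pairs of an index `i` and an order `n` such that `f i` is not of type `B n`, with
  -- disjoint supports and increasing orders: a compact set meets finitely many of the others, and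
  -- these have a common order by `hAB`.
  obtain ⟨a, ha, har⟩ := exists_seq_of_forall_finset_exists (α := ι × ℕ)
    (fun p => ∃ x, ¬ B p.2 x (f p.1))
    (fun p q => Disjoint (C p.1) (C q.1) ∧ p.1 ≠ q.1 ∧ p.2 < q.2) (by
      rintro s -
      have hT : (⋃ p ∈ s, ({i | (C i ∩ C p.1).Nonempty} ∪ {p.1})).Finite :=
        s.finite_toSet.biUnion fun p _ =>
          (hC.finite_nonempty_inter_compact (hCk p.1)).union (Set.finite_singleton _)
      obtain ⟨m, hm⟩ : ∃ m : ℕ, ∀ i ∈ ⋃ p ∈ s, ({i | (C i ∩ C p.1).Nonempty} ∪ {p.1}), N i ≤ m := by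
        obtain ⟨m, hm⟩ := (hT.image N).bddAbove
        exact ⟨m, fun i hi => hm (Set.mem_image_of_mem N hi)⟩
      let m' := max m (s.sup fun p => p.2 + 1)
      obtain ⟨i, x, hx⟩ := H m'
      have hi : i ∉ ⋃ p ∈ s, ({i | (C i ∩ C p.1).Nonempty} ∪ {p.1}) := fun hi =>
        hx (hBm _ _ x _ ((hm i hi).trans (le_max_left _ _)) (hN i x))
      simp only [Set.mem_iUnion, not_exists] at hi
      refine ⟨(i, m'), ⟨x, hx⟩, fun p hp => ⟨?_, ?_, ?_⟩⟩
      · refine Set.disjoint_iff_inter_eq_empty.2 (Set.not_nonempty_iff_eq_empty.1 fun h => ?_)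
        exact hi p hp (Or.inl (by rwa [Set.inter_comm] at h))
      · exact fun h => hi p hp (Or.inr h.symm)
      · have h1 : p.2 + 1 ≤ s.sup fun p => p.2 + 1 := Finset.le_sup (f := fun p => p.2 + 1) hp
        exact h1.trans (le_max_right _ _))
  have hinj : Function.Injective fun n => (a n).1 := by
    intro m n hmn
    rcases lt_trichotomy m n with h | h | h
    · exact absurd hmn (har m n h).2.1
    · exact h
    · exact absurd hmn.symm (har n m h).2.1
  have hdis : ∀ m n, m ≠ n → Disjoint (C (a m).1) (C (a n).1) := by
    intro m n hmn
    rcases lt_or_gt_of_ne hmn with h | h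
    · exact (har m n h).1
    · exact (har n m h).1.symm
  have hge : ∀ n, n ≤ (a n).2 :=
    fun n => (strictMono_nat_of_lt_succ fun n => (har n (n + 1) n.lt_succ_self).2.2).le_apply
  have hlf := hC.comp_injective hinj
  -- Near any point, the sum `g` of the sequence is zero or equal to one of its terms.
  let g : X → ℝ := fun x => ∑ᶠ n, f (a n).1 x
  have hev : ∀ x, ∀ᶠ z in 𝓝 x, ∀ n, b z ∈ C (a n).1 → b x ∈ C (a n).1 := fun x =>
    hb.continuousAt.eventually (hlf.eventually_subset (fun n => hCc _) (b x))
  have hg1 : ∀ x n, b x ∈ C (a n).1 → ∀ᶠ z in 𝓝 x, g z = f (a n).1 z := by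
    intro x n hx
    filter_upwards [hev x] with z hz
    refine finsum_eq_single _ n fun m hm => hf0 _ _ fun h => ?_
    exact Set.disjoint_left.1 (hdis m n hm) (hz m h) hx
  have hg0 : ∀ x, (∀ n, b x ∉ C (a n).1) → ∀ᶠ z in 𝓝 x, g z = 0 := by
    intro x hx
    filter_upwards [hev x] with z hz
    exact finsum_eq_zero_of_forall_eq_zero fun m => hf0 _ _ fun h => hx m (hz m h)
  obtain ⟨m, hm⟩ := hAB g fun x => by
    by_cases h : ∃ n, b x ∈ C (a n).1
    · obtain ⟨n, hn⟩ := h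
      exact hAc x _ _ (hg1 x n hn) (hf _ x)
    · exact hAc x _ _ (hg0 x (not_exists.1 h)) (hA0 x)
  obtain ⟨x, hx⟩ := ha m
  refine hx ?_
  by_cases h : b x ∈ C (a m).1
  · exact hBm m _ x _ (hge m) (hBc m x _ _ ((hg1 x m h).mono fun z hz => hz.symm) (hm x))
  · refine hBc _ x _ _ ?_ (hB0 _ x)
    exact (hb.continuousAt.eventually ((hCc _).isOpen_compl.eventually_mem h)).mono
      fun z hz => hf0 _ z hz

namespace Regularity

variable {E : Type*} [NormedAddCommGroup E] [NormedSpace ℝ E] [FiniteDimensional ℝ E]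
  {M : Type*} [TopologicalSpace M] [ChartedSpace E M] [IsManifold 𝓘(ℝ, E) ∞ M]
  {F : Type*} [NormedAddCommGroup F] [NormedSpace ℝ F] [FiniteDimensional ℝ F]
  {V : M → Type*} [TopologicalSpace (TotalSpace F V)] [∀ x, TopologicalSpace (V x)]
  [∀ x, AddCommGroup (V x)] [∀ x, Module ℝ (V x)] [FiberBundle F V] [VectorBundle ℝ F V]
  [ContMDiffVectorBundle ∞ F V 𝓘(ℝ, E)]
  {H : Type*} [NormedAddCommGroup H] [NormedSpace ℝ H]
  {FP : Type*} [NormedAddCommGroup FP] [NormedSpace ℝ FP] [FiniteDimensional ℝ FP]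
  {P : M → Type*} [TopologicalSpace (TotalSpace FP P)] [∀ x, TopologicalSpace (P x)]
  [∀ x, AddCommGroup (P x)] [∀ x, Module ℝ (P x)] [FiberBundle FP P] [VectorBundle ℝ FP P]
  [ContMDiffVectorBundle ∞ FP P 𝓘(ℝ, E)]
  {Φ : HorizontalModule FP P (Set.univ : Set (InfJet E F V))} (R : Regularity Φ)

/-! ### The splitting of a neighbourhood of the equation -/

/-- A point of the prolonged equation as a point of its neighbourhood. -/
def incl (y : prolongation Φ) : R.U := ⟨y.1, R.prolongation_subset y.2⟩

/-- The splitting `ν`, with the second component as an element of `ℝ^∞`. -/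
def fwd (θ : R.U) : prolongation Φ × (ℕ → ℝ) := ((R.ν θ).1, (R.ν θ).2)

open Classical in
/-- The inverse of the splitting; outside its domain the value is the point of the
equation given by the first component. -/
noncomputable def bwd (z : prolongation Φ × (ℕ → ℝ)) : R.U :=
  if h : z.2 ∈ R.W then R.ν.symm (z.1, ⟨z.2, h⟩) else R.incl z.1

theorem fwd_mem (θ : R.U) : (R.fwd θ).2 ∈ R.W := (R.ν θ).2.2

theorem bwd_of_mem {z : prolongation Φ × (ℕ → ℝ)} (h : z.2 ∈ R.W) :
    R.bwd z = R.ν.symm (z.1, ⟨z.2, h⟩) := dif_pos h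

theorem bwd_fwd (θ : R.U) : R.bwd (R.fwd θ) = θ := by
  rw [R.bwd_of_mem (R.fwd_mem θ)]
  exact R.ν.symm_apply_apply θ

theorem fwd_bwd {z : prolongation Φ × (ℕ → ℝ)} (h : z.2 ∈ R.W) : R.fwd (R.bwd z) = z := by
  rw [R.bwd_of_mem h, fwd, R.ν.apply_symm_apply]

theorem fwd_incl (y : prolongation Φ) : R.fwd (R.incl y) = (y, 0) :=
  Prod.ext (R.ν_fst y) (R.ν_snd y)

theorem bwd_zero (y : prolongation Φ) : R.bwd (y, 0) = R.incl y := by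
  rw [← fwd_incl, bwd_fwd]

theorem continuous_fwd : Continuous R.fwd :=
  (continuous_fst.comp R.ν.continuous).prodMk
    (continuous_subtype_val.comp (continuous_snd.comp R.ν.continuous))

theorem continuousAt_bwd {z : prolongation Φ × (ℕ → ℝ)} (h : z.2 ∈ R.W) :
    ContinuousAt R.bwd z := by
  have hj : Topology.IsOpenEmbedding (Prod.map id Subtype.val : prolongation Φ × R.W → _) :=
    Topology.IsOpenEmbedding.id.prodMap R.isOpen_W.isOpenEmbedding_subtypeVal
  have h1 := hj.continuousAt_iff (g := R.bwd) (x := (z.1, ⟨z.2, h⟩))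
  refine h1.1 (R.ν.symm.continuous.continuousAt.congr (Eventually.of_forall fun z' => ?_))
  exact (R.bwd_of_mem (z := (z'.1, z'.2)) z'.2.2).symm

theorem continuous_fwd_base : Continuous fun θ : R.U => (R.fwd θ).1.1.base :=
  continuous_base.comp (continuous_subtype_val.comp (continuous_fst.comp R.continuous_fwd))

/-- The coordinates of the first component of the splitting up to order `n`, and the first `n`
coordinates of the second component. -/
noncomputable def splitCoords (n : ℕ) (x₁ : M) (θ : R.U) : JetCoord E F n × (Fin n → ℝ) :=
  (coords n x₁ (R.fwd θ).1.1, fun i => (R.fwd θ).2 i)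

/-- Forgetting coordinates of the splitting. -/
theorem smoothThrough_splitCoords {n n' m : ℕ} (hn : n ≤ n') (hm : m ≤ n') {x₁ x₂ : M} {θ₀ : R.U}
    (h₁ : (R.fwd θ₀).1.1.base ∈ coordDomain E F V x₁)
    (h₂ : (R.fwd θ₀).1.1.base ∈ coordDomain E F V x₂) :
    SmoothThrough (R.splitCoords n' x₁)
      (fun θ => (coords n x₂ (R.fwd θ).1.1, fun i : Fin m => (R.fwd θ).2 i)) θ₀ := by
  have hc : ContinuousAt (fun θ : R.U => (R.fwd θ).1.1) θ₀ :=
    (continuous_subtype_val.comp (continuous_fst.comp R.continuous_fwd)).continuousAt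
  have h3 : SmoothThrough (R.splitCoords n' x₁) (fun θ => coords n' x₁ (R.fwd θ).1.1) θ₀ :=
    smoothThrough_of_contDiff _ contDiff_fst θ₀
  refine (h3.trans ((smoothThrough_coords hn h₁ h₂).comp_continuousAt hc)).prodMk ?_
  exact smoothThrough_of_contDiff (R.splitCoords n' x₁)
    (G := fun c (i : Fin m) => c.2 (⟨i, i.2.trans_le hm⟩ : Fin n'))
    (contDiff_pi.2 fun i => (contDiff_apply ℝ ℝ _).comp contDiff_snd) θ₀

/-- A function of one finite order in the jet coordinates is of one finite order in the coordinates
of the splitting. -/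
theorem exists_split_order {k : ℕ} {f : R.U → ℝ}
    (hf : ∀ θ₀ : R.U, SmoothThrough (fun θ : R.U => coords k θ₀.1.base θ.1) f θ₀) :
    ∃ n, ∀ θ₀ : R.U, SmoothThrough (R.splitCoords n (R.fwd θ₀).1.1.base) f θ₀ := by
  obtain ⟨m, N, h⟩ := R.smooth_symm f ⟨k, hf⟩
  refine ⟨max m N, fun θ₀ => ?_⟩
  obtain ⟨G, hG, h⟩ := h (R.ν θ₀)
  have hx := mem_coordDomain_self (E := E) F V (R.fwd θ₀).1.1.base
  refine (R.smoothThrough_splitCoords (le_max_left m N) (le_max_right m N) hx hx).trans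
    ⟨G, hG, ?_⟩
  filter_upwards [R.ν.continuous.continuousAt.eventually h] with θ hθ
  rw [Function.comp_apply, R.ν.symm_apply_apply] at hθ
  exact hθ

/-- A function of one finite order in the coordinates of the splitting is of one finite order in the
jet coordinates. -/
theorem exists_jet_order {n : ℕ} {f : R.U → ℝ}
    (hf : ∀ θ₀ : R.U, SmoothThrough (R.splitCoords n (R.fwd θ₀).1.1.base) f θ₀) :
    ∃ k, ∀ θ₀ : R.U, SmoothThrough (fun θ : R.U => coords k θ₀.1.base θ.1) f θ₀ := by
  have h1 : IsSmoothProd (f ∘ R.ν.symm) := by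
    refine ⟨n, n, fun z₀ => ?_⟩
    obtain ⟨G, hG, h⟩ := hf (R.ν.symm z₀)
    refine ⟨G, hG, ?_⟩
    filter_upwards [R.ν.symm.continuous.continuousAt.eventually h] with z hz
    rw [splitCoords, fwd, fwd, R.ν.apply_symm_apply, R.ν.apply_symm_apply] at hz
    exact hz
  obtain ⟨k, hk⟩ := R.smooth _ h1
  refine ⟨k, fun θ₀ => ?_⟩
  obtain ⟨G, hG, h⟩ := hk θ₀
  refine ⟨G, hG, ?_⟩
  filter_upwards [h] with θ hθ
  rw [← hθ]
  exact congrArg f (R.ν.symm_apply_apply θ).symm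

theorem smoothThrough_splitCoords_mono {n n' : ℕ} (hn : n ≤ n') {f : R.U → H} {θ₀ : R.U}
    (hf : SmoothThrough (R.splitCoords n (R.fwd θ₀).1.1.base) f θ₀) :
    SmoothThrough (R.splitCoords n' (R.fwd θ₀).1.1.base) f θ₀ :=
  have hx := mem_coordDomain_self (E := E) F V (R.fwd θ₀).1.1.base
  (R.smoothThrough_splitCoords hn hn hx hx).trans hf

theorem smoothThrough_coords_mono {n n' : ℕ} (hn : n ≤ n') {f : R.U → H} {θ₀ : R.U}
    (hf : SmoothThrough (fun θ : R.U => coords n θ₀.1.base θ.1) f θ₀) :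
    SmoothThrough (fun θ : R.U => coords n' θ₀.1.base θ.1) f θ₀ :=
  have hx := mem_coordDomain_self (E := E) F V θ₀.1.base
  ((smoothThrough_coords hn hx hx).comp_continuousAt continuous_subtype_val.continuousAt).trans hf

section FiniteDimensional

variable [FiniteDimensional ℝ H]

theorem exists_split_order_vector {k : ℕ} {f : R.U → H}
    (hf : ∀ θ₀ : R.U, SmoothThrough (fun θ : R.U => coords k θ₀.1.base θ.1) f θ₀) :
    ∃ n, ∀ θ₀ : R.U, SmoothThrough (R.splitCoords n (R.fwd θ₀).1.1.base) f θ₀ := by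
  choose n hn using fun i => R.exists_split_order fun θ₀ => (hf θ₀).component i
  exact ⟨Finset.univ.sup n, fun θ₀ => SmoothThrough.of_components fun i =>
    R.smoothThrough_splitCoords_mono (Finset.le_sup (Finset.mem_univ i)) (hn i θ₀)⟩

theorem exists_jet_order_vector {n : ℕ} {f : R.U → H}
    (hf : ∀ θ₀ : R.U, SmoothThrough (R.splitCoords n (R.fwd θ₀).1.1.base) f θ₀) :
    ∃ k, ∀ θ₀ : R.U, SmoothThrough (fun θ : R.U => coords k θ₀.1.base θ.1) f θ₀ := by
  choose k hk using fun i => R.exists_jet_order fun θ₀ => (hf θ₀).component i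
  exact ⟨Finset.univ.sup k, fun θ₀ => SmoothThrough.of_components fun i =>
    R.smoothThrough_coords_mono (Finset.le_sup (Finset.mem_univ i)) (hk i θ₀)⟩

/-- A locally finite family of functions of one order in the jet coordinates has a common order in
the coordinates of the splitting. -/
theorem exists_split_order_family {k : ℕ} {ι : Type*} {f : ι → R.U → H}
    {C : ι → Set M} (hC : LocallyFinite C) (hCc : ∀ i, IsClosed (C i))
    (hCk : ∀ i, IsCompact (C i)) (hf0 : ∀ i, ∀ θ : R.U, θ.1.base ∉ C i → f i θ = 0)
    (hf : ∀ i, ∀ θ₀ : R.U, SmoothThrough (fun θ : R.U => coords k θ₀.1.base θ.1) (f i) θ₀) :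
    ∃ n, ∀ i, ∀ θ₀ : R.U, SmoothThrough (R.splitCoords n (R.fwd θ₀).1.1.base) (f i) θ₀ := by
  have key := fun j => exists_uniform_order (X := R.U) (b := fun θ => θ.1.base)
    (A := fun θ₀ g => SmoothThrough (fun θ : R.U => coords k θ₀.1.base θ.1) g θ₀)
    (B := fun n θ₀ g => SmoothThrough (R.splitCoords n (R.fwd θ₀).1.1.base) g θ₀)
    (continuous_base.comp continuous_subtype_val) (fun θ => smoothThrough_const _ 0 θ)
    (fun θ f g h h' => h'.congr h) (fun n θ => smoothThrough_const _ 0 θ)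
    (fun n θ f g h h' => h'.congr h) (fun m n θ f h h' => R.smoothThrough_splitCoords_mono h h')
    (fun f hf => R.exists_split_order hf) hC hCc hCk
    (f := fun i θ => (Module.finBasis ℝ H).equivFunL (f i θ) j)
    (fun i θ h => by rw [hf0 i θ h, map_zero]; rfl) (fun i θ => (hf i θ).component j)
  choose n hn using key
  exact ⟨Finset.univ.sup n, fun i θ₀ => SmoothThrough.of_components fun j =>
    R.smoothThrough_splitCoords_mono (Finset.le_sup (Finset.mem_univ j)) (hn j i θ₀)⟩

/-- A locally finite family of functions of one order in the coordinates of the splitting has a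
common order in the jet coordinates. -/
theorem exists_jet_order_family {n : ℕ} {ι : Type*} {f : ι → R.U → H}
    {C : ι → Set M} (hC : LocallyFinite C) (hCc : ∀ i, IsClosed (C i))
    (hCk : ∀ i, IsCompact (C i)) (hf0 : ∀ i, ∀ θ : R.U, θ.1.base ∉ C i → f i θ = 0)
    (hf : ∀ i, ∀ θ₀ : R.U, SmoothThrough (R.splitCoords n (R.fwd θ₀).1.1.base) (f i) θ₀) :
    ∃ k, ∀ i, ∀ θ₀ : R.U, SmoothThrough (fun θ : R.U => coords k θ₀.1.base θ.1) (f i) θ₀ := by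
  have key := fun j => exists_uniform_order (X := R.U) (b := fun θ => θ.1.base)
    (B := fun k θ₀ g => SmoothThrough (fun θ : R.U => coords k θ₀.1.base θ.1) g θ₀)
    (A := fun θ₀ g => SmoothThrough (R.splitCoords n (R.fwd θ₀).1.1.base) g θ₀)
    (continuous_base.comp continuous_subtype_val) (fun θ => smoothThrough_const _ 0 θ)
    (fun θ f g h h' => h'.congr h) (fun n θ => smoothThrough_const _ 0 θ)
    (fun n θ f g h h' => h'.congr h) (fun m n θ f h h' => R.smoothThrough_coords_mono h h')
    (fun f hf => R.exists_jet_order hf) hC hCc hCk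
    (f := fun i θ => (Module.finBasis ℝ H).equivFunL (f i θ) j)
    (fun i θ h => by rw [hf0 i θ h, map_zero]; rfl) (fun i θ => (hf i θ).component j)
  choose k hk using key
  exact ⟨Finset.univ.sup k, fun i θ₀ => SmoothThrough.of_components fun j =>
    R.smoothThrough_coords_mono (Finset.le_sup (Finset.mem_univ j)) (hk j i θ₀)⟩

end FiniteDimensional

variable [T2Space M]

/-- The jet coordinates are smooth functions of the coordinates of the splitting. -/
theorem exists_smoothThrough_coords (k : ℕ) {θ₀ : R.U} {x₁ : M}
    (h₁ : θ₀.1.base ∈ coordDomain E F V x₁) :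
    ∃ n, SmoothThrough (R.splitCoords n (R.fwd θ₀).1.1.base)
      (fun θ : R.U => coords k x₁ θ.1) θ₀ := by
  obtain ⟨f, hf, hf1, hfD⟩ := exists_bump_base (E := E)
    ((isOpen_coordDomain (E := E) F V x₁).mem_nhds h₁)
  -- The isomorphism concerns functions on the whole neighbourhood, so the coordinates are cut off
  -- in the base.
  obtain ⟨n, hn⟩ := R.exists_split_order_vector (k := k)
    (f := fun θ => f θ.1.base • coords k x₁ θ.1) fun θ => by
      refine smoothThrough_of_support (isClosed_tsupport f) hfD (fun θ hθ => ?_) (fun θ hθ => ?_) θ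
      · rw [image_eq_zero_of_notMem_tsupport hθ, zero_smul]
      · exact ((smoothThrough_base k (hfD hθ)
          (Eventually.of_forall fun x => hf x)).comp_continuousAt
            continuous_subtype_val.continuousAt).smul (smoothThrough_of_contDiff _ contDiff_id θ)
  refine ⟨n, (hn θ₀).congr ?_⟩
  filter_upwards [continuous_subtype_val.continuousAt.eventually (eventually_base hf1)] with θ hθ
  rw [hθ, one_smul]

/-- The jet coordinates of the retraction onto the equation are smooth. -/
theorem exists_smoothThrough_retraction (k : ℕ) {θ₀ : R.U} {x₁ : M}
    (h₁ : (R.fwd θ₀).1.1.base ∈ coordDomain E F V x₁) :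
    ∃ n, SmoothThrough (fun θ : R.U => coords n θ₀.1.base θ.1)
      (fun θ => coords k x₁ (R.fwd θ).1.1) θ₀ := by
  obtain ⟨f, hf, hf1, hfD⟩ := exists_bump_base (E := E)
    ((isOpen_coordDomain (E := E) F V x₁).mem_nhds h₁)
  obtain ⟨n, hn⟩ := R.exists_jet_order_vector (n := k)
    (f := fun θ => f (R.fwd θ).1.1.base • coords k x₁ (R.fwd θ).1.1) fun θ => by
      by_cases hθ : (R.fwd θ).1.1.base ∈ tsupport f
      · have hx := mem_coordDomain_self (E := E) F V (R.fwd θ).1.1.base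
        have h2 : SmoothThrough (R.splitCoords k (R.fwd θ).1.1.base)
            (fun θ => coords k x₁ (R.fwd θ).1.1) θ :=
          (R.smoothThrough_splitCoords le_rfl le_rfl hx (hfD hθ)).contDiff_comp
            (g := fun c : JetCoord E F k × (Fin k → ℝ) => c.1) contDiff_fst
        have h3 := (smoothThrough_base (θ₀ := (R.fwd θ).1.1) k (hfD hθ)
          (Eventually.of_forall fun x => hf x)).comp_continuousAt (z := θ)
            (φ := fun θ => (R.fwd θ).1.1)
            (continuous_subtype_val.comp (continuous_fst.comp R.continuous_fwd)).continuousAt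
        exact (h2.trans h3).smul h2
      · refine (smoothThrough_const _ 0 θ).congr ?_
        filter_upwards [R.continuous_fwd_base.continuousAt.eventually
          ((isClosed_tsupport f).isOpen_compl.eventually_mem hθ)] with θ' hθ'
        rw [image_eq_zero_of_notMem_tsupport hθ', zero_smul]
  refine ⟨n, (hn θ₀).congr ?_⟩
  filter_upwards [R.continuous_fwd_base.continuousAt.eventually hf1] with θ hθ
  rw [hθ, one_smul]

end Regularity

end JetGeometry

namespace JetGeometry

/-- The velocity of a curve in a finite-dimensional subspace belongs to the subspace, as the latter
is closed. -/
theorem _root_.HasDerivAt.mem_submodule {H : Type*} [NormedAddCommGroup H] [NormedSpace ℝ H]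
    [FiniteDimensional ℝ H] {S : Submodule ℝ H} {γ : ℝ → H} {d : H} {t : ℝ}
    (h : HasDerivAt γ d t) (hS : ∀ᶠ τ in 𝓝 t, γ τ ∈ S) : d ∈ S := by
  have h1 := h.tendsto_slope_zero
  refine S.closed_of_finiteDimensional.mem_of_tendsto h1 ?_
  have h2 : Tendsto (fun τ : ℝ => t + τ) (𝓝[≠] 0) (𝓝 t) := by
    have : Tendsto (fun τ : ℝ => t + τ) (𝓝 0) (𝓝 (t + 0)) :=
      (continuous_const.add continuous_id).tendsto 0
    rw [add_zero] at this
    exact this.mono_left nhdsWithin_le_nhds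
  filter_upwards [h2.eventually hS] with τ hτ
  exact S.smul_mem _ (S.sub_mem hτ hS.self_of_nhds)

namespace Regularity

variable {E : Type*} [NormedAddCommGroup E] [NormedSpace ℝ E] [FiniteDimensional ℝ E]
  {M : Type*} [TopologicalSpace M] [ChartedSpace E M] [IsManifold 𝓘(ℝ, E) ∞ M]
  {F : Type*} [NormedAddCommGroup F] [NormedSpace ℝ F] [FiniteDimensional ℝ F]
  {V : M → Type*} [TopologicalSpace (TotalSpace F V)] [∀ x, TopologicalSpace (V x)]
  [∀ x, AddCommGroup (V x)] [∀ x, Module ℝ (V x)] [FiberBundle F V] [VectorBundle ℝ F V]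
  [ContMDiffVectorBundle ∞ F V 𝓘(ℝ, E)]
  {FP : Type*} [NormedAddCommGroup FP] [NormedSpace ℝ FP] [FiniteDimensional ℝ FP]
  {P : M → Type*} [TopologicalSpace (TotalSpace FP P)] [∀ x, TopologicalSpace (P x)]
  [∀ x, AddCommGroup (P x)] [∀ x, Module ℝ (P x)] [FiberBundle FP P] [VectorBundle ℝ FP P]
  [ContMDiffVectorBundle ∞ FP P 𝓘(ℝ, E)]
  {Φ : HorizontalModule FP P (Set.univ : Set (InfJet E F V))} (R : Regularity Φ)

/-! ### The retraction along prolongations of sections -/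

open Classical in
/-- The prolongation of a section through a point of the equation, in terms of a chart; where it
leaves the neighbourhood of the equation, the value is the point itself. -/
noncomputable def path (y : prolongation Φ) (w : E) : R.U :=
  if h : jet E F V y.1.sec ((chartAt E y.1.base).symm w) ∈ R.U then ⟨_, h⟩ else R.incl y

theorem eventually_path (y : prolongation Φ) : ∀ᶠ w in 𝓝 (chartAt E y.1.base y.1.base),
    (R.path y w).1 = jet E F V y.1.sec ((chartAt E y.1.base).symm w) := by
  have h := tendsto_jet_chart_symm (mem_chart_source E y.1.base) y.1.sec
  rw [InfJet.jet_sec] at h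
  filter_upwards [h.eventually (R.isOpen_U.eventually_mem (R.prolongation_subset y.2))] with w hw
  rw [path, dif_pos hw]

theorem tendsto_path (y : prolongation Φ) :
    Tendsto (R.path y) (𝓝 (chartAt E y.1.base y.1.base)) (𝓝 (R.incl y)) := by
  have h := tendsto_jet_chart_symm (mem_chart_source E y.1.base) y.1.sec
  rw [InfJet.jet_sec] at h
  exact tendsto_subtype_rng.2 (h.congr' ((R.eventually_path y).mono fun w hw => hw.symm))

theorem path_self (y : prolongation Φ) : R.path y (chartAt E y.1.base y.1.base) = R.incl y := by
  refine Subtype.ext ((R.eventually_path y).self_of_nhds.trans ?_)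
  rw [(chartAt E y.1.base).left_inv (mem_chart_source E _), InfJet.jet_sec]
  rfl

theorem eventually_coords_path (k : ℕ) (y : prolongation Φ) :
    ∀ᶠ w in 𝓝 (chartAt E y.1.base y.1.base), coords k y.1.base (R.path y w).1 =
      (w, jetAt k (localRep E F V y.1.base y.1.sec) w) := by
  have hx := mem_coordDomain_self (E := E) F V y.1.base
  filter_upwards [R.eventually_path y, eventually_chart_symm hx.1
    ((isOpen_coordDomain F V y.1.base).eventually_mem hx)] with w h1 h2
  rw [h1, coords_jet k h2.2, (chartAt E y.1.base).right_inv h2.1]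

theorem tendsto_retraction_path (y : prolongation Φ) :
    Tendsto (fun w => (R.fwd (R.path y w)).1) (𝓝 (chartAt E y.1.base y.1.base)) (𝓝 y) := by
  have h1 := (continuous_fst.comp R.continuous_fwd).continuousAt.tendsto.comp (R.tendsto_path y)
  rw [Function.comp_apply, fwd_incl] at h1
  exact h1

theorem continuous_incl : Continuous R.incl :=
  Continuous.subtype_mk continuous_subtype_val _

variable [T2Space M]

theorem exists_isTotalOperator_snd (i : ℕ) :
    ∃ (l : ℕ) (L : ((θ : InfJet E F V) → P θ.base) → InfJet E F V → ℝ),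
      IsTotalOperator FP l L ∧ ∀ θ : R.U, (R.fwd θ).2 i = L (extend Φ.1) θ.1 := by
  obtain ⟨σ, ξ, h⟩ := R.v_eq i
  obtain ⟨l, hl⟩ := exists_isTotalOperator_foldr (F := F) (V := V) ξ σ
  have h1 : (fun θ : InfJet E F V => ξ.toFun θ.base (Φ.1 ⟨θ, trivial⟩)) =
      fun θ => ξ.toFun θ.base (extend Φ.1 θ) := funext fun θ => by
    rw [extend_of_mem Φ.1 ⟨θ, trivial⟩]
  exact ⟨l, _, hl, fun θ => by rw [← h1]; exact h θ⟩

/-- The coordinates of the second component of the splitting belong to the ideal of the equation. -/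
theorem snd_mem_equationIdeal (i : ℕ) : (fun θ => (R.fwd θ).2 i) ∈ equationIdeal R.U Φ := by
  obtain ⟨l, L, hL, h⟩ := R.exists_isTotalOperator_snd i
  rw [show (fun θ => (R.fwd θ).2 i) = fun θ : R.U => L (extend Φ.1) θ.1 from funext h]
  exact hL.mem_equationIdeal R.isOpen_U Φ

/-- The retraction onto the equation preserves the first derivatives of the prolongation of a
section at a point where it meets the equation: the second component of the splitting consists of
total derivatives of the equation and thus has zero derivative there. -/
theorem exists_hasFDerivAt_retraction (k : ℕ) (y : prolongation Φ) :
    ∃ D : E →L[ℝ] JetCoord E F k,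
      HasFDerivAt (fun w => coords k y.1.base (R.fwd (R.path y w)).1.1) D
        (chartAt E y.1.base y.1.base) ∧
      ∀ X, (D X).1 = X ∧ (D X).2 ∈ jetSpace E F k := by
  set x₁ := y.1.base with hx₁
  set y₀ := chartAt E x₁ x₁ with hy₀
  set s := localRep E F V x₁ y.1.sec with hs
  have hx := mem_coordDomain_self (E := E) F V x₁
  have hsm : SmoothNear s y₀ := smoothNear_localRep _ hx
  have hc : ∀ m, HasFDerivAt (fun w => (w, jetAt m s w))
      ((ContinuousLinearMap.id ℝ E).prod (fderiv ℝ (jetAt m s) y₀)) y₀ := fun m =>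
    (hasFDerivAt_id y₀).prodMk (hasFDerivAt_jetAt hsm m).1
  obtain ⟨n, G, hG, hG'⟩ := R.exists_smoothThrough_coords k (θ₀ := R.incl y) hx
  rw [R.fwd_incl] at hG'
  obtain ⟨m, K, hK, hK'⟩ := R.exists_smoothThrough_retraction n (θ₀ := R.incl y) (x₁ := x₁)
    (by rw [R.fwd_incl]; exact hx)
  -- the two components of the splitting along the prolongation
  have hh : HasFDerivAt (fun w => coords n x₁ (R.fwd (R.path y w)).1.1)
      ((fderiv ℝ K (y₀, jetAt m s y₀)).comp
        ((ContinuousLinearMap.id ℝ E).prod (fderiv ℝ (jetAt m s) y₀))) y₀ := by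
    have h1 := (hK.differentiable (by simp) (y₀, jetAt m s y₀)).hasFDerivAt.comp y₀ (hc m)
    refine h1.congr_of_eventuallyEq ?_
    filter_upwards [(R.tendsto_path y).eventually hK', R.eventually_coords_path m y] with w h2 h3
    rw [h2]
    exact congrArg K h3
  set D' := (fderiv ℝ K (y₀, jetAt m s y₀)).comp
        ((ContinuousLinearMap.id ℝ E).prod (fderiv ℝ (jetAt m s) y₀)) with hD'
  have hv : HasFDerivAt (fun w => fun i : Fin n => (R.fwd (R.path y w)).2 i)
      (0 : E →L[ℝ] (Fin n → ℝ)) y₀ := by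
    refine hasFDerivAt_pi'.2 fun i => ?_
    obtain ⟨l, L, hL, h⟩ := R.exists_isTotalOperator_snd i
    rw [ContinuousLinearMap.comp_zero]
    refine (hL.hasFDerivAt_zero Φ y.2).congr_of_eventuallyEq ?_
    filter_upwards [R.eventually_path y] with w hw
    rw [h, hw]
  have hGd : HasFDerivAt G (fderiv ℝ G (coords n x₁ y.1, fun _ => 0))
      (coords n x₁ y.1, fun _ => 0) :=
    (hG.differentiable (by simp) _).hasFDerivAt
  have hp0 : (coords n x₁ (R.fwd (R.path y y₀)).1.1, fun i : Fin n => (R.fwd (R.path y y₀)).2 i) =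
      (coords n x₁ y.1, fun _ => 0) := by
    rw [R.path_self, R.fwd_incl]
    rfl
  -- The jet coordinates are a function `G` of the splitting. The derivative of `G` along the
  -- prolongation and along its retraction, where the second component is zero, is the same.
  have hd1 : HasFDerivAt (fun w => coords k x₁ (R.path y w).1)
      ((fderiv ℝ G (coords n x₁ y.1, fun _ => 0)).comp (D'.prod 0)) y₀ := by
    have h1 := HasFDerivAt.comp y₀ (by rw [hp0]; exact hGd) (hh.prodMk hv)
    refine h1.congr_of_eventuallyEq ?_
    exact (R.tendsto_path y).eventually hG'
  have hd2 : HasFDerivAt (fun w => coords k x₁ (R.fwd (R.path y w)).1.1)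
      ((fderiv ℝ G (coords n x₁ y.1, fun _ => 0)).comp (D'.prod 0)) y₀ := by
    have h1 := HasFDerivAt.comp y₀ (g := G) (f := fun w =>
      (coords n x₁ (R.fwd (R.path y w)).1.1, fun _ : Fin n => (0 : ℝ)))
      (by rw [R.path_self, R.fwd_incl]; exact hGd) (hh.prodMk (hasFDerivAt_const _ _))
    refine h1.congr_of_eventuallyEq ?_
    have h2 := (R.continuous_incl.tendsto y).comp (R.tendsto_retraction_path y)
    filter_upwards [h2.eventually hG'] with w hw
    refine hw.trans ?_
    rw [splitCoords, Function.comp_apply, R.fwd_incl]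
    rfl
  have hD : (fderiv ℝ G (coords n x₁ y.1, fun _ => 0)).comp (D'.prod 0) =
      (ContinuousLinearMap.id ℝ E).prod (fderiv ℝ (jetAt k s) y₀) :=
    hd1.unique ((hc k).congr_of_eventuallyEq (R.eventually_coords_path k y))
  rw [hD] at hd2
  refine ⟨_, hd2, fun X => ⟨rfl, ?_⟩⟩
  have h4 : HasDerivAt (fun τ : ℝ => jetAt k s (y₀ + τ • X)) (fderiv ℝ (jetAt k s) y₀ X) 0 := by
    have h5 : HasDerivAt (fun τ : ℝ => y₀ + τ • X) X 0 := by
      simpa using ((hasDerivAt_id (0 : ℝ)).smul_const X).const_add y₀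
    have h6 : HasFDerivAt (jetAt k s) (fderiv ℝ (jetAt k s) y₀) (y₀ + (0 : ℝ) • X) := by
      simpa using (hasFDerivAt_jetAt hsm k).1
    exact h6.comp_hasDerivAt (0 : ℝ) h5
  refine h4.mem_submodule ?_
  have h6 : Tendsto (fun τ : ℝ => y₀ + τ • X) (𝓝 0) (𝓝 y₀) := by
    have : Continuous fun τ : ℝ => y₀ + τ • X := by fun_prop
    simpa using this.tendsto 0
  exact (h6.eventually hsm.eventually).mono fun τ hτ => jetAt_mem_jetSpace hτ k

/-- The projection from the equation to the base is open: the retraction of the prolongation of a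
section through `y` projects to a map `β` of the base whose derivative at `y` is the identity. -/
theorem eventually_exists_base_eq (R : Regularity Φ) (y : prolongation Φ)
    {N : Set (prolongation Φ)} (hN : N ∈ 𝓝 y) :
    ∀ᶠ x in 𝓝 y.1.base, ∃ y' ∈ N, y'.1.base = x := by
  have hx := mem_coordDomain_self (E := E) F V y.1.base
  obtain ⟨D, hD, hD'⟩ := R.exists_hasFDerivAt_retraction 0 y
  obtain ⟨m, K, hK, hK'⟩ := R.exists_smoothThrough_retraction 0 (θ₀ := R.incl y) (x₁ := y.1.base)
    (by rw [R.fwd_incl]; exact hx)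
  let β : E → E := fun w => (coords 0 y.1.base (R.fwd (R.path y w)).1.1).1
  have hβ : ContDiffAt ℝ ∞ β (chartAt E y.1.base y.1.base) := by
    have h1 := (smoothNear_localRep y.1.sec hx).jetAt m
    refine ContDiffAt.congr_of_eventuallyEq (f := fun w =>
      (K (w, jetAt m (localRep E F V y.1.base y.1.sec) w)).1) ?_ ?_
    · exact contDiff_fst.contDiffAt.comp _ (hK.contDiffAt.comp _
        (contDiffAt_id.prodMk h1.contDiffAt))
    · filter_upwards [(R.tendsto_path y).eventually hK', R.eventually_coords_path m y] with w h2 h3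
      change (coords 0 y.1.base (R.fwd (R.path y w)).1.1).1 = _
      rw [h2]
      exact congrArg (fun c => (K c).1) h3
  have hβ0 : β (chartAt E y.1.base y.1.base) = chartAt E y.1.base y.1.base := by
    simp only [β]
    rw [R.path_self, R.fwd_incl]
    rfl
  have hid : ∀ X, fderiv ℝ β (chartAt E y.1.base y.1.base) X = X := fun X => by
    have h1 : HasFDerivAt β ((ContinuousLinearMap.fst ℝ E (JetFibre E F 0)).comp D)
        (chartAt E y.1.base y.1.base) := hasFDerivAt_fst.comp _ hD
    rw [h1.fderiv]
    exact (hD' X).1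
  have h1 : ∀ᶠ w in 𝓝 (chartAt E y.1.base y.1.base), (R.fwd (R.path y w)).1 ∈ N ∧
      (R.fwd (R.path y w)).1.1.base ∈ (chartAt E y.1.base).source :=
    (R.tendsto_retraction_path y).eventually (Filter.inter_mem hN
      (continuous_subtype_val.continuousAt.eventually (eventually_base
        ((chartAt E y.1.base).open_source.eventually_mem hx.1))))
  have h2 := eventually_exists_eq_of_fderiv_eq_id hβ hβ0 hid h1
  filter_upwards [eventually_chart hx.1 h2] with x hxx
  obtain ⟨hxs, w, hw, hwx⟩ := hxx
  exact ⟨_, hw.1, (chartAt E y.1.base).injOn hw.2 hxs hwx⟩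

end Regularity

end JetGeometry

namespace JetGeometry
namespace Regularity

variable {E : Type*} [NormedAddCommGroup E] [NormedSpace ℝ E] [FiniteDimensional ℝ E]
  {M : Type*} [TopologicalSpace M] [ChartedSpace E M] [IsManifold 𝓘(ℝ, E) ∞ M]
  {F : Type*} [NormedAddCommGroup F] [NormedSpace ℝ F] [FiniteDimensional ℝ F]
  {V : M → Type*} [TopologicalSpace (TotalSpace F V)] [∀ x, TopologicalSpace (V x)]
  [∀ x, AddCommGroup (V x)] [∀ x, Module ℝ (V x)] [FiberBundle F V] [VectorBundle ℝ F V]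
  [ContMDiffVectorBundle ∞ F V 𝓘(ℝ, E)]
  {FP : Type*} [NormedAddCommGroup FP] [NormedSpace ℝ FP] [FiniteDimensional ℝ FP]
  {P : M → Type*} [TopologicalSpace (TotalSpace FP P)] [∀ x, TopologicalSpace (P x)]
  [∀ x, AddCommGroup (P x)] [∀ x, Module ℝ (P x)] [FiberBundle FP P] [VectorBundle ℝ FP P]
  [ContMDiffVectorBundle ∞ FP P 𝓘(ℝ, E)]
  {FQ : Type*} [NormedAddCommGroup FQ] [NormedSpace ℝ FQ] [FiniteDimensional ℝ FQ]
  {Q : M → Type*} [TopologicalSpace (TotalSpace FQ Q)] [∀ x, TopologicalSpace (Q x)]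
  [∀ x, AddCommGroup (Q x)] [∀ x, Module ℝ (Q x)] [FiberBundle FQ Q] [VectorBundle ℝ FQ Q]
  [ContMDiffVectorBundle ∞ FQ Q 𝓘(ℝ, E)]
  [T2Space M]
  {Φ : HorizontalModule FP P (Set.univ : Set (InfJet E F V))} (R : Regularity Φ)

/-! ### Sections that are flat along the equation -/

/-- Jets at a point form a complemented subspace of the space of jet coordinates. -/
theorem exists_jetProjection (E F : Type*) [NormedAddCommGroup E] [NormedSpace ℝ E]
    [FiniteDimensional ℝ E] [NormedAddCommGroup F] [NormedSpace ℝ F] [FiniteDimensional ℝ F]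
    (m : ℕ) : ∃ p : JetFibre E F m →L[ℝ] JetFibre E F m,
      (∀ u, p u ∈ jetSpace E F m) ∧ ∀ u ∈ jetSpace E F m, p u = u := by
  obtain ⟨q, hq⟩ :=
    (jetSpace E F m).subtype.exists_leftInverse_of_injective (Submodule.ker_subtype _)
  exact ⟨LinearMap.toContinuousLinearMap ((jetSpace E F m).subtype.comp q), fun u => (q u).2,
    fun u hu => congrArg Subtype.val (LinearMap.congr_fun hq ⟨u, hu⟩)⟩

/-- A section that is flat along the equation is, on the equation, locally the pullback of a section
over the base: composed with the retraction, it is constant along the fibres of the submersion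
that sends a jet to the base point of its retraction. -/
theorem exists_section_eq_of_flatAt {q : (θ : R.U) → Q θ.1.base}
    (hq : q ∈ HorizontalModule FQ Q R.U) (hflat : ∀ y, FlatAt FQ Q q (R.incl y))
    (y : prolongation Φ) :
    ∃ s : Sections E FQ Q, ∀ᶠ θ in 𝓝 (R.incl y), θ.1 ∈ prolongation Φ → q θ = s θ.1.base := by
  set x₁ := y.1.base with hx₁
  set y₀ := chartAt E x₁ x₁ with hy₀
  have hx := mem_coordDomain_self (E := E) F V x₁
  have hxQ := mem_coordDomain_self (E := E) FQ Q x₁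
  obtain ⟨k, hk⟩ := hq
  obtain ⟨G, hG, hqG⟩ := SmoothOfOrder.smoothThrough hk le_rfl (θ₀ := R.incl y) hx hxQ.2
  obtain ⟨k', K, hK, hK'⟩ := R.exists_smoothThrough_retraction k (θ₀ := R.incl y) (x₁ := x₁)
    (by rw [R.fwd_incl]; exact hx)
  -- the conditions under which the coordinate expressions hold
  let good : R.U → Prop := fun θ => coords k x₁ (R.fwd θ).1.1 = K (coords k' x₁ θ.1) ∧
    (R.fwd θ).1.1.base ∈ coordDomain E F V x₁ ∧
    (R.fwd θ).1.1.base ∈ (trivializationAt FQ Q x₁).baseSet ∧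
    ∀ᶠ θ' in 𝓝 (R.incl (R.fwd θ).1), fibreCoord FQ Q x₁ (q θ') = G (coords k x₁ θ'.1)
  have hgood : ∀ᶠ θ in 𝓝 (R.incl y), good θ := by
    have h1 : Tendsto (fun θ => (R.fwd θ).1) (𝓝 (R.incl y)) (𝓝 y) := by
      have := (continuous_fst.comp R.continuous_fwd).tendsto (R.incl y)
      rwa [Function.comp_apply, R.fwd_incl] at this
    have h2 : Tendsto (fun θ => (R.fwd θ).1.1.base) (𝓝 (R.incl y)) (𝓝 x₁) :=
      ((continuous_base.comp continuous_subtype_val).tendsto y).comp h1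
    filter_upwards [hK', h2.eventually ((isOpen_coordDomain F V x₁).eventually_mem hx),
      h2.eventually ((trivializationAt FQ Q x₁).open_baseSet.eventually_mem hxQ.2),
      ((R.continuous_incl.tendsto y).comp h1).eventually hqG.eventually_nhds] with θ a b c d
    exact ⟨a, b, c, d⟩
  have hgood' : Subtype.val '' {θ | good θ} ∈ 𝓝 y.1 :=
    R.isOpen_U.isOpenMap_subtype_val.image_mem_nhds hgood
  obtain ⟨K₀, W, hW, hWgood⟩ := (mem_nhds_infJet_iff (θ₀ := y.1) hx).1 hgood'
  let m := max K₀ k'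
  have hm₁ : K₀ ≤ m := le_max_left _ _
  have hm₂ : k' ≤ m := le_max_right _ _
  obtain ⟨g, hg, hgs⟩ := (smoothNear_localRep y.1.sec hx).exists_contDiff
  have hgj : ContDiff ℝ ∞ (jetAt m g) :=
    contDiff_iff_contDiffAt.2 fun w => ((hg.smoothNear w).jetAt m).contDiffAt
  have hgs' : ∀ᶠ w in 𝓝 y₀, jetAt m g w = jetAt m (localRep E F V x₁ y.1.sec) w :=
    hgs.eventually_nhds.mono fun w hw => jetAt_congr hw m
  -- jets near the prolongation of a section, parametrized by the base point and the difference
  obtain ⟨pr, hpr, hpr'⟩ := exists_jetProjection E F m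
  let κ : E × JetFibre E F m → JetCoord E F m := fun ζ => (ζ.1, jetAt m g ζ.1 + pr ζ.2)
  have hκ : ContDiff ℝ ∞ κ :=
    contDiff_fst.prodMk ((hgj.comp contDiff_fst).add (pr.contDiff.comp contDiff_snd))
  have hκ0 : κ (y₀, 0) = coords m x₁ y.1 := by
    refine Prod.ext rfl ?_
    change jetAt m g y₀ + pr 0 = _
    rw [map_zero, add_zero, hgs'.self_of_nhds]
    rfl
  let Ψ : E × JetFibre E F m → JetCoord E F k := fun ζ => K (coordTrunc E F hm₂ (κ ζ))
  have hΨ : ContDiff ℝ ∞ Ψ := hK.comp ((coordTrunc E F hm₂).contDiff.comp hκ)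
  have hreal : ∀ᶠ ζ in 𝓝 (y₀, (0 : JetFibre E F m)), ∃ θ : R.U, good θ ∧
      coords m x₁ θ.1 = κ ζ := by
    have h1 : ∀ᶠ ζ in 𝓝 (y₀, (0 : JetFibre E F m)), coordTrunc E F hm₁ (κ ζ) ∈ W := by
      have hc : ContinuousAt (fun ζ => coordTrunc E F hm₁ (κ ζ)) (y₀, (0 : JetFibre E F m)) :=
        ((coordTrunc E F hm₁).continuous.comp hκ.continuous).continuousAt
      refine hc.eventually (p := fun c => c ∈ W) ?_
      simp only [hκ0]
      exact hW
    have h2 : ∀ᶠ ζ in 𝓝 (y₀, (0 : JetFibre E F m)), ζ.1 ∈ (chartAt E x₁).target ∧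
        (chartAt E x₁).symm ζ.1 ∈ coordDomain E F V x₁ :=
      (continuousAt_fst (p := (y₀, (0 : JetFibre E F m)))).eventually (eventually_chart_symm hx.1
        ((isOpen_coordDomain F V x₁).eventually_mem hx))
    filter_upwards [h1, h2] with ζ h1 h2
    obtain ⟨t, ht⟩ := exists_section_jetAt_eq (V := V) (k := m) h2.2
      ((jetSpace E F m).add_mem (jetAt_mem_jetSpace (hg.smoothNear ζ.1) m) (hpr ζ.2))
    have hc : coords m x₁ (jet E F V t ((chartAt E x₁).symm ζ.1)) = κ ζ := by
      rw [coords_jet m h2.2, ht, (chartAt E x₁).right_inv h2.1]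
    obtain ⟨θ, hθ, hθ'⟩ := hWgood (jet E F V t ((chartAt E x₁).symm ζ.1)) h2.2
      (by rw [← coordTrunc_coords hm₁, hc]; exact h1)
    exact ⟨θ, hθ, by rw [hθ', hc]⟩
  have hΨθ : ∀ θ : R.U, good θ → ∀ ζ, coords m x₁ θ.1 = κ ζ →
      Ψ ζ = coords k x₁ (R.fwd θ).1.1 := fun θ hθ ζ h => by
    rw [hθ.1, ← coordTrunc_coords hm₂, h]
  have hΨ0 : Ψ (y₀, 0) = coords k x₁ y.1 := by
    have h := hΨθ (R.incl y) hgood.self_of_nhds (y₀, 0) hκ0.symm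
    rwa [R.fwd_incl] at h
  have hΨd : ∀ ζ, HasFDerivAt Ψ (fderiv ℝ Ψ ζ) ζ := fun ζ =>
    (hΨ.differentiable (by simp) ζ).hasFDerivAt
  have hB : ∀ ζ, fderiv ℝ (fun ζ => (Ψ ζ).1) ζ =
      (ContinuousLinearMap.fst ℝ E (JetFibre E F k)).comp (fderiv ℝ Ψ ζ) := fun ζ => by
    have h1 : HasFDerivAt (fun ζ => (Ψ ζ).1)
        ((ContinuousLinearMap.fst ℝ E (JetFibre E F k)).comp (fderiv ℝ Ψ ζ)) ζ :=
      hasFDerivAt_fst.comp ζ (hΨd ζ)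
    exact HasFDerivAt.fderiv (𝕜 := ℝ) (E := E × JetFibre E F m) (F := E) h1
  have hf : ∀ ζ, fderiv ℝ (fun ζ => G (Ψ ζ)) ζ = (fderiv ℝ G (Ψ ζ)).comp (fderiv ℝ Ψ ζ) := fun ζ =>
    (HasFDerivAt.comp ζ (hG.differentiable (by simp) (Ψ ζ)).hasFDerivAt (hΨd ζ)).fderiv
  -- The map to the base point of the retraction is a submersion, as the retraction preserves the
  -- derivatives of the prolongation.
  have hid : ∀ X, fderiv ℝ (fun ζ => (Ψ ζ).1) (y₀, 0) (X, 0) = X := by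
    intro X
    obtain ⟨D, hD, hD'⟩ := R.exists_hasFDerivAt_retraction k y
    have h1 : HasFDerivAt (fun w => Ψ (w, 0))
        ((fderiv ℝ Ψ (y₀, 0)).comp (ContinuousLinearMap.inl ℝ E (JetFibre E F m))) y₀ :=
      HasFDerivAt.comp (f := fun w : E => (w, (0 : JetFibre E F m))) y₀ (hΨd (y₀, 0))
        (hasFDerivAt_prodMk_left y₀ 0)
    have h2 : HasFDerivAt (fun w => Ψ (w, 0)) D y₀ := by
      refine hD.congr_of_eventuallyEq ?_
      filter_upwards [hgs', R.eventually_coords_path m y,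
        (R.tendsto_path y).eventually hgood] with w h3 h4 h5
      refine hΨθ _ h5 _ (h4.trans (Prod.ext rfl ?_))
      change _ = jetAt m g w + pr 0
      rw [map_zero, add_zero, h3]
    rw [hB, ← (hD' X).1, ← h1.unique h2]
    have h6 := (hD' X).1
    rw [← h1.unique h2] at h6
    rw [h6]
    exact h6
  -- A direction in the kernel of the submersion is taken by the retraction to a vertical direction,
  -- in which the derivative of the flat section vanishes.
  have hker : ∀ᶠ ζ in 𝓝 (y₀, (0 : JetFibre E F m)), ∀ η,
      fderiv ℝ (fun ζ => (Ψ ζ).1) ζ η = 0 → fderiv ℝ (fun ζ => G (Ψ ζ)) ζ η = 0 := by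
    filter_upwards [hreal.eventually_nhds] with ζ hζ η hη
    rw [hB] at hη
    rw [hf]
    obtain ⟨θ, hθ, hθζ⟩ := hζ.self_of_nhds
    have hu : (fderiv ℝ Ψ ζ η).2 ∈ jetSpace E F k := by
      have h1 : HasDerivAt (fun τ : ℝ => Ψ (ζ + τ • η)) (fderiv ℝ Ψ ζ η) 0 := by
        have h2 : HasDerivAt (fun τ : ℝ => ζ + τ • η) η 0 := by
          simpa using ((hasDerivAt_id (0 : ℝ)).smul_const η).const_add ζ
        have h3 : HasFDerivAt Ψ (fderiv ℝ Ψ ζ) (ζ + (0 : ℝ) • η) := by simpa using hΨd ζ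
        exact h3.comp_hasDerivAt (0 : ℝ) h2
      have h4 : HasDerivAt (fun τ : ℝ => (Ψ (ζ + τ • η)).2) (fderiv ℝ Ψ ζ η).2 0 :=
        h1.snd
      refine h4.mem_submodule ?_
      have h5 : Tendsto (fun τ : ℝ => ζ + τ • η) (𝓝 0) (𝓝 ζ) := by
        have : Continuous fun τ : ℝ => ζ + τ • η := by fun_prop
        simpa using this.tendsto 0
      filter_upwards [h5.eventually hζ] with τ hτ
      obtain ⟨θ', hθ', hθζ'⟩ := hτ
      rw [hΨθ θ' hθ' _ hθζ']
      exact jetAt_mem_jetSpace (smoothNear_localRep _ hθ'.2.1) k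
    have h6 := (hflat (R.fwd θ).1).fderiv_eq_zero (x₁ := x₁) (x₂ := x₁) hθ.2.1 hθ.2.2.1 hG
      (eventually_subtype R.isOpen_U (hθ.2.2.2.mono fun θ' h => by
        rw [extendCoord_of_mem, h])) hu
    rw [ContinuousLinearMap.comp_apply, hΨθ θ hθ ζ hθζ]
    have h7 : fderiv ℝ Ψ ζ η = (0, (fderiv ℝ Ψ ζ η).2) := Prod.ext hη rfl
    rw [h7]
    exact h6
  obtain ⟨σ, hσ, hσf⟩ := exists_factor_through_submersion (y₀ := y₀) (S := JetFibre E F m)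
    ((hG.comp hΨ).smoothNear _) ((contDiff_fst.comp hΨ).smoothNear _)
    (by change (Ψ (y₀, 0)).1 = y₀; rw [hΨ0]; rfl) hid hker
  obtain ⟨s, hs⟩ := exists_section_localRep_eq (V := Q) hxQ hσ
  refine ⟨s, ?_⟩
  -- A point of the equation is its own retraction, so that the factorization holds for `q` itself
  -- there.
  obtain ⟨N₁, hN₁, N₂, hN₂, hN⟩ := mem_nhds_prod_iff.1 hσf
  have hval := continuous_subtype_val.tendsto (R.incl y)
  have hcm : Tendsto (fun θ : R.U => coords m x₁ θ.1) (𝓝 (R.incl y)) (𝓝 (coords m x₁ y.1)) :=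
    (continuousAt_coords m (θ₀ := y.1) hx).tendsto.comp hval
  have h1 : Tendsto (fun θ : R.U => (coords m x₁ θ.1).1) (𝓝 (R.incl y)) (𝓝 y₀) :=
    (continuous_fst.tendsto _).comp hcm
  have h2 : Tendsto (fun θ : R.U => (coords m x₁ θ.1).2 - jetAt m g (coords m x₁ θ.1).1)
      (𝓝 (R.incl y)) (𝓝 0) := by
    have h3 := ((continuous_snd.tendsto _).comp hcm).sub ((hgj.continuous.tendsto y₀).comp h1)
    have h4 : (coords m x₁ y.1).2 - jetAt m g y₀ = 0 := by
      rw [hgs'.self_of_nhds]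
      exact sub_self _
    rw [h4] at h3
    exact h3
  filter_upwards [h1.eventually hN₁, h2.eventually hN₂, hgood,
    hval.eventually (eventually_base ((isOpen_coordDomain F V x₁).eventually_mem hx)),
    hval.eventually (eventually_base hs),
    hval.eventually (eventually_base ((isOpen_coordDomain FQ Q x₁).eventually_mem hxQ))]
    with θ h3 h4 h5 h6 h7 h8 hθ
  let ζ : E × JetFibre E F m :=
    ((coords m x₁ θ.1).1, (coords m x₁ θ.1).2 - jetAt m g (coords m x₁ θ.1).1)
  have h9 : coords m x₁ θ.1 = κ ζ := by
    have h := hpr' _ ((jetSpace E F m).sub_mem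
      (jetAt_mem_jetSpace (smoothNear_localRep θ.1.sec h6) m)
      (jetAt_mem_jetSpace (hg.smoothNear (chartAt E x₁ θ.1.base)) m))
    exact Prod.ext rfl ((add_sub_cancel _ _).symm.trans (congrArg (_ + ·) h.symm))
  have h10 : G (Ψ ζ) = σ (Ψ ζ).1 := hN (Set.mk_mem_prod (b := ζ.2) h3 h4)
  have h11 : θ = R.incl ⟨θ.1, hθ⟩ := rfl
  have h12 : R.fwd θ = (⟨θ.1, hθ⟩, 0) := R.fwd_incl ⟨θ.1, hθ⟩
  rw [hΨθ θ h5 ζ h9, h12] at h10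
  have h13 := h5.2.2.2.self_of_nhds
  rw [h12] at h13
  refine fibreCoord_injective FQ Q h8.2 ?_
  rw [h7]
  exact h13.trans h10

end Regularity
end JetGeometry

namespace JetGeometry
namespace Regularity

universe uM

variable {E : Type*} [NormedAddCommGroup E] [NormedSpace ℝ E] [FiniteDimensional ℝ E]
  {M : Type uM} [TopologicalSpace M] [ChartedSpace E M] [IsManifold 𝓘(ℝ, E) ∞ M]
  {F : Type*} [NormedAddCommGroup F] [NormedSpace ℝ F] [FiniteDimensional ℝ F]
  {V : M → Type*} [TopologicalSpace (TotalSpace F V)] [∀ x, TopologicalSpace (V x)]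
  [∀ x, AddCommGroup (V x)] [∀ x, Module ℝ (V x)] [FiberBundle F V] [VectorBundle ℝ F V]
  [ContMDiffVectorBundle ∞ F V 𝓘(ℝ, E)]
  {FP : Type*} [NormedAddCommGroup FP] [NormedSpace ℝ FP] [FiniteDimensional ℝ FP]
  {P : M → Type*} [TopologicalSpace (TotalSpace FP P)] [∀ x, TopologicalSpace (P x)]
  [∀ x, AddCommGroup (P x)] [∀ x, Module ℝ (P x)] [FiberBundle FP P] [VectorBundle ℝ FP P]
  [ContMDiffVectorBundle ∞ FP P 𝓘(ℝ, E)]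
  {FQ : Type*} [NormedAddCommGroup FQ] [NormedSpace ℝ FQ] [FiniteDimensional ℝ FQ]
  {Q : M → Type*} [TopologicalSpace (TotalSpace FQ Q)] [∀ x, TopologicalSpace (Q x)]
  [∀ x, AddCommGroup (Q x)] [∀ x, Module ℝ (Q x)] [FiberBundle FQ Q] [VectorBundle ℝ FQ Q]
  [ContMDiffVectorBundle ∞ FQ Q 𝓘(ℝ, E)]
  [T2Space M]
  {Φ : HorizontalModule FP P (Set.univ : Set (InfJet E F V))} (R : Regularity Φ)

/-! ### Sections vanishing to second order along the equation -/

/-- A locally finite cover by compact sets contained in coordinate domains, with two families of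
smooth functions supported in them whose products sum to one. -/
theorem _root_.JetGeometry.exists_weights [SigmaCompactSpace M] (F : Type*) [NormedAddCommGroup F]
    [NormedSpace ℝ F] (V : M → Type*) [TopologicalSpace (TotalSpace F V)]
    [∀ x, TopologicalSpace (V x)] [∀ x, AddCommGroup (V x)] [∀ x, Module ℝ (V x)]
    [FiberBundle F V] [VectorBundle ℝ F V] (FQ : Type*) [NormedAddCommGroup FQ]
    [NormedSpace ℝ FQ] (Q : M → Type*) [TopologicalSpace (TotalSpace FQ Q)]
    [∀ x, TopologicalSpace (Q x)] [∀ x, AddCommGroup (Q x)] [∀ x, Module ℝ (Q x)]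
    [FiberBundle FQ Q] [VectorBundle ℝ FQ Q] :
    ∃ (ι : Type uM) (c : ι → M) (C : ι → Set M) (η φ : ι → M → ℝ), LocallyFinite C ∧
      (∀ i, IsClosed (C i)) ∧ (∀ i, IsCompact (C i)) ∧
      (∀ i, C i ⊆ coordDomain E F V (c i) ∩ (trivializationAt FQ Q (c i)).baseSet) ∧
      (∀ i, ContMDiff 𝓘(ℝ, E) 𝓘(ℝ, ℝ) ∞ (η i)) ∧ (∀ i, ContMDiff 𝓘(ℝ, E) 𝓘(ℝ, ℝ) ∞ (φ i)) ∧
      (∀ i, ∀ x ∉ C i, η i x = 0) ∧ (∀ i, ∀ x ∉ C i, φ i x = 0) ∧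
      ∀ (x : M) (T : Finset ι), (∀ i, x ∈ C i → i ∈ T) → ∑ i ∈ T, η i x * φ i x = 1 := by
  obtain ⟨ι, f, hf⟩ := SmoothBumpCovering.exists_isSubordinate 𝓘(ℝ, E)
    (U := fun x => coordDomain E F V x ∩ (trivializationAt FQ Q x).baseSet)
    (isClosed_univ (X := M)) fun x _ =>
      ((isOpen_coordDomain F V x).inter (trivializationAt FQ Q x).open_baseSet).mem_nhds
        ⟨mem_coordDomain_self F V x, FiberBundle.mem_baseSet_trivializationAt' x⟩
  have hC : LocallyFinite fun i => tsupport (f i) := f.locallyFinite.closure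
  have hfs : ∀ i, ContMDiff 𝓘(ℝ, E) 𝓘(ℝ, ℝ) ∞ fun x => f i x * f i x := fun i =>
    (f i).contMDiff.mul (f i).contMDiff
  have h0 : ∀ i, ∀ x ∉ tsupport (f i), f i x = 0 := fun i x hx =>
    image_eq_zero_of_notMem_tsupport hx
  -- The products of the two families are the normalized squares of bump functions.
  let S : M → ℝ := fun x => ∑ᶠ i, f i x * f i x
  have hS : ContMDiff 𝓘(ℝ, E) 𝓘(ℝ, ℝ) ∞ S := by
    refine contMDiff_finsum hfs (hC.subset fun i x hx => ?_)
    by_contra h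
    exact hx (by simp [h0 i x h])
  have hSsum : ∀ (x : M) (T : Finset ι), (∀ i, x ∈ tsupport (f i) → i ∈ T) →
      S x = ∑ i ∈ T, f i x * f i x := fun x T hT => by
    refine finsum_eq_sum_of_support_subset _ fun i hi => hT i ?_
    by_contra h
    exact hi (by simp [h0 i x h])
  have hSpos : ∀ x, S x ≠ 0 := by
    intro x
    have hfin : {i | x ∈ tsupport (f i)}.Finite := hC.point_finite x
    have h1 := (f.eventuallyEq_one x trivial).self_of_nhds
    rw [hSsum x hfin.toFinset fun i hi => hfin.mem_toFinset.2 hi]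
    refine (Finset.sum_pos' (fun i _ => mul_self_nonneg _) ⟨f.ind x trivial, ?_, ?_⟩).ne'
    · refine hfin.mem_toFinset.2 (by_contra fun h => ?_)
      rw [h0 _ x h] at h1
      exact zero_ne_one h1
    · rw [h1]
      norm_num
  refine ⟨ι, f.c, fun i => tsupport (f i), fun i => f i, fun i x => f i x / S x, hC,
    fun i => isClosed_tsupport _, fun i => (f i).hasCompactSupport, hf, fun i => (f i).contMDiff,
    fun i => (f i).contMDiff.div₀ hS hSpos, h0, fun i x hx => by simp [h0 i x hx], fun x T hT => ?_⟩
  have h1 : ∀ i, f i x * (f i x / S x) = f i x * f i x / S x := fun i => (mul_div_assoc _ _ _).symm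
  simp only [h1]
  rw [← Finset.sum_div, ← hSsum x T hT, div_self (hSpos x)]

variable {H : Type*} [NormedAddCommGroup H] [NormedSpace ℝ H]

/-- A function on the neighbourhood of the equation as a function on the product, in the form needed
for the Hadamard lemma. -/
theorem smoothInCoords_bwd {n : ℕ} {f : R.U → H}
    (hf : ∀ θ₀, SmoothThrough (R.splitCoords n (R.fwd θ₀).1.1.base) f θ₀) (y : prolongation Φ)
    (w : ℕ → ℝ) (hw : w ∈ R.W) :
    SmoothInCoords n (fun y' => coords n y.1.base y'.1) (fun z => f (R.bwd z)) (y, w) := by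
  obtain ⟨G, hG, h⟩ := hf (R.bwd (y, w))
  refine ⟨G, hG, ?_⟩
  have h1 := (R.continuousAt_bwd (z := (y, w)) hw).eventually h
  rw [R.fwd_bwd hw] at h1
  filter_upwards [h1, (continuous_snd.tendsto (y, w)).eventually (R.isOpen_W.eventually_mem hw)]
    with z h2 h3
  rw [h2, splitCoords, R.fwd_bwd h3]

/-- A function on the product as a function on the neighbourhood of the equation. -/
theorem smoothThrough_fwd {n : ℕ} {h : prolongation Φ × (ℕ → ℝ) → H}
    (hh : ∀ y, ∀ w ∈ R.W, SmoothInCoords n (fun y' => coords n y.1.base y'.1) h (y, w))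
    (θ₀ : R.U) :
    SmoothThrough (R.splitCoords n (R.fwd θ₀).1.1.base) (fun θ => h (R.fwd θ)) θ₀ := by
  obtain ⟨G, hG, h⟩ := hh (R.fwd θ₀).1 (R.fwd θ₀).2 (R.fwd_mem θ₀)
  exact ⟨G, hG, (R.continuous_fwd.tendsto θ₀).eventually h⟩

theorem tendsto_bwd_line (y : prolongation Φ) (w : ℕ → ℝ) :
    Tendsto (fun τ : ℝ => R.bwd (y, τ • w)) (𝓝 0) (𝓝 (R.incl y)) := by
  have h1 : Tendsto (fun τ : ℝ => (y, τ • w)) (𝓝 0) (𝓝 (y, (0 : ℕ → ℝ))) := by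
    have : Continuous fun τ : ℝ => (y, τ • w) := by fun_prop
    simpa using this.tendsto 0
  have h2 := (R.continuousAt_bwd (z := (y, 0)) R.zero_mem_W).tendsto.comp h1
  rwa [R.bwd_zero] at h2

theorem eventually_line_mem (w : ℕ → ℝ) : ∀ᶠ τ : ℝ in 𝓝 0, τ • w ∈ R.W := by
  have h1 : Tendsto (fun τ : ℝ => τ • w) (𝓝 0) (𝓝 (0 : ℕ → ℝ)) := by
    have : Continuous fun τ : ℝ => τ • w := by fun_prop
    simpa using this.tendsto 0
  exact h1.eventually (R.isOpen_W.eventually_mem R.zero_mem_W)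

/-- A section that vanishes and is flat along the equation has zero derivative at the equation also
in the directions of the second factor of the splitting: together with the vertical directions,
the Cartan directions, which the retraction preserves, span all directions. -/
theorem hasDerivAt_line {q : (θ : R.U) → Q θ.1.base} (hq : q ∈ HorizontalModule FQ Q R.U)
    (h0 : ∀ y, q (R.incl y) = 0) (hflat : ∀ y, FlatAt FQ Q q (R.incl y)) (y : prolongation Φ)
    {x₂ : M} (hx₂ : y.1.base ∈ (trivializationAt FQ Q x₂).baseSet) (w : ℕ → ℝ) :
    HasDerivAt (fun τ : ℝ => fibreCoord FQ Q x₂ (q (R.bwd (y, τ • w)))) 0 0 := by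
  have hx := mem_coordDomain_self (E := E) F V y.1.base
  obtain ⟨k, hk⟩ := hq
  obtain ⟨G, hG, hqG⟩ := SmoothOfOrder.smoothThrough hk le_rfl (θ₀ := R.incl y) hx hx₂
  obtain ⟨n, K, hK, hK'⟩ := R.exists_smoothThrough_coords k (θ₀ := R.incl y) hx
  rw [R.fwd_incl] at hK'
  have hline := R.tendsto_bwd_line y w
  -- the jet coordinates along the line
  have hc : ∃ d, HasDerivAt (fun τ : ℝ => coords k y.1.base (R.bwd (y, τ • w)).1) d 0 := by
    have h1 : HasDerivAt (fun τ : ℝ => (coords n y.1.base y.1, fun i : Fin n => τ * w i))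
        (0, fun i : Fin n => w i) 0 :=
      (hasDerivAt_const _ _).prodMk (hasDerivAt_pi.2 fun i => by
        simpa using (hasDerivAt_id (0 : ℝ)).mul_const (w i))
    refine ⟨_, ((hK.differentiable (by simp) _).hasFDerivAt.comp_hasDerivAt (0 : ℝ)
      h1).congr_of_eventuallyEq ?_⟩
    filter_upwards [hline.eventually hK', R.eventually_line_mem w] with τ h2 h3
    refine h2.trans ?_
    rw [splitCoords, R.fwd_bwd h3]
    rfl
  obtain ⟨d, hd⟩ := hc
  have hbase : R.bwd (y, (0 : ℝ) • w) = R.incl y := by rw [zero_smul, R.bwd_zero]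
  have hd2 : d.2 ∈ jetSpace E F k := by
    have h1 : HasDerivAt (fun τ : ℝ => (coords k y.1.base (R.bwd (y, τ • w)).1).2) d.2 0 := hd.snd
    refine h1.mem_submodule ?_
    filter_upwards [hline.eventually (continuous_subtype_val.continuousAt.eventually
      (eventually_base ((isOpen_coordDomain F V y.1.base).eventually_mem hx)))] with τ hτ
    exact jetAt_mem_jetSpace (smoothNear_localRep _ hτ) k
  have hGd : HasFDerivAt G (fderiv ℝ G (coords k y.1.base y.1)) (coords k y.1.base y.1) :=
    (hG.differentiable (by simp) _).hasFDerivAt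
  have hvert : ∀ u ∈ jetSpace E F k, fderiv ℝ G (coords k y.1.base y.1) (0, u) = 0 := fun u hu =>
    (hflat y).fderiv_eq_zero (x₁ := y.1.base) (x₂ := x₂) hx hx₂ hG
      (eventually_subtype R.isOpen_U (hqG.mono fun θ' h => by rw [extendCoord_of_mem, ← h])) hu
  obtain ⟨D, hD, hD'⟩ := R.exists_hasFDerivAt_retraction k y
  have hcartan : (fderiv ℝ G (coords k y.1.base y.1)).comp D = 0 := by
    have h1 := HasFDerivAt.comp (g := G) (chartAt E y.1.base y.1.base)
      (by rw [R.path_self, R.fwd_incl]; exact hGd) hD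
    refine h1.unique ((hasFDerivAt_const (0 : FQ) _).congr_of_eventuallyEq ?_)
    have h2 := (R.continuous_incl.tendsto y).comp (R.tendsto_retraction_path y)
    have h3 := h2.eventually (continuous_subtype_val.continuousAt.eventually
      (eventually_base ((trivializationAt FQ Q x₂).open_baseSet.eventually_mem hx₂)))
    filter_upwards [h2.eventually hqG, h3] with v h4 h5
    refine h4.symm.trans ?_
    change fibreCoord FQ Q x₂ (q (R.incl _)) = 0
    rw [h0]
    exact fibreCoord_zero FQ Q h5
  have hGc : HasDerivAt (fun τ : ℝ => G (coords k y.1.base (R.bwd (y, τ • w)).1))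
      (fderiv ℝ G (coords k y.1.base y.1) d) 0 :=
    HasFDerivAt.comp_hasDerivAt (l := G) (0 : ℝ) (by rw [hbase]; exact hGd) hd
  have hzero : fderiv ℝ G (coords k y.1.base y.1) d = 0 := by
    have h1 : d = D d.1 + (0, d.2 - (D d.1).2) :=
      Prod.ext (by simp [(hD' d.1).1]) (by simp)
    rw [h1, map_add, hvert _ (Submodule.sub_mem _ hd2 (hD' d.1).2), add_zero]
    exact DFunLike.congr_fun hcartan d.1
  rw [hzero] at hGc
  exact hGc.congr_of_eventuallyEq (hline.eventually hqG)

end Regularity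
end JetGeometry

namespace JetGeometry
namespace Regularity

universe uM

variable {E : Type*} [NormedAddCommGroup E] [NormedSpace ℝ E] [FiniteDimensional ℝ E]
  {M : Type uM} [TopologicalSpace M] [ChartedSpace E M] [IsManifold 𝓘(ℝ, E) ∞ M]
  {F : Type*} [NormedAddCommGroup F] [NormedSpace ℝ F] [FiniteDimensional ℝ F]
  {V : M → Type*} [TopologicalSpace (TotalSpace F V)] [∀ x, TopologicalSpace (V x)]
  [∀ x, AddCommGroup (V x)] [∀ x, Module ℝ (V x)] [FiberBundle F V] [VectorBundle ℝ F V]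
  [ContMDiffVectorBundle ∞ F V 𝓘(ℝ, E)]
  {FP : Type*} [NormedAddCommGroup FP] [NormedSpace ℝ FP] [FiniteDimensional ℝ FP]
  {P : M → Type*} [TopologicalSpace (TotalSpace FP P)] [∀ x, TopologicalSpace (P x)]
  [∀ x, AddCommGroup (P x)] [∀ x, Module ℝ (P x)] [FiberBundle FP P] [VectorBundle ℝ FP P]
  [ContMDiffVectorBundle ∞ FP P 𝓘(ℝ, E)]
  {FQ : Type*} [NormedAddCommGroup FQ] [NormedSpace ℝ FQ] [FiniteDimensional ℝ FQ]
  {Q : M → Type*} [TopologicalSpace (TotalSpace FQ Q)] [∀ x, TopologicalSpace (Q x)]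
  [∀ x, AddCommGroup (Q x)] [∀ x, Module ℝ (Q x)] [FiberBundle FQ Q] [VectorBundle ℝ FQ Q]
  [ContMDiffVectorBundle ∞ FQ Q 𝓘(ℝ, E)]
  [T2Space M]
  {Φ : HorizontalModule FP P (Set.univ : Set (InfJet E F V))} (R : Regularity Φ)

/-- A coefficient of the Hadamard expansion is on the zero section the derivative of the function in
the direction of the corresponding coordinate. -/
theorem eq_zero_of_hasDerivAt_line {H : Type*} [NormedAddCommGroup H] [NormedSpace ℝ H] {n : ℕ}
    {h : prolongation Φ × (ℕ → ℝ) → H} {b : Fin n → prolongation Φ × (ℕ → ℝ) → H}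
    (hb : ∀ j y, ∀ w ∈ R.W, SmoothInCoords n (fun y' => coords n y.1.base y'.1) (b j) (y, w))
    (hsum : ∀ y, ∀ w ∈ R.W, h (y, w) = ∑ j : Fin n, w j • b j (y, w)) (j : Fin n)
    (y : prolongation Φ)
    (hd : HasDerivAt (fun τ : ℝ => h (y, τ • (Pi.single (j : ℕ) 1 : ℕ → ℝ))) 0 0) :
    b j (y, 0) = 0 := by
  obtain ⟨g, hg, hgb⟩ := hb j y 0 R.zero_mem_W
  have h1 := hasDerivAt_of_eventuallyEq_coords
    (c := fun y' : prolongation Φ => coords n y.1.base y'.1) (h := b j) (z₀ := (y, 0)) hg hgb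
    (γ := fun τ => τ • (Pi.single (j : ℕ) 1 : ℕ → ℝ)) (γ' := Pi.single (j : ℕ) 1) (t := 0)
    (fun i => by simpa using (hasDerivAt_id (0 : ℝ)).mul_const ((Pi.single (j : ℕ) 1 : ℕ → ℝ) i))
    (zero_smul ℝ _)
  have h2 := (hasDerivAt_id (0 : ℝ)).smul h1
  have h3 : HasDerivAt (fun τ : ℝ => h (y, τ • (Pi.single (j : ℕ) 1 : ℕ → ℝ)))
      (b j (y, 0)) 0 := by
    refine HasDerivAt.congr_of_eventuallyEq (f := fun τ : ℝ => τ • b j (y, τ • Pi.single (j : ℕ) 1))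
      (by simpa [Pi.smul_def'] using h2) ?_
    filter_upwards [R.eventually_line_mem (Pi.single (j : ℕ) 1)] with τ hτ
    rw [hsum y _ hτ, Finset.sum_eq_single j]
    · simp
    · intro i _ hi
      have : (i : ℕ) ≠ j := fun h => hi (Fin.ext h)
      simp [this]
    · simp
  exact h3.unique hd

variable [SigmaCompactSpace M]

/-- A section that vanishes and is flat along the equation belongs to `I²Q`: localized in the base,
it is expanded twice by the Hadamard lemma in the second factor of the splitting, whose coordinates
are elements of `I`. -/
theorem mem_idealSqModule_of_flatAt {q : (θ : R.U) → Q θ.1.base}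
    (hq : q ∈ HorizontalModule FQ Q R.U) (h0 : ∀ y, q (R.incl y) = 0)
    (hflat : ∀ y, FlatAt FQ Q q (R.incl y)) : q ∈ idealSqModule FQ Q R.U Φ := by
  classical
  obtain ⟨ι, c, C, η, φ, hC, hCc, hCk, hCD, hη, hφ, hη0, hφ0, hsum⟩ :=
    exists_weights (E := E) (M := M) F V FQ Q
  have hbase : ∀ θ : R.U, ContinuousAt (fun θ : R.U => θ.1.base) θ := fun θ =>
    (continuous_base.comp continuous_subtype_val).continuousAt
  have hval : ∀ θ : R.U, ContinuousAt (Subtype.val : R.U → _) θ := fun θ =>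
    continuous_subtype_val.continuousAt
  obtain ⟨k, hk⟩ := id hq
  -- the localized coordinate expressions
  let f : ι → R.U → FQ := fun i θ => φ i θ.1.base • fibreCoord FQ Q (c i) (q θ)
  have hf0 : ∀ i, ∀ θ : R.U, θ.1.base ∉ C i → f i θ = 0 := fun i θ hθ => by
    change φ i θ.1.base • _ = 0
    rw [hφ0 i _ hθ, zero_smul]
  have hf : ∀ i, ∀ θ₀ : R.U, SmoothThrough (fun θ : R.U => coords k θ₀.1.base θ.1) (f i) θ₀ :=
    fun i θ₀ => smoothThrough_of_support (hCc i) (fun x hx => (hCD i hx).1) (hf0 i)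
      (fun θ hθ => ((smoothThrough_base k (hCD i hθ).1
        (Eventually.of_forall fun x => hφ i x)).comp_continuousAt (hval θ)).smul
          (SmoothOfOrder.smoothThrough hk le_rfl (hCD i hθ).1 (hCD i hθ).2)) θ₀
  obtain ⟨n, hn⟩ := R.exists_split_order_family hC hCc hCk hf0 hf
  have hfz : ∀ i y, f i (R.bwd (y, 0)) = 0 := by
    intro i y
    by_cases hy : y.1.base ∈ C i
    · change φ i _ • fibreCoord FQ Q (c i) (q (R.bwd (y, 0))) = 0
      rw [R.bwd_zero, h0, fibreCoord_zero FQ Q (x := (R.incl y).1.base) (hCD i hy).2, smul_zero]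
    · rw [R.bwd_zero]
      exact hf0 i (R.incl y) hy
  have hfd : ∀ i y w, HasDerivAt (fun τ : ℝ => f i (R.bwd (y, τ • w))) 0 0 := by
    intro i y w
    have hline := R.tendsto_bwd_line y w
    by_cases hy : y.1.base ∈ C i
    · have h1 : (fun θ : R.U => φ i θ.1.base) ∈ Functions R.U := ⟨0, fun θ₀ =>
        (smoothThrough_base 0 (mem_coordDomain_self F V θ₀.1.base)
          (Eventually.of_forall fun x => hφ i x)).comp_continuousAt (hval θ₀)⟩
      refine (R.hasDerivAt_line (smul_mem_horizontalModule h1 hq) (fun y' => ?_) (fun y' =>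
        flatAt_smul R.isOpen_U h1 hq (h0 y') (Or.inr (hflat y'))) y
          (hCD i hy).2 w).congr_of_eventuallyEq ?_
      · simp only [h0, smul_zero]
      · filter_upwards [hline.eventually ((hbase (R.incl y)).eventually
          ((trivializationAt FQ Q (c i)).open_baseSet.eventually_mem (hCD i hy).2))] with τ hτ
        exact (fibreCoord_smul FQ Q hτ _ _).symm
    · refine (hasDerivAt_const (0 : ℝ) (0 : FQ)).congr_of_eventuallyEq ?_
      filter_upwards [hline.eventually ((hbase (R.incl y)).eventually
        ((hCc i).isOpen_compl.eventually_mem hy))] with τ hτ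
      exact hf0 i _ hτ
  -- Two applications of the Hadamard lemma: the coefficients of the first expansion vanish on the
  -- equation, because the first derivatives of the section do.
  choose b hb hbf using fun i => exists_hadamard R.starConvex_W
    (c := fun y y' : prolongation Φ => coords n y.1.base y'.1) (h := fun z => f i (R.bwd z))
    (R.smoothInCoords_bwd (hn i)) (hfz i)
  have hbz : ∀ i j y, b i j (y, 0) = 0 := fun i j y =>
    R.eq_zero_of_hasDerivAt_line (h := fun z => f i (R.bwd z)) (hb i) (hbf i) j y (hfd i y _)
  choose a ha hab using fun i j => exists_hadamard R.starConvex_W (hb i j) (hbz i j)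
  -- The base point varies along the segments in the second factor of the splitting, so that the
  -- coefficients need not be supported over `C i`: they are cut off by the other weights.
  let g : ι → R.U → Fin n → Fin n → FQ := fun i θ j l => η i θ.1.base • a i j l (R.fwd θ)
  have hg0 : ∀ i, ∀ θ : R.U, θ.1.base ∉ C i → g i θ = 0 := fun i θ hθ => by
    funext j l
    change η i θ.1.base • _ = 0
    rw [hη0 i _ hθ, zero_smul]
  obtain ⟨n', hn'⟩ := R.exists_split_order_family (k := 0) (f := fun i θ => η i θ.1.base) hC hCc hCk
    (fun i θ hθ => hη0 i _ hθ) fun i θ₀ =>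
      (smoothThrough_base 0 (mem_coordDomain_self F V θ₀.1.base)
        (Eventually.of_forall fun x => hη i x)).comp_continuousAt (hval θ₀)
  obtain ⟨m, hm⟩ := R.exists_jet_order_family (n := max n n') hC hCc hCk hg0 fun i θ₀ =>
    SmoothThrough.pi fun j => SmoothThrough.pi fun l =>
      (R.smoothThrough_splitCoords_mono (le_max_right n n') (hn' i θ₀)).smul
        (R.smoothThrough_splitCoords_mono (le_max_left n n') (R.smoothThrough_fwd (ha i j l) θ₀))
  have hfin : ∀ x, {i | x ∈ C i}.Finite := hC.point_finite
  let T : M → Finset ι := fun x => (hfin x).toFinset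
  have hT : ∀ x i, i ∈ T x ↔ x ∈ C i := fun x i => (hfin x).mem_toFinset
  -- The sections `p i j l` are supported over `C i` and extended by zero, and the sections `A j l`
  -- are their locally finite sums.
  let p : ι → Fin n → Fin n → (θ : R.U) → Q θ.1.base := fun i j l θ =>
    (trivializationAt FQ Q (c i)).symm θ.1.base (g i θ j l)
  let A : Fin n → Fin n → (θ : R.U) → Q θ.1.base := fun j l θ => ∑ i ∈ T θ.1.base, p i j l θ
  have hA : ∀ j l, A j l ∈ HorizontalModule FQ Q R.U := by
    refine fun j l => ⟨m, fun θ₀ => ?_⟩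
    have hx := FiberBundle.mem_baseSet_trivializationAt' (F := FQ) (E := Q) θ₀.1.base
    have h1 : ∀ i ∈ T θ₀.1.base, SmoothThrough (fun θ : R.U => coords m θ₀.1.base θ.1)
        (fun θ => fibreCoord FQ Q θ₀.1.base (p i j l θ)) θ₀ := by
      intro i hi
      have h2 := hCD i ((hT _ _).1 hi)
      refine smoothThrough_fibreCoord_change FQ Q le_rfl (mem_coordDomain_self F V θ₀.1.base)
        h2.2 (mem_coordDomain_self F V θ₀.1.base) hx ?_
      refine ((hm i θ₀).contDiff_comp (g := fun v => v j l) ?_).congr ?_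
      · exact contDiff_pi.1 (contDiff_pi.1 contDiff_id j) l
      · filter_upwards [(hbase θ₀).eventually
          ((trivializationAt FQ Q (c i)).open_baseSet.eventually_mem h2.2)] with θ hθ
        exact fibreCoord_symm FQ Q hθ _
    refine (SmoothThrough.sum h1).congr ?_
    filter_upwards [(hbase θ₀).eventually (hC.eventually_subset hCc θ₀.1.base),
      (hbase θ₀).eventually ((trivializationAt FQ Q θ₀.1.base).open_baseSet.eventually_mem hx),
      (Filter.eventually_all_finset (T θ₀.1.base)).2 fun i hi => (hbase θ₀).eventually
        ((trivializationAt FQ Q (c i)).open_baseSet.eventually_mem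
          (hCD i ((hT _ _).1 hi)).2)] with θ h2 h3 h5
    have h4 : A j l θ = ∑ i ∈ T θ₀.1.base, p i j l θ := by
      refine Finset.sum_subset (fun i hi => (hT _ _).2 (h2 ((hT _ _).1 hi))) fun i hi hi' => ?_
      change (trivializationAt FQ Q (c i)).symm θ.1.base (g i θ j l) = 0
      rw [hg0 i θ fun h => hi' ((hT _ _).2 h)]
      exact ((trivializationAt FQ Q (c i)).symmₗ_apply (R := ℝ) (h5 i hi) 0).symm.trans
        (map_zero _)
    change fibreCoord FQ Q θ₀.1.base (A j l θ) = _
    rw [h4]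
    exact map_sum (AddMonoidHom.mk' (fun v : Q θ.1.base => fibreCoord FQ Q θ₀.1.base v)
      (fibreCoord_add FQ Q h3)) _ _
  have hqA : q = ∑ j : Fin n, ∑ l : Fin n,
      fun θ : R.U => ((R.fwd θ).2 j * (R.fwd θ).2 l) • A j l θ := by
    funext θ
    simp only [Finset.sum_apply]
    have h1 : ∀ i ∈ T θ.1.base, ∑ j : Fin n, ∑ l : Fin n,
        ((R.fwd θ).2 j * (R.fwd θ).2 l) • p i j l θ = (η i θ.1.base * φ i θ.1.base) • q θ := by
      intro i hi
      have h2 := (hCD i ((hT _ _).1 hi)).2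
      let e : Q θ.1.base →+ FQ := AddMonoidHom.mk' (fun v => fibreCoord FQ Q (c i) v)
        (fibreCoord_add FQ Q h2)
      refine fibreCoord_injective FQ Q h2 ?_
      change e _ = _
      rw [fibreCoord_smul FQ Q h2, mul_smul, map_sum]
      have h3 : φ i θ.1.base • fibreCoord FQ Q (c i) (q θ) = f i (R.bwd (R.fwd θ)) := by
        rw [R.bwd_fwd]
      rw [h3, hbf i (R.fwd θ).1 (R.fwd θ).2 (R.fwd_mem θ), Finset.smul_sum]
      refine Finset.sum_congr rfl fun j _ => ?_
      rw [hab i j (R.fwd θ).1 (R.fwd θ).2 (R.fwd_mem θ), map_sum, Finset.smul_sum, Finset.smul_sum]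
      refine Finset.sum_congr rfl fun l _ => ?_
      change fibreCoord FQ Q (c i) (_ • p i j l θ) = _
      rw [fibreCoord_smul FQ Q h2, fibreCoord_symm FQ Q h2]
      change _ • η i θ.1.base • a i j l (R.fwd θ) = _
      rw [smul_smul, smul_smul, smul_smul]
      congr 1
      ring
    have h4 := hsum θ.1.base (T θ.1.base) fun i hi => (hT _ _).2 hi
    calc q θ = ∑ i ∈ T θ.1.base, (η i θ.1.base * φ i θ.1.base) • q θ := by
          rw [← Finset.sum_smul, h4, one_smul]
      _ = ∑ i ∈ T θ.1.base, ∑ j : Fin n, ∑ l : Fin n,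
          ((R.fwd θ).2 j * (R.fwd θ).2 l) • p i j l θ :=
        Finset.sum_congr rfl fun i hi => (h1 i hi).symm
      _ = ∑ j : Fin n, ∑ l : Fin n, ((R.fwd θ).2 j * (R.fwd θ).2 l) • A j l θ := by
        rw [Finset.sum_comm]
        refine Finset.sum_congr rfl fun j _ => ?_
        rw [Finset.sum_comm]
        refine Finset.sum_congr rfl fun l _ => ?_
        rw [← Finset.smul_sum]
  rw [hqA]
  exact Submodule.sum_mem _ fun j _ => Submodule.sum_mem _ fun l _ => Submodule.subset_span
    ⟨_, R.snd_mem_equationIdeal j, _, R.snd_mem_equationIdeal l, A j l, hA j l, rfl⟩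

/-- `I²Q` consists of the sections that vanish to second order along the equation. -/
theorem mem_idealSqModule_iff {q : (θ : R.U) → Q θ.1.base} : q ∈ idealSqModule FQ Q R.U Φ ↔
    q ∈ HorizontalModule FQ Q R.U ∧ (∀ y, q (R.incl y) = 0) ∧
      ∀ y, FlatAt FQ Q q (R.incl y) := by
  refine ⟨fun h => ?_, fun h => R.mem_idealSqModule_of_flatAt h.1 h.2.1 h.2.2⟩
  have hone := const_mem_functions (U := R.U)
  induction h using Submodule.span_induction with
  | mem w hw =>
    obtain ⟨f, hf, g, hg, q, hq, rfl⟩ := hw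
    have hf' := equationIdeal_subset_functions hf
    have hg' := equationIdeal_subset_functions hg
    have hgq := smul_mem_horizontalModule hg' hq
    have hz : ∀ y : prolongation Φ, f (R.incl y) = 0 ∧ g (R.incl y) = 0 := fun y =>
      ⟨eq_zero_of_mem_equationIdeal R.isOpen_U hf y.2,
        eq_zero_of_mem_equationIdeal R.isOpen_U hg y.2⟩
    have h1 : (fun θ => (f θ * g θ) • q θ) = fun θ => f θ • g θ • q θ :=
      funext fun θ => mul_smul _ _ _
    rw [h1]
    refine ⟨smul_mem_horizontalModule hf' hgq, fun y => ?_, fun y => ?_⟩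
    · simp only [(hz y).1, zero_smul]
    · exact flatAt_smul R.isOpen_U hf' hgq (by simp only [(hz y).2, zero_smul]) (Or.inl (hz y).1)
  | zero =>
    refine ⟨zero_mem_horizontalModule, fun y => rfl, fun y => ?_⟩
    have := flatAt_pullback R.isOpen_U (0 : Sections E FQ Q) (R.incl y)
    rwa [map_zero] at this
  | add q q' _ _ h h' =>
    exact ⟨add_mem_horizontalModule h.1 h'.1, fun y => by
      rw [Pi.add_apply, h.2.1, h'.2.1, add_zero], fun y => (h.2.2 y).add (h'.2.2 y)⟩
  | smul a q _ h =>
    exact ⟨const_smul_mem_horizontalModule a h.1, fun y => by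
      rw [Pi.smul_apply, h.2.1, smul_zero], fun y =>
        flatAt_smul R.isOpen_U (hone a) h.1 (h.2.1 y) (Or.inr (h.2.2 y))⟩

end Regularity
end JetGeometry

namespace JetGeometry
namespace Regularity

universe uM

variable {E : Type*} [NormedAddCommGroup E] [NormedSpace ℝ E] [FiniteDimensional ℝ E]
  {M : Type uM} [TopologicalSpace M] [ChartedSpace E M] [IsManifold 𝓘(ℝ, E) ∞ M]
  {F : Type*} [NormedAddCommGroup F] [NormedSpace ℝ F] [FiniteDimensional ℝ F]
  {V : M → Type*} [TopologicalSpace (TotalSpace F V)] [∀ x, TopologicalSpace (V x)]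
  [∀ x, AddCommGroup (V x)] [∀ x, Module ℝ (V x)] [FiberBundle F V] [VectorBundle ℝ F V]
  [ContMDiffVectorBundle ∞ F V 𝓘(ℝ, E)]
  {FP : Type*} [NormedAddCommGroup FP] [NormedSpace ℝ FP] [FiniteDimensional ℝ FP]
  {P : M → Type*} [TopologicalSpace (TotalSpace FP P)] [∀ x, TopologicalSpace (P x)]
  [∀ x, AddCommGroup (P x)] [∀ x, Module ℝ (P x)] [FiberBundle FP P] [VectorBundle ℝ FP P]
  [ContMDiffVectorBundle ∞ FP P 𝓘(ℝ, E)]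
  {FQ : Type*} [NormedAddCommGroup FQ] [NormedSpace ℝ FQ] [FiniteDimensional ℝ FQ]
  {Q : M → Type*} [TopologicalSpace (TotalSpace FQ Q)] [∀ x, TopologicalSpace (Q x)]
  [∀ x, AddCommGroup (Q x)] [∀ x, Module ℝ (Q x)] [FiberBundle FQ Q] [VectorBundle ℝ FQ Q]
  [ContMDiffVectorBundle ∞ FQ Q 𝓘(ℝ, E)]
  [T2Space M]
  {Φ : HorizontalModule FP P (Set.univ : Set (InfJet E F V))} (R : Regularity Φ)

variable [SigmaCompactSpace M]

/-! ### The kernel of the restricted linearization -/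

theorem mem_linearizationKernel {q : (θ : R.U) → Q θ.1.base}
    (hq : q ∈ HorizontalModule FQ Q R.U) :
    q ∈ linearizationKernel FQ Q R.prolongation_subset ↔ ∀ y, FlatAt FQ Q q (R.incl y) :=
  mem_linearizationKernel_iff R.isOpen_U R.prolongation_subset hq

theorem flatAt_sub_pullback {q : (θ : R.U) → Q θ.1.base} {θ : R.U} (hq : FlatAt FQ Q q θ)
    (s : Sections E FQ Q) : FlatAt FQ Q (q - pullback FQ Q R.U s) θ := by
  rw [sub_eq_add_neg, ← map_neg]
  exact hq.add (flatAt_pullback R.isOpen_U _ θ)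

/-- If the fibres of the equation over the base are connected, a section that is flat along the
equation agrees on it with a global section over the base. -/
theorem exists_global_section_eq
    (hconn : ∀ x : M, IsConnected {θ | θ ∈ prolongation Φ ∧ θ.base = x})
    {q : (θ : R.U) → Q θ.1.base} (hq : q ∈ HorizontalModule FQ Q R.U)
    (hflat : ∀ y, FlatAt FQ Q q (R.incl y)) :
    ∃ s : Sections E FQ Q, ∀ y, q (R.incl y) = s (R.incl y).1.base := by
  -- `t y` is the local section near `y`, and `z x` a point of the equation over `x`.
  choose t ht using R.exists_section_eq_of_flatAt hq hflat
  have ht' : ∀ y, ∀ᶠ y' in 𝓝 y, q (R.incl y') = t y y'.1.base := fun y =>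
    ((R.continuous_incl.tendsto y).eventually (ht y)).mono fun y' h => h y'.2
  choose y₀ hy₀ using fun x => (hconn x).nonempty
  let z : M → prolongation Φ := fun x => ⟨y₀ x, (hy₀ x).1⟩
  have hz : ∀ x, (z x).1.base = x := fun x => (hy₀ x).2
  -- In the fibre over one base point, `q` is locally constant along the equation.
  have key : ∀ y : prolongation Φ, q (R.incl y) = t (z y.1.base) y.1.base := by
    intro y
    let S : Set (InfJet E F V) := {θ | θ ∈ prolongation Φ ∧ θ.base = y.1.base}
    have : ConnectedSpace S := Subtype.connectedSpace (hconn y.1.base)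
    let i : S → prolongation Φ := fun θ => ⟨θ.1, θ.2.1⟩
    have hi : Continuous i := Continuous.subtype_mk continuous_subtype_val _
    let f : S → FQ := fun θ => fibreCoord FQ Q y.1.base (q (R.incl (i θ)))
    have hf : IsLocallyConstant f := by
      refine (IsLocallyConstant.iff_eventually_eq f).2 fun θ => ?_
      have h1 : ∀ᶠ θ' in 𝓝 θ, f θ' = fibreCoord FQ Q y.1.base (t (i θ) y.1.base) := by
        filter_upwards [(hi.tendsto θ).eventually (ht' (i θ))] with θ' h
        change fibreCoord FQ Q y.1.base (q (R.incl (i θ'))) = _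
        rw [h]
        exact congrArg (fun x => fibreCoord FQ Q y.1.base (t (i θ) x)) θ'.2.2
      filter_upwards [h1] with θ' h2
      rw [h2, h1.self_of_nhds]
    have h1 := hf.apply_eq_of_preconnectedSpace ⟨y.1, y.2, rfl⟩ ⟨y₀ y.1.base, hy₀ y.1.base⟩
    refine fibreCoord_injective FQ Q (FiberBundle.mem_baseSet_trivializationAt' y.1.base) ?_
    refine h1.trans ?_
    change fibreCoord FQ Q y.1.base (q (R.incl (z y.1.base))) = _
    rw [(ht' (z y.1.base)).self_of_nhds]
    exact congrArg (fun x => fibreCoord FQ Q y.1.base (t (z y.1.base) x)) (hz y.1.base)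
  -- The global section `x ↦ t (z x) x` is smooth near `x₀`: as the projection is open, nearby
  -- points `x` lie below points near `z x₀`, where `q` is given by `t (z x₀)`.
  have hloc : ∀ x₀ : M, ∀ᶠ x in 𝓝 x₀, t (z x) x = t (z x₀) x := by
    intro x₀
    have h1 := R.eventually_exists_base_eq (z x₀) (ht' (z x₀))
    rw [hz] at h1
    filter_upwards [h1] with x hx
    obtain ⟨y', hy', rfl⟩ := hx
    exact (key y').symm.trans hy'
  refine ⟨⟨fun x => t (z x) x, fun x₀ => ?_⟩, key⟩
  refine ((t (z x₀)).contMDiff x₀).congr_of_eventuallyEq ?_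
  filter_upwards [hloc x₀] with x hx
  rw [hx]

/-- After subtraction of the pullback with which it agrees on the equation, an element of the kernel
vanishes there to second order. -/
theorem linearizationKernel_eq
    (hconn : ∀ x : M, IsConnected {θ | θ ∈ prolongation Φ ∧ θ.base = x}) :
    linearizationKernel FQ Q R.prolongation_subset =
      ((idealSqModule FQ Q R.U Φ ⊔ LinearMap.range (pullback FQ Q R.U) :
        Submodule ℝ ((θ : R.U) → Q θ.1.base)) : Set ((θ : R.U) → Q θ.1.base)) := by
  ext q
  rw [SetLike.mem_coe, Submodule.mem_sup]
  constructor
  · intro h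
    have hq := h.1
    rw [R.mem_linearizationKernel hq] at h
    obtain ⟨s, hs⟩ := R.exists_global_section_eq hconn hq h
    refine ⟨q - pullback FQ Q R.U s, R.mem_idealSqModule_iff.2
      ⟨sub_mem_horizontalModule hq (pullback_mem_horizontalModule s), fun y => ?_,
        fun y => R.flatAt_sub_pullback (h y) s⟩, _, ⟨s, rfl⟩, sub_add_cancel _ _⟩
    rw [Pi.sub_apply, hs]
    exact sub_self _
  · rintro ⟨a, ha, _, ⟨s, rfl⟩, rfl⟩
    obtain ⟨h1, -, h2⟩ := R.mem_idealSqModule_iff.1 ha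
    exact (R.mem_linearizationKernel
      (add_mem_horizontalModule h1 (pullback_mem_horizontalModule s))).2
        fun y => (h2 y).add (flatAt_pullback R.isOpen_U s _)

/-- An element of `I²Q` determines a section over the base with which it coincides somewhere along
the equation, namely zero: it vanishes on the equation, which is open over the base. -/
theorem eventually_eq_zero_of_eq_pullback {a : (θ : R.U) → Q θ.1.base}
    (ha : a ∈ idealSqModule FQ Q R.U Φ) (s : Sections E FQ Q) (y : prolongation Φ)
    (h : ∀ᶠ θ in 𝓝 (R.incl y), a θ = s θ.1.base) : ∀ᶠ x in 𝓝 y.1.base, s x = 0 := by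
  filter_upwards [R.eventually_exists_base_eq y
    ((R.continuous_incl.tendsto y).eventually h)] with x hx
  obtain ⟨y', hy', rfl⟩ := hx
  exact hy'.symm.trans ((R.mem_idealSqModule_iff.1 ha).2.1 y')

theorem disjoint_idealSqModule_pullback (hne : ∀ x : M, ∃ y : prolongation Φ, y.1.base = x) :
    Disjoint (idealSqModule FQ Q R.U Φ) (LinearMap.range (pullback FQ Q R.U)) := by
  refine Submodule.disjoint_def.2 ?_
  rintro _ ha ⟨s, rfl⟩
  funext θ
  obtain ⟨y, hy⟩ := hne θ.1.base
  have h1 := (R.eventually_eq_zero_of_eq_pullback ha s y (Eventually.of_forall fun _ => rfl))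
    |>.self_of_nhds
  rw [hy] at h1
  exact h1

/-- Without a condition on the fibres, the local section near `y` is used; the difference is cut off
by a function supported where it vanishes on the equation. -/
theorem mem_linearizationKernel_iff_local {q : (θ : R.U) → Q θ.1.base}
    (hq : q ∈ HorizontalModule FQ Q R.U) :
    q ∈ linearizationKernel FQ Q R.prolongation_subset ↔
      ∀ y : prolongation Φ, ∃ a ∈ idealSqModule FQ Q R.U Φ, ∃ s : Sections E FQ Q,
        ∀ᶠ θ in 𝓝 (R.incl y), q θ = a θ + s θ.1.base := by
  rw [R.mem_linearizationKernel hq]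
  constructor
  · intro hflat y
    obtain ⟨s, hs⟩ := R.exists_section_eq_of_flatAt hq hflat y
    obtain ⟨χ, hχ, hχ1, hχ0⟩ := exists_bump_jet hs
    have hp := sub_mem_horizontalModule hq (pullback_mem_horizontalModule s)
    refine ⟨fun θ => χ θ • (q - pullback FQ Q R.U s) θ, R.mem_idealSqModule_iff.2
      ⟨smul_mem_horizontalModule hχ hp, fun y' => ?_, fun y' => ?_⟩, s, ?_⟩
    · by_cases h : q (R.incl y') = s (R.incl y').1.base
      · simp only [Pi.sub_apply, h]
        exact (congrArg _ (sub_self _)).trans (smul_zero _)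
      · simp only [(hχ0 (R.incl y') fun h' => h (h' y'.2)).self_of_nhds, zero_smul]
    · by_cases h : q (R.incl y') = s (R.incl y').1.base
      · exact flatAt_smul R.isOpen_U hχ hp (by rw [Pi.sub_apply, h]; exact sub_self _)
          (Or.inr (R.flatAt_sub_pullback (hflat y') s))
      · have h1 := flatAt_pullback R.isOpen_U (0 : Sections E FQ Q) (R.incl y')
        refine h1.congr R.isOpen_U ?_
        filter_upwards [hχ0 (R.incl y') fun h' => h (h' y'.2)] with θ hθ
        rw [hθ, zero_smul]
        rfl
    · filter_upwards [hχ1] with θ hθ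
      rw [hθ, one_smul]
      exact (sub_add_cancel (q θ) (s θ.1.base)).symm
  · intro h y
    obtain ⟨a, ha, s, hs⟩ := h y
    exact (((R.mem_idealSqModule_iff.1 ha).2.2 y).add
      (flatAt_pullback R.isOpen_U s _)).congr R.isOpen_U hs

end Regularity
end JetGeometry

namespace JetGeometry

universe uM

variable {E : Type*} [NormedAddCommGroup E] [NormedSpace ℝ E] [FiniteDimensional ℝ E]
  {M : Type uM} [TopologicalSpace M] [ChartedSpace E M] [IsManifold 𝓘(ℝ, E) ∞ M]
  {F : Type*} [NormedAddCommGroup F] [NormedSpace ℝ F] [FiniteDimensional ℝ F]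
  {V : M → Type*} [TopologicalSpace (TotalSpace F V)] [∀ x, TopologicalSpace (V x)]
  [∀ x, AddCommGroup (V x)] [∀ x, Module ℝ (V x)] [FiberBundle F V] [VectorBundle ℝ F V]
  [ContMDiffVectorBundle ∞ F V 𝓘(ℝ, E)]
  {FP : Type*} [NormedAddCommGroup FP] [NormedSpace ℝ FP] [FiniteDimensional ℝ FP]
  {P : M → Type*} [TopologicalSpace (TotalSpace FP P)] [∀ x, TopologicalSpace (P x)]
  [∀ x, AddCommGroup (P x)] [∀ x, Module ℝ (P x)] [FiberBundle FP P] [VectorBundle ℝ FP P]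
  [ContMDiffVectorBundle ∞ FP P 𝓘(ℝ, E)]
  {FQ : Type*} [NormedAddCommGroup FQ] [NormedSpace ℝ FQ] [FiniteDimensional ℝ FQ]
  {Q : M → Type*} [TopologicalSpace (TotalSpace FQ Q)] [∀ x, TopologicalSpace (Q x)]
  [∀ x, AddCommGroup (Q x)] [∀ x, Module ℝ (Q x)] [FiberBundle FQ Q] [VectorBundle ℝ FQ Q]
  [ContMDiffVectorBundle ∞ FQ Q 𝓘(ℝ, E)]
  [T2Space M]
  {U : Set (InfJet E F V)}

/-! ### Bidifferential operators -/

section Abstract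

variable {C H₁ H₂ H : Type*} [NormedAddCommGroup C] [NormedSpace ℝ C]
  [NormedAddCommGroup H₁] [NormedSpace ℝ H₁] [NormedAddCommGroup H₂] [NormedSpace ℝ H₂]
  [NormedAddCommGroup H] [NormedSpace ℝ H]

/-- A bilinear expression has zero derivative where both of its arguments vanish. -/
theorem hasFDerivAt_bilinear_zero {a : C → H₁ →L[ℝ] H₂ →L[ℝ] H} {u : C → H₁} {v : C → H₂} {c : C}
    (ha : DifferentiableAt ℝ a c) (hu : DifferentiableAt ℝ u c) (hv : DifferentiableAt ℝ v c)
    (hu0 : u c = 0) (hv0 : v c = 0) : HasFDerivAt (fun c => a c (u c) (v c)) (0 : C →L[ℝ] H) c := by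
  have h := (ha.hasFDerivAt.clm_apply hu.hasFDerivAt).clm_apply hv.hasFDerivAt
  convert h using 1
  ext x
  simp [hu0, hv0]

end Abstract

variable (FP P FQ Q) in
/-- `Δ` is a `𝒞`-differential operator of order `r` whose coefficients depend on jets of order `k`;
the coefficients are collected in one linear map on the jets of total derivatives. -/
def IsCDiffOfOrder (r k : ℕ) (Δ : HorizontalModule FP P U → HorizontalModule FQ Q U) : Prop :=
  ∀ θ₀ : U, ∃ A : JetCoord E F k → JetFibre E FP r →L[ℝ] FQ,
    ContDiff ℝ ∞ A ∧ ∀ᶠ θ in 𝓝 θ₀, ∀ p : HorizontalModule FP P U,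
      fibreCoord FQ Q θ₀.1.base ((Δ p).1 θ) =
        A (coords k θ₀.1.base θ.1) (totalJet FP P r θ₀.1.base p.1 θ)

set_option maxSynthPendingDepth 3 in
variable (FP P FQ Q) in
/-- `Δ` is a bidifferential operator of order `r` in both arguments whose coefficients depend on
jets of order `k`; the coefficients are collected in one bilinear map on the jets of total
derivatives. -/
def IsBiCDiffOfOrder (r k : ℕ)
    (Δ : HorizontalModule FP P U → HorizontalModule FP P U → HorizontalModule FQ Q U) : Prop :=
  ∀ θ₀ : U, ∃ A : JetCoord E F k → JetFibre E FP r →L[ℝ] JetFibre E FP r →L[ℝ] FQ,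
    ContDiff ℝ ∞ A ∧ ∀ᶠ θ in 𝓝 θ₀, ∀ p p' : HorizontalModule FP P U,
      fibreCoord FQ Q θ₀.1.base ((Δ p p').1 θ) =
        A (coords k θ₀.1.base θ.1) (totalJet FP P r θ₀.1.base p.1 θ)
          (totalJet FP P r θ₀.1.base p'.1 θ)

/-- The coefficients of the separate total derivatives are the components of one linear map. -/
theorem isCDiff_iff {Δ : HorizontalModule FP P U → HorizontalModule FQ Q U} :
    IsCDiff FP P FQ Q Δ ↔ ∃ r k, IsCDiffOfOrder FP P FQ Q r k Δ := by
  constructor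
  · rintro ⟨r, k, h⟩
    refine ⟨r, k, fun θ₀ => ?_⟩
    obtain ⟨a, ha, h⟩ := h θ₀
    refine ⟨fun c => ∑ i, (a i c).comp (ContinuousLinearMap.proj (R := ℝ)
      (φ := fun j : Fin (r + 1) => E [×(j : ℕ)]→L[ℝ] FP) i),
        ContDiff.sum fun i _ => (ha i).clm_comp contDiff_const, h.mono fun θ hθ p => ?_⟩
    refine (hθ p).trans ?_
    rw [_root_.sum_apply]
    rfl
  · rintro ⟨r, k, h⟩
    refine ⟨r, k, fun θ₀ => ?_⟩
    obtain ⟨A, hA, h⟩ := h θ₀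
    refine ⟨fun i c => (A c).comp (ContinuousLinearMap.single ℝ
      (fun j : Fin (r + 1) => E [×(j : ℕ)]→L[ℝ] FP) i), fun i => hA.clm_comp contDiff_const,
      h.mono fun θ hθ p => ?_⟩
    exact (hθ p).trans (ContinuousLinearMap.sum_comp_single _ _ (A _) _).symm

set_option maxSynthPendingDepth 3 in
theorem isBiCDiff_iff
    {Δ : HorizontalModule FP P U → HorizontalModule FP P U → HorizontalModule FQ Q U} :
    IsBiCDiff FP P FQ Q Δ ↔ ∃ r k, IsBiCDiffOfOrder FP P FQ Q r k Δ := by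
  constructor
  · rintro ⟨r, k, h⟩
    refine ⟨r, k, fun θ₀ => ?_⟩
    obtain ⟨a, ha, h⟩ := h θ₀
    let ρ (i : Fin (r + 1)) : JetFibre E FP r →L[ℝ] (E [×(i : ℕ)]→L[ℝ] FP) :=
      ContinuousLinearMap.proj (R := ℝ) (φ := fun j : Fin (r + 1) => E [×(j : ℕ)]→L[ℝ] FP) i
    refine ⟨fun c => ∑ i, ∑ j, ((ρ j).precomp FQ).comp ((a i j c).comp (ρ i)),
      ContDiff.sum fun i _ => ContDiff.sum fun j _ =>
        contDiff_const.clm_comp ((ha i j).clm_comp contDiff_const), h.mono fun θ hθ p p' => ?_⟩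
    refine (hθ p p').trans ?_
    simp only [_root_.sum_apply]
    rfl
  · rintro ⟨r, k, h⟩
    refine ⟨r, k, fun θ₀ => ?_⟩
    obtain ⟨A, hA, h⟩ := h θ₀
    let σ (i : Fin (r + 1)) : (E [×(i : ℕ)]→L[ℝ] FP) →L[ℝ] JetFibre E FP r :=
      ContinuousLinearMap.single ℝ (fun j : Fin (r + 1) => E [×(j : ℕ)]→L[ℝ] FP) i
    refine ⟨fun i j c => ((σ j).precomp FQ).comp ((A c).comp (σ i)), fun i j =>
      contDiff_const.clm_comp (hA.clm_comp contDiff_const), h.mono fun θ hθ p p' => ?_⟩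
    refine (hθ p p').trans ?_
    have h1 : ∀ (L : JetFibre E FP r →L[ℝ] FQ) (v : JetFibre E FP r),
        L v = ∑ j, L (σ j (v j)) := fun L v =>
      (ContinuousLinearMap.sum_comp_single _ _ L v).symm
    have h2 : ∀ (L : JetFibre E FP r →L[ℝ] JetFibre E FP r →L[ℝ] FQ) (v : JetFibre E FP r),
        L v = ∑ j, L (σ j (v j)) := fun L v =>
      (ContinuousLinearMap.sum_comp_single _ _ L v).symm
    rw [h2, _root_.sum_apply]
    refine Finset.sum_congr rfl fun i _ => ?_
    rw [h1]
    rfl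

theorem IsCDiffOfOrder.mono {r k r' k' : ℕ} (hr : r ≤ r') (hk : k ≤ k')
    {Δ : HorizontalModule FP P U → HorizontalModule FQ Q U}
    (h : IsCDiffOfOrder FP P FQ Q r k Δ) : IsCDiffOfOrder FP P FQ Q r' k' Δ := fun θ₀ => by
  obtain ⟨A, hA, h⟩ := h θ₀
  exact ⟨fun c => (A (coordTrunc E F hk c)).comp (jetTrunc E FP hr),
    (hA.comp (coordTrunc E F hk).contDiff).clm_comp contDiff_const, h⟩

set_option maxSynthPendingDepth 3 in
theorem IsBiCDiffOfOrder.mono {r k r' k' : ℕ} (hr : r ≤ r') (hk : k ≤ k')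
    {Δ : HorizontalModule FP P U → HorizontalModule FP P U → HorizontalModule FQ Q U}
    (h : IsBiCDiffOfOrder FP P FQ Q r k Δ) : IsBiCDiffOfOrder FP P FQ Q r' k' Δ := fun θ₀ => by
  obtain ⟨A, hA, h⟩ := h θ₀
  exact ⟨fun c => ((jetTrunc E FP hr).precomp FQ).comp
      ((A (coordTrunc E F hk c)).comp (jetTrunc E FP hr)),
    contDiff_const.clm_comp ((hA.comp (coordTrunc E F hk).contDiff).clm_comp contDiff_const), h⟩

set_option maxSynthPendingDepth 3 in
theorem isBiCDiff_add
    {Δ Δ' : HorizontalModule FP P U → HorizontalModule FP P U → HorizontalModule FQ Q U}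
    (h : IsBiCDiff FP P FQ Q Δ) (h' : IsBiCDiff FP P FQ Q Δ') :
    IsBiCDiff FP P FQ Q fun p p' =>
      ⟨(Δ p p').1 + (Δ' p p').1, add_mem_horizontalModule (Δ p p').2 (Δ' p p').2⟩ := by
  obtain ⟨r, k, h⟩ := isBiCDiff_iff.1 h
  obtain ⟨r', k', h'⟩ := isBiCDiff_iff.1 h'
  refine isBiCDiff_iff.2 ⟨max r r', max k k', fun θ₀ => ?_⟩
  obtain ⟨A, hA, h⟩ := h.mono (le_max_left r r') (le_max_left k k') θ₀
  obtain ⟨A', hA', h'⟩ := h'.mono (le_max_right r r') (le_max_right k k') θ₀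
  refine ⟨fun c => A c + A' c, hA.add hA', ?_⟩
  filter_upwards [h, h', eventually_mem_baseSet (FP := FQ) (P := Q) θ₀] with θ h1 h2 h3 p p'
  refine (fibreCoord_add FQ Q h3 _ _).trans ?_
  rw [h1, h2]
  rfl

set_option maxSynthPendingDepth 3 in
theorem isBiCDiff_const_smul (t : ℝ)
    {Δ : HorizontalModule FP P U → HorizontalModule FP P U → HorizontalModule FQ Q U}
    (h : IsBiCDiff FP P FQ Q Δ) :
    IsBiCDiff FP P FQ Q fun p p' =>
      ⟨t • (Δ p p').1, const_smul_mem_horizontalModule t (Δ p p').2⟩ := by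
  obtain ⟨r, k, h⟩ := isBiCDiff_iff.1 h
  refine isBiCDiff_iff.2 ⟨r, k, fun θ₀ => ?_⟩
  obtain ⟨A, hA, h⟩ := h θ₀
  refine ⟨fun c => t • A c, hA.const_smul t, ?_⟩
  filter_upwards [h, eventually_mem_baseSet (FP := FQ) (P := Q) θ₀] with θ h1 h3 p p'
  refine (fibreCoord_smul FQ Q h3 _ _).trans ?_
  rw [h1]
  rfl

set_option maxSynthPendingDepth 3 in
theorem isBiCDiff_zero : IsBiCDiff FP P FQ Q
    fun _ _ : HorizontalModule FP P U => ⟨0, zero_mem_horizontalModule⟩ := by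
  refine isBiCDiff_iff.2 ⟨0, 0, fun θ₀ => ⟨fun _ => 0, contDiff_const, ?_⟩⟩
  filter_upwards [eventually_mem_baseSet (FP := FQ) (P := Q) θ₀] with θ h3 p p'
  exact fibreCoord_zero FQ Q h3

set_option maxSynthPendingDepth 3 in
/-- The product of two scalar operators, applied to separate arguments, with a section. -/
theorem IsCDiff.mul_smul {Δ Δ' : HorizontalModule FP P U → Functions U}
    (h : IsCDiff FP P ℝ (Bundle.Trivial M ℝ) Δ) (h' : IsCDiff FP P ℝ (Bundle.Trivial M ℝ) Δ')
    (q : HorizontalModule FQ Q U) :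
    IsBiCDiff FP P FQ Q fun p p' => ⟨fun θ => (Δ p).1 θ • (Δ' p').1 θ • q.1 θ,
      smul_mem_horizontalModule (Δ p).2 (smul_mem_horizontalModule (Δ' p').2 q.2)⟩ := by
  obtain ⟨r, k, h⟩ := isCDiff_iff.1 h
  obtain ⟨r', k', h'⟩ := isCDiff_iff.1 h'
  obtain ⟨m, hm⟩ := q.2
  refine isBiCDiff_iff.2 ⟨max r r', max (max k k') m, fun θ₀ => ?_⟩
  obtain ⟨A, hA, h⟩ := h.mono (le_max_left r r')
    ((le_max_left k k').trans (le_max_left _ m)) θ₀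
  obtain ⟨A', hA', h'⟩ := h'.mono (le_max_right r r')
    ((le_max_right k k').trans (le_max_left _ m)) θ₀
  obtain ⟨G, hG, hq⟩ := SmoothOfOrder.mono (le_max_right (max k k') m) hm θ₀
  refine ⟨fun c => (A c).smulRight ((A' c).smulRight (G c)), hA.smulRight (hA'.smulRight hG), ?_⟩
  filter_upwards [h, h', hq, eventually_mem_baseSet (FP := FQ) (P := Q) θ₀] with θ h1 h2 h4 h3 p p'
  refine (fibreCoord_smul FQ Q h3 _ _).trans ?_
  rw [fibreCoord_smul FQ Q h3, h4]
  have h5 : (Δ p).1 θ = _ := h1 p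
  have h6 : (Δ' p').1 θ = _ := h2 p'
  rw [h5, h6]
  rfl

variable {Φ : HorizontalModule FP P (Set.univ : Set (InfJet E F V))}

/-- A generator `Δ(F) Δ'(F) q` is the value at `(F, F)` of the bidifferential operator `(p, p') ↦
Δ(p) Δ'(p') q`, and bidifferential operators are closed under linear combinations. -/
theorem exists_isBiCDiff_of_mem_idealSqModule {w : (θ : U) → Q θ.1.base}
    (hw : w ∈ idealSqModule FQ Q U Φ) :
    ∃ Δ : HorizontalModule FP P U → HorizontalModule FP P U → HorizontalModule FQ Q U,
      IsBiCDiff FP P FQ Q Δ ∧ w = (Δ (restrict FP P U Φ) (restrict FP P U Φ)).1 := by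
  induction hw using Submodule.span_induction with
  | mem w hw =>
    obtain ⟨_, ⟨Δ, hΔ, rfl⟩, _, ⟨Δ', hΔ', rfl⟩, q, hq, rfl⟩ := hw
    exact ⟨_, hΔ.mul_smul hΔ' ⟨q, hq⟩, funext fun θ => mul_smul _ _ _⟩
  | zero => exact ⟨_, isBiCDiff_zero, rfl⟩
  | add w w' _ _ h h' =>
    obtain ⟨Δ, hΔ, rfl⟩ := h
    obtain ⟨Δ', hΔ', rfl⟩ := h'
    exact ⟨_, isBiCDiff_add hΔ hΔ', rfl⟩
  | smul t w _ h =>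
    obtain ⟨Δ, hΔ, rfl⟩ := h
    exact ⟨_, isBiCDiff_const_smul t hΔ, rfl⟩

set_option maxSynthPendingDepth 3 in
/-- The value of a bidifferential operator on the section defining the equation vanishes to second
order along the prolonged equation, as both of its arguments vanish there. -/
theorem IsBiCDiff.eq_zero_and_flatAt (hU : IsOpen U)
    {Δ : HorizontalModule FP P U → HorizontalModule FP P U → HorizontalModule FQ Q U}
    (h : IsBiCDiff FP P FQ Q Δ) {θ₀ : U} (hθ : θ₀.1 ∈ prolongation Φ) :
    (Δ (restrict FP P U Φ) (restrict FP P U Φ)).1 θ₀ = 0 ∧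
      FlatAt FQ Q (Δ (restrict FP P U Φ) (restrict FP P U Φ)).1 θ₀ := by
  obtain ⟨r, k, h⟩ := isBiCDiff_iff.1 h
  obtain ⟨A, hA, h⟩ := h θ₀
  have hx := mem_coordDomain_self (E := E) F V θ₀.1.base
  have hxQ := FiberBundle.mem_baseSet_trivializationAt' (F := FQ) (E := Q) θ₀.1.base
  obtain ⟨m, hm⟩ := (restrict FP P U Φ).2
  obtain ⟨T, hT, hT'⟩ := smoothThrough_totalJet hU hm r (x₁ := θ₀.1.base) hx
    (FiberBundle.mem_baseSet_trivializationAt' θ₀.1.base)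
  have h0 : totalJet FP P r θ₀.1.base (restrict FP P U Φ).1 θ₀ = 0 := by
    rw [totalJet_restrict hU Φ r _ θ₀ (mem_chart_source E _)]
    exact funext fun i => hθ i
  have h1 := h.self_of_nhds (restrict FP P U Φ) (restrict FP P U Φ)
  rw [h0, map_zero] at h1
  refine ⟨fibreCoord_injective FQ Q hxQ (h1.trans (fibreCoord_zero FQ Q hxQ).symm), fun t => ?_⟩
  have hk₁ : k ≤ max k (m + r) := le_max_left _ _
  have hk₂ : m + r ≤ max k (m + r) := le_max_right _ _
  let a : JetCoord E F (max k (m + r)) → JetFibre E FP r →L[ℝ] JetFibre E FP r →L[ℝ] FQ :=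
    fun c => A (coordTrunc E F hk₁ c)
  let u : JetCoord E F (max k (m + r)) → JetFibre E FP r := fun c => T (coordTrunc E F hk₂ c)
  have ha : ContDiff ℝ ∞ a := hA.comp (coordTrunc E F hk₁).contDiff
  have hu : ContDiff ℝ ∞ u := hT.comp (coordTrunc E F hk₂).contDiff
  have hu0 : u (coords (max k (m + r)) θ₀.1.base θ₀.1) = 0 := hT'.self_of_nhds.symm.trans h0
  have h2 : ∀ᶠ θ in 𝓝 θ₀.1, extendCoord FQ θ₀.1.base
      (Δ (restrict FP P U Φ) (restrict FP P U Φ)).1 θ =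
        (fun c => a c (u c) (u c)) (coords (max k (m + r)) θ₀.1.base θ) := by
    refine eventually_subtype hU ?_
    filter_upwards [h, hT'] with θ h3 h4
    rw [extendCoord_of_mem, h3, h4]
    rfl
  have h3 := hasFDerivAt_bilinear_zero (ha.differentiable (by simp) _)
    (hu.differentiable (by simp) _) (hu.differentiable (by simp) _) hu0 hu0
  have h4 := hasDerivAt_vertical hx ((ha.clm_apply hu).clm_apply hu) h2 t
  rw [h3.fderiv] at h4
  exact h4

end JetGeometry

theorem mainTheorem8
    {E : Type*} [NormedAddCommGroup E] [NormedSpace ℝ E] [FiniteDimensional ℝ E]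
    {M : Type*} [TopologicalSpace M] [ChartedSpace E M] [IsManifold 𝓘(ℝ, E) ∞ M]
    [T2Space M] [SigmaCompactSpace M]
    -- the vector bundle `π` with typical fibre `F`
    {F : Type*} [NormedAddCommGroup F] [NormedSpace ℝ F] [FiniteDimensional ℝ F]
    {V : M → Type*} [TopologicalSpace (TotalSpace F V)] [∀ x, TopologicalSpace (V x)]
    [∀ x, AddCommGroup (V x)] [∀ x, Module ℝ (V x)] [FiberBundle F V] [VectorBundle ℝ F V]
    [ContMDiffVectorBundle ∞ F V 𝓘(ℝ, E)]
    -- the vector bundle `α₁`, with `P₁` the horizontal module of `P`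
    {FP : Type*} [NormedAddCommGroup FP] [NormedSpace ℝ FP] [FiniteDimensional ℝ FP]
    {P : M → Type*} [TopologicalSpace (TotalSpace FP P)] [∀ x, TopologicalSpace (P x)]
    [∀ x, AddCommGroup (P x)] [∀ x, Module ℝ (P x)] [FiberBundle FP P] [VectorBundle ℝ FP P]
    [ContMDiffVectorBundle ∞ FP P 𝓘(ℝ, E)]
    -- the vector bundle `α`
    {FQ : Type*} [NormedAddCommGroup FQ] [NormedSpace ℝ FQ] [FiniteDimensional ℝ FQ]
    {Q : M → Type*} [TopologicalSpace (TotalSpace FQ Q)] [∀ x, TopologicalSpace (Q x)]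
    [∀ x, AddCommGroup (Q x)] [∀ x, Module ℝ (Q x)] [FiberBundle FQ Q] [VectorBundle ℝ FQ Q]
    [ContMDiffVectorBundle ∞ FQ Q 𝓘(ℝ, E)]
    -- the section `Φ ∈ P₁` defining the equation, and the regularity condition
    (Φ : JetGeometry.HorizontalModule FP P (Set.univ : Set (JetGeometry.InfJet E F V)))
    (R : JetGeometry.Regularity Φ) :
    -- the kernel of `q ↦ ℓ_q|_𝓔^∞` is `I²Q ⊕ Q'`
    ((∀ x : M, IsConnected {θ | θ ∈ JetGeometry.prolongation Φ ∧ θ.base = x}) →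
      JetGeometry.linearizationKernel FQ Q R.prolongation_subset =
          ((JetGeometry.idealSqModule FQ Q R.U Φ ⊔
            LinearMap.range (JetGeometry.pullback FQ Q R.U) :
              Submodule ℝ ((θ : R.U) → Q θ.1.base)) : Set ((θ : R.U) → Q θ.1.base)) ∧
        Disjoint (JetGeometry.idealSqModule FQ Q R.U Φ)
          (LinearMap.range (JetGeometry.pullback FQ Q R.U))) ∧
    -- without the assumption on the fibres, the same holds locally along `𝓔^∞`
    (∀ q ∈ JetGeometry.HorizontalModule FQ Q R.U,
      q ∈ JetGeometry.linearizationKernel FQ Q R.prolongation_subset ↔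
        ∀ θ₀ : R.U, θ₀.1 ∈ JetGeometry.prolongation Φ →
          ∃ a ∈ JetGeometry.idealSqModule FQ Q R.U Φ, ∃ s : JetGeometry.Sections E FQ Q,
            ∀ᶠ θ in 𝓝 θ₀, q θ = a θ + s θ.1.base) ∧
    (∀ θ₀ : R.U, θ₀.1 ∈ JetGeometry.prolongation Φ →
      ∀ a ∈ JetGeometry.idealSqModule FQ Q R.U Φ, ∀ s : JetGeometry.Sections E FQ Q,
        (∀ᶠ θ in 𝓝 θ₀, a θ = s θ.1.base) → ∀ᶠ x in 𝓝 θ₀.1.base, s x = 0) ∧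
    -- `I²Q` consists of the elements `Δ(F, F)`
    ((JetGeometry.idealSqModule FQ Q R.U Φ : Set ((θ : R.U) → Q θ.1.base)) =
      {w | ∃ Δ : JetGeometry.HorizontalModule FP P R.U → JetGeometry.HorizontalModule FP P R.U →
          JetGeometry.HorizontalModule FQ Q R.U, JetGeometry.IsBiCDiff FP P FQ Q Δ ∧
        w = (Δ (JetGeometry.restrict FP P R.U Φ) (JetGeometry.restrict FP P R.U Φ)).1}) := by
  refine ⟨fun hconn => ⟨R.linearizationKernel_eq hconn,
    R.disjoint_idealSqModule_pullback fun x => ?_⟩, fun q hq => ?_, fun θ₀ hθ₀ a ha s h => ?_, ?_⟩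
  · obtain ⟨y, hy, hyx⟩ := (hconn x).nonempty
    exact ⟨⟨y, hy⟩, hyx⟩
  · rw [R.mem_linearizationKernel_iff_local hq]
    exact ⟨fun h θ₀ hθ₀ => h ⟨θ₀.1, hθ₀⟩, fun h y => h (R.incl y) y.2⟩
  · exact R.eventually_eq_zero_of_eq_pullback ha s ⟨θ₀.1, hθ₀⟩ h
  · refine Set.Subset.antisymm (fun w hw => JetGeometry.exists_isBiCDiff_of_mem_idealSqModule hw) ?_
    rintro _ ⟨Δ, hΔ, rfl⟩
    exact R.mem_idealSqModule_iff.2 ⟨(Δ _ _).2,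
      fun y => (hΔ.eq_zero_and_flatAt R.isOpen_U y.2).1,
      fun y => (hΔ.eq_zero_and_flatAt R.isOpen_U y.2).2⟩
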